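/- Theorem 3.2. Let $G$ be a connected complex reductive linear algebraic group, i.e. a Zariski-closed, Zariski-connected subgroup of some $GL_n(\mathbb C)$ all of whose finite-dimensional rational representations are completely reducible. Let $G_c$ be a maximal compact subgroup of $G$, let $W$ be a finite-dimensional complex vector space with its usual topology, and let $G$ act on $W$ by a rational representation (one whose matrix coefficients are regular functions on $G$). An algebraic group homomorphism $\lambda:\mathbb C^*\to G$ is called a special one-parameter subgroup if $\lambda(S^1)\subset G_c$, where $S^1=\{z\in\mathbb C^* : |z|=1\}$. A point $w\neq 0$ of $W$ is called stable if its orbit $G\cdot w$ is closed in $W$. Let $w\in W$ with $w\neq 0$. Then $w$ is stable if and only if there exists a point $w'\in G\cdot w$ such that, for every special one-parameter subgroup $\lambda$ of $G$, the orbit $\lambda(\mathbb C^*)\cdot w'$ is closed in $W$. -/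

import Mathlib

/-!
Complex linear algebraic groups are realised as Zariski-closed subgroups `G` of `GL_n(ℂ)`.
All notions below (regular functions, connectedness, reductivity, maximal compact subgroups)
depend only on the algebraic group `G` and not on the chosen embedding.
-/

namespace LinAlgGrp

/-- A subset of `GL_n(ℂ)` is Zariski closed if it is cut out, inside `GL_n(ℂ)`, by a set of
polynomials in the matrix entries. (Allowing `det⁻¹` in the equations gives the same sets, since
one can clear denominators.) -/
def IsZariskiClosed {n : ℕ} (A : Set (Matrix.GeneralLinearGroup (Fin n) ℂ)) : Prop :=
  ∃ S : Set (MvPolynomial (Fin n × Fin n) ℂ), ∀ g : Matrix.GeneralLinearGroup (Fin n) ℂ,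
    g ∈ A ↔ ∀ p ∈ S, MvPolynomial.eval
      (fun ij : Fin n × Fin n => (g : Matrix (Fin n) (Fin n) ℂ) ij.1 ij.2) p = 0

/-- `G` is connected in the Zariski topology: it is not covered by two Zariski-closed sets which
are disjoint on `G`, unless one of them already contains `G`. -/
def IsZariskiConnected {n : ℕ} (G : Subgroup (Matrix.GeneralLinearGroup (Fin n) ℂ)) : Prop :=
  ∀ A B : Set (Matrix.GeneralLinearGroup (Fin n) ℂ), IsZariskiClosed A → IsZariskiClosed B →
    (G : Set (Matrix.GeneralLinearGroup (Fin n) ℂ)) ⊆ A ∪ B →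
    (G : Set (Matrix.GeneralLinearGroup (Fin n) ℂ)) ∩ (A ∩ B) = ∅ →
    (G : Set (Matrix.GeneralLinearGroup (Fin n) ℂ)) ⊆ A ∨
      (G : Set (Matrix.GeneralLinearGroup (Fin n) ℂ)) ⊆ B

/-- The coordinate ring of `G`, as an algebra of functions on `G`: it is generated by the matrix
entries and by `det⁻¹`. -/
def regularFunctions {n : ℕ} (G : Subgroup (Matrix.GeneralLinearGroup (Fin n) ℂ)) :
    Subalgebra ℂ (G → ℂ) :=
  Algebra.adjoin ℂ
    (Set.range (fun (ij : Fin n × Fin n) (g : G) =>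
        ((g : Matrix.GeneralLinearGroup (Fin n) ℂ) : Matrix (Fin n) (Fin n) ℂ) ij.1 ij.2) ∪
      {fun g : G =>
        ((g : Matrix.GeneralLinearGroup (Fin n) ℂ) : Matrix (Fin n) (Fin n) ℂ).det⁻¹})

/-- The coordinate ring `ℂ[z, z⁻¹]` of the one-dimensional torus `ℂ*`, as an algebra of functions
on `ℂ*`. -/
def regularFunctionsTorus : Subalgebra ℂ (ℂˣ → ℂ) :=
  Algebra.adjoin ℂ {fun z : ℂˣ => (z : ℂ), fun z : ℂˣ => (z : ℂ)⁻¹}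

/-- A representation of `G` is rational (a representation of the algebraic group `G`) if all its
matrix coefficients are regular functions on `G`. -/
def IsRational {n : ℕ} {G : Subgroup (Matrix.GeneralLinearGroup (Fin n) ℂ)}
    {W : Type*} [AddCommGroup W] [Module ℂ W] (ρ : Representation ℂ G W) : Prop :=
  ∀ (φ : Module.Dual ℂ W) (w : W), (fun g : G => φ (ρ g w)) ∈ regularFunctions G

/-- `G` is a reductive algebraic group: it is Zariski closed in `GL_n(ℂ)` and each of its
finite-dimensional rational representations is completely reducible. -/
structure IsReductive {n : ℕ} (G : Subgroup (Matrix.GeneralLinearGroup (Fin n) ℂ)) : Prop where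
  isZariskiClosed : IsZariskiClosed (G : Set (Matrix.GeneralLinearGroup (Fin n) ℂ))
  isSemisimple : ∀ (m : ℕ) (σ : Representation ℂ G (Fin m → ℂ)), IsRational σ →
    σ.IsSemisimpleRepresentation

/-- `K` is maximal among the subgroups of `G` which are compact for the classical topology. -/
def IsMaximalCompact {n : ℕ} (G K : Subgroup (Matrix.GeneralLinearGroup (Fin n) ℂ)) : Prop :=
  Maximal (fun H : Subgroup (Matrix.GeneralLinearGroup (Fin n) ℂ) =>
    H ≤ G ∧ IsCompact (H : Set (Matrix.GeneralLinearGroup (Fin n) ℂ))) K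

/-- A group homomorphism `l : ℂ* → G` is algebraic if it pulls regular functions on `G` back to
regular functions on `ℂ*`. -/
def IsAlgebraicOneParam {n : ℕ} {G : Subgroup (Matrix.GeneralLinearGroup (Fin n) ℂ)}
    (l : ℂˣ →* G) : Prop :=
  ∀ f ∈ regularFunctions G, (fun z : ℂˣ => f (l z)) ∈ regularFunctionsTorus

/-- A special one-parameter subgroup of `G` with respect to `K`: an algebraic homomorphism
`l : ℂ* → G` with `l(S¹) ⊆ K`. -/
def IsSpecialOneParam {n : ℕ} {G : Subgroup (Matrix.GeneralLinearGroup (Fin n) ℂ)}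
    (K : Subgroup (Matrix.GeneralLinearGroup (Fin n) ℂ)) (l : ℂˣ →* G) : Prop :=
  IsAlgebraicOneParam l ∧
    ∀ z : ℂˣ, ‖(z : ℂ)‖ = 1 → (l z : Matrix.GeneralLinearGroup (Fin n) ℂ) ∈ K

/-- The orbit `G · w`. -/
def orbit {n : ℕ} {G : Subgroup (Matrix.GeneralLinearGroup (Fin n) ℂ)}
    {W : Type*} [AddCommGroup W] [Module ℂ W] (ρ : Representation ℂ G W) (w : W) : Set W :=
  Set.range (fun g : G => ρ g w)

/-- A point `w` is stable if `w ≠ 0` and its orbit `G · w` is closed. -/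
def IsStable {n : ℕ} {G : Subgroup (Matrix.GeneralLinearGroup (Fin n) ℂ)}
    {W : Type*} [AddCommGroup W] [Module ℂ W] [TopologicalSpace W]
    (ρ : Representation ℂ G W) (w : W) : Prop :=
  w ≠ 0 ∧ IsClosed (orbit ρ w)

end LinAlgGrp

/-!
Choose a Hermitian norm on `W` invariant under the maximal compact subgroup `K` (average over Haar
measure, `exists_unitarization`). Along a one-parameter group of `G` whose compact part acts
isometrically, the squared norm of an orbit is a sum `∑ exp (2 t μ) ‖y_μ‖ ^ 2` over the weights `μ`
(`norm_sq_expSum`), hence convex in `t`. Both directions rest on this convexity.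

If the orbit of `w` is closed, it contains a vector `w'` of minimal norm. By convexity, for every
special one-parameter subgroup, either `w'` is fixed or both positive and negative weights occur in
`w'`; in either case its orbit under the one-parameter subgroup is closed
(`isClosed_range_of_norm_minimal`).

For the converse one needs the structure of `G`: after conjugation in `GL_n(ℂ)`, the group `G` is
stable under the polar decomposition and `K` is its unitary part (`IsReductive.exists_conj_polar`).
To see this, realise `G` as the stabiliser of a vector `v` with closed orbit in a rational
representation of `GL_n(ℂ)` (`IsReductive.exists_closed_orbit`): `v` is evaluation at the identity
on a finite-dimensional space of functions which generates the right `G`-invariant regular functions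
on `GL_n(ℂ)`.
That the invariants are finitely generated (Hilbert), separate `G` from its cosets, and have values
at limits which are attained on `GL_n(ℂ)` (Nullstellensatz), all follows from complete reducibility,
used in the form that invariants lift along equivariant surjections
(`IsReductive.exists_fixed_lift`). At a vector of minimal norm in the orbit of `v`, convexity shows
that the stabiliser contains the Hermitian part of each of its elements. Choosing the
conjugating element closest to being unitary among the minimisers makes `K` unitary.

Now assume that all special one-parameter subgroups have closed orbit through `w'`. A limit of orbit
points is a limit of `g_j w'` with `g_j` of almost minimal operator-norm size modulo the stabiliser
of `w'`. If the sizes are bounded, a subsequence of the `g_j` converges. Otherwise the Hermitian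
parts `exp p_j` of the `g_j` have a limit direction `p`, and by convexity `exp (t p) w'` is bounded
for `t ≥ 0`. Approximating `p` by an integral direction inside its Zariski closure gives a special
one-parameter subgroup driving `w'` to the same limit as `exp (t p)`, and since its orbit is closed,
`exp (t p)` fixes `w'` (`oneParam_fix_of_bounded`). Then `g_j exp (-2 p)` represents the same point
as `g_j` with a size smaller by a factor of about `exp 2`, a contradiction
(`isClosed_orbit_of_isClosed_oneParam`).
-/

namespace LinAlgGrp

/-! ### Exponential sums -/

section

open Filter Topology

/-- Exponentials `t ↦ exp (a t μ)` with distinct exponents are linearly independent over `ℂ`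
(Dedekind), so a vanishing exponential sum has vanishing total coefficient at every exponent. -/
theorem sum_filter_eq_zero_of_exp_sum_eq_zero {α : Type*} (s : Finset α) (e : α → ℝ)
    (c : α → ℂ) {a : ℂ} (ha : a ≠ 0)
    (h : ∀ t : ℝ, ∑ β ∈ s, Complex.exp (a * t * e β) * c β = 0) (μ : ℝ) :
    ∑ β ∈ s with e β = μ, c β = 0 := by
  let ψ : ℝ → (Multiplicative ℝ →* ℂ) := fun δ =>
    { toFun := fun t => Complex.exp (a * (Multiplicative.toAdd t : ℝ) * δ)
      map_one' := by simp
      map_mul' := fun x y => by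
        rw [← Complex.exp_add, toAdd_mul]; push_cast; ring_nf }
  have hψ : Function.Injective ψ := by
    intro δ δ' hd
    have h1 : ∀ δ : ℝ, HasDerivAt (fun t : ℝ => Complex.exp (a * t * δ)) (a * δ) 0 := by
      intro δ
      have : HasDerivAt (fun t : ℝ => a * (t : ℂ) * δ) (a * 1 * δ) 0 :=
        ((Complex.ofRealCLM.hasDerivAt (x := 0)).const_mul a).mul_const (δ : ℂ)
      simpa using this.cexp
    have h2 : (fun t : ℝ => Complex.exp (a * t * δ)) = fun t : ℝ => Complex.exp (a * t * δ') := by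
      funext t
      exact DFunLike.congr_fun hd (Multiplicative.ofAdd t)
    have h3 := (h1 δ).unique (h2 ▸ h1 δ')
    exact_mod_cast mul_left_cancel₀ ha h3
  have hli := (linearIndependent_monoidHom (Multiplicative ℝ) ℂ).comp ψ hψ
  rw [linearIndependent_iff'] at hli
  by_cases hμ : μ ∈ s.image e
  · refine hli (s.image e) (fun μ => ∑ β ∈ s with e β = μ, c β) ?_ μ hμ
    funext t
    simp only [Function.comp_apply, Finset.sum_apply, Pi.smul_apply, smul_eq_mul, Pi.zero_apply]
    rw [← h (Multiplicative.toAdd t), ← Finset.sum_fiberwise_of_maps_to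
      (fun x hx => Finset.mem_image_of_mem e hx)]
    refine Finset.sum_congr rfl fun μ _ => ?_
    rw [Finset.sum_mul]
    refine Finset.sum_congr rfl fun β hβ => ?_
    rw [(Finset.mem_filter.mp hβ).2, mul_comm]
    rfl
  · rw [Finset.filter_false_of_mem, Finset.sum_empty]
    rintro β hβ rfl
    exact hμ (Finset.mem_image_of_mem e hβ)

/-- The exponential sum `∑ μ ∈ s, exp (z μ) y_μ` with real exponents and vector coefficients. -/
noncomputable def expSum {V : Type*} [AddCommGroup V] [Module ℂ V] (s : Finset ℝ) (y : ℝ → V)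
    (z : ℂ) : V := ∑ μ ∈ s, Complex.exp (z * μ) • y μ

section

variable {V : Type*} [NormedAddCommGroup V] [InnerProductSpace ℂ V]

/-- If the norm of `∑ exp (i θ μ) y_μ` does not depend on `θ`, its square is the constant term
of the expansion of the squared norm, that is `∑ ‖y_μ‖ ^ 2`. -/
theorem sq_eq_sum_of_norm_expSum_eq (s : Finset ℝ) (y : ℝ → V) (C : ℝ)
    (h : ∀ θ : ℝ, ‖expSum s y (Complex.I * θ)‖ = C) : C ^ 2 = ∑ μ ∈ s, ‖y μ‖ ^ 2 := by
  let e : Option (ℝ × ℝ) → ℝ := fun o => o.elim 0 (fun p => p.1 - p.2)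
  let c : Option (ℝ × ℝ) → ℂ := fun o => o.elim (-(C : ℂ) ^ 2) (fun p => inner ℂ (y p.2) (y p.1))
  have key := sum_filter_eq_zero_of_exp_sum_eq_zero (Finset.insertNone (s ×ˢ s)) e c
    Complex.I_ne_zero (fun t => by
      rw [Finset.sum_insertNone]
      have h1 : (C : ℂ) ^ 2 = inner ℂ (expSum s y (Complex.I * t)) (expSum s y (Complex.I * t)) := by
        rw [inner_self_eq_norm_sq_to_K, h t]; rfl
      have h2 : inner ℂ (expSum s y (Complex.I * t)) (expSum s y (Complex.I * t)) =
          ∑ p ∈ s ×ˢ s, Complex.exp (Complex.I * t * e (some p)) * c (some p) := by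
        rw [Finset.sum_product]
        simp only [expSum, sum_inner, inner_sum, inner_smul_left, inner_smul_right, Finset.mul_sum]
        refine Finset.sum_congr rfl fun μ _ => Finset.sum_congr rfl fun ν _ => ?_
        simp only [e, c, Option.elim_some]
        rw [← mul_assoc, ← Complex.exp_conj, ← Complex.exp_add]
        congr 2
        simp only [map_mul, Complex.conj_I, Complex.conj_ofReal]
        push_cast
        ring
      rw [← h2, ← h1]
      simp [e, c]) 0
  rw [Finset.sum_filter, Finset.sum_insertNone, Finset.sum_product] at key
  simp only [e, c, Option.elim_some, Option.elim_none, if_true, sub_eq_zero] at key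
  have h3 : ∀ μ ∈ s, (∑ ν ∈ s, if μ = ν then inner ℂ (y ν) (y μ) else 0) = ((‖y μ‖ ^ 2 : ℝ) : ℂ) := by
    intro μ hμ
    rw [Finset.sum_ite_eq s μ, if_pos hμ, inner_self_eq_norm_sq_to_K]
    push_cast
    rfl
  rw [Finset.sum_congr rfl h3, ← Complex.ofReal_sum] at key
  have h4 : ((∑ μ ∈ s, ‖y μ‖ ^ 2 : ℝ) : ℂ) = ((C ^ 2 : ℝ) : ℂ) := by
    push_cast at key ⊢
    linear_combination key
  exact (Complex.ofReal_injective h4).symm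

/-- The hypothesis says that the norm is invariant under the compact part of a one-parameter
group. -/
theorem norm_sq_expSum (s : Finset ℝ) (y : ℝ → V)
    (h : ∀ t θ : ℝ, ‖expSum s y (t + Complex.I * θ)‖ = ‖expSum s y t‖) (t : ℝ) :
    ‖expSum s y t‖ ^ 2 = ∑ μ ∈ s, Real.exp (2 * t * μ) * ‖y μ‖ ^ 2 := by
  rw [sq_eq_sum_of_norm_expSum_eq s (fun μ => Complex.exp (t * μ) • y μ) ‖expSum s y t‖]
  · refine Finset.sum_congr rfl fun μ _ => ?_
    rw [norm_smul, mul_pow, Complex.norm_exp, ← Real.exp_nat_mul]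
    congr 2
    simp
    ring
  · intro θ
    rw [← h t θ]
    congr 1
    refine Finset.sum_congr rfl fun μ _ => ?_
    rw [smul_smul, ← Complex.exp_add]
    ring_nf

theorem expSum_eq_of_coeff_eq_zero (s : Finset ℝ) (y : ℝ → V) (h : ∀ μ ∈ s, μ ≠ 0 → y μ = 0)
    (z : ℂ) : expSum s y z = expSum s y 0 := by
  refine Finset.sum_congr rfl fun μ hμ => ?_
  rcases eq_or_ne μ 0 with rfl | h0
  · simp
  · simp [h μ hμ h0]

/-- Strict convexity of the squared norm along a one-parameter group: a vector which is of
minimal norm on its real orbit, and whose translate by time one has the same norm, is fixed. -/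
theorem expSum_eq_of_norm_one_eq (s : Finset ℝ) (y : ℝ → V)
    (h : ∀ t θ : ℝ, ‖expSum s y (t + Complex.I * θ)‖ = ‖expSum s y t‖)
    (hmin : ∀ t : ℝ, ‖expSum s y 0‖ ≤ ‖expSum s y t‖)
    (h1 : ‖expSum s y 1‖ = ‖expSum s y 0‖) (z : ℂ) : expSum s y z = expSum s y 0 := by
  apply expSum_eq_of_coeff_eq_zero
  have e0 := norm_sq_expSum s y h 0
  have e1 := norm_sq_expSum s y h 1
  have e2 := norm_sq_expSum s y h (1 / 2)
  have hm := pow_le_pow_left₀ (norm_nonneg _) (hmin (1 / 2)) 2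
  simp only [Complex.ofReal_zero, Complex.ofReal_one] at e0 e1
  rw [h1] at e1
  rw [e2] at hm
  have hsum : ∑ μ ∈ s, (Real.exp μ - 1) ^ 2 * ‖y μ‖ ^ 2 ≤ 0 := by
    have : ∑ μ ∈ s, (Real.exp μ - 1) ^ 2 * ‖y μ‖ ^ 2 =
        ∑ μ ∈ s, Real.exp (2 * 1 * μ) * ‖y μ‖ ^ 2 + ∑ μ ∈ s, Real.exp (2 * 0 * μ) * ‖y μ‖ ^ 2
          - 2 * ∑ μ ∈ s, Real.exp (2 * (1 / 2) * μ) * ‖y μ‖ ^ 2 := by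
      rw [Finset.mul_sum, ← Finset.sum_add_distrib, ← Finset.sum_sub_distrib]
      refine Finset.sum_congr rfl fun μ _ => ?_
      have : Real.exp (2 * 1 * μ) = Real.exp μ ^ 2 := by
        rw [← Real.exp_nat_mul]; norm_num
      rw [this]
      norm_num
      ring
    rw [this, ← e1, ← e0]
    linarith
  have h0 := (Finset.sum_eq_zero_iff_of_nonneg (fun μ _ => by positivity)).mp
    (le_antisymm hsum (Finset.sum_nonneg fun μ _ => by positivity))
  intro μ hμ hne
  have h2 : Real.exp μ - 1 ≠ 0 := by
    rw [sub_ne_zero]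
    simpa using hne
  simpa [h2] using h0 μ hμ

/-- Convexity of the squared norm along a one-parameter group. -/
theorem norm_expSum_le_of_le (s : Finset ℝ) (y : ℝ → V)
    (h : ∀ t θ : ℝ, ‖expSum s y (t + Complex.I * θ)‖ = ‖expSum s y t‖)
    {C T t : ℝ} (h0 : ‖expSum s y 0‖ ≤ C) (hT : ‖expSum s y T‖ ≤ C) (ht : 0 ≤ t) (htT : t ≤ T) :
    ‖expSum s y t‖ ≤ C := by
  have hC : 0 ≤ C := (norm_nonneg _).trans h0
  rcases ht.eq_or_lt with rfl | htpos
  · simpa using h0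
  have hTpos : 0 < T := htpos.trans_le htT
  have e0 := norm_sq_expSum s y h 0
  have eT := norm_sq_expSum s y h T
  have et := norm_sq_expSum s y h t
  simp only [Complex.ofReal_zero] at e0
  have h0' := pow_le_pow_left₀ (norm_nonneg _) h0 2
  have hT' := pow_le_pow_left₀ (norm_nonneg _) hT 2
  rw [e0] at h0'
  rw [eT] at hT'
  refine (sq_le_sq₀ (norm_nonneg _) hC).mp ?_
  rw [et]
  set r := t / T with hr
  have hr0 : 0 ≤ r := by positivity
  have hr1 : r ≤ 1 := by rw [hr, div_le_one hTpos]; exact htT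
  have hconv : ∑ μ ∈ s, Real.exp (2 * t * μ) * ‖y μ‖ ^ 2 ≤
      (1 - r) * ∑ μ ∈ s, Real.exp (2 * 0 * μ) * ‖y μ‖ ^ 2 +
        r * ∑ μ ∈ s, Real.exp (2 * T * μ) * ‖y μ‖ ^ 2 := by
    rw [Finset.mul_sum, Finset.mul_sum, ← Finset.sum_add_distrib]
    refine Finset.sum_le_sum fun μ _ => ?_
    have := convexOn_exp.2 (Set.mem_univ (2 * 0 * μ)) (Set.mem_univ (2 * T * μ))
      (sub_nonneg.mpr hr1) hr0 (by ring)
    simp only [smul_eq_mul] at this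
    have e : (1 - r) * (2 * 0 * μ) + r * (2 * T * μ) = 2 * t * μ := by
      rw [hr]; field_simp; ring
    rw [e] at this
    nlinarith [mul_le_mul_of_nonneg_right this (sq_nonneg ‖y μ‖)]
  nlinarith

/-- A one-parameter orbit which stays bounded in positive time involves no positive exponent. -/
theorem coeff_eq_zero_of_norm_expSum_le (s : Finset ℝ) (y : ℝ → V)
    (h : ∀ t θ : ℝ, ‖expSum s y (t + Complex.I * θ)‖ = ‖expSum s y t‖)
    {C : ℝ} (hC : ∀ t : ℝ, 0 ≤ t → ‖expSum s y t‖ ≤ C) {μ : ℝ} (hμs : μ ∈ s) (hμ : 0 < μ) :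
    y μ = 0 := by
  by_contra hne
  have hy : 0 < ‖y μ‖ ^ 2 := by positivity
  have ht : Tendsto (fun t : ℝ => Real.exp (2 * t * μ) * ‖y μ‖ ^ 2) atTop atTop := by
    refine Tendsto.atTop_mul_const hy (Real.tendsto_exp_atTop.comp ?_)
    exact (tendsto_id.const_mul_atTop two_pos).atTop_mul_const hμ
  obtain ⟨t, ht1, ht0⟩ := ((ht.eventually_gt_atTop (C ^ 2)).and (eventually_ge_atTop 0)).exists
  have h1 := pow_le_pow_left₀ (norm_nonneg _) (hC t ht0) 2
  rw [norm_sq_expSum s y h t] at h1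
  have h2 := Finset.single_le_sum (f := fun μ => Real.exp (2 * t * μ) * ‖y μ‖ ^ 2)
    (fun ν _ => by positivity) hμs
  exact absurd (h2.trans h1) (not_le.mpr ht1)

end

end

/-! ### Diagonalisable elements and Laurent expansions -/

section

open Filter Topology

variable {n : ℕ}

/-- The diagonal torus of `GL_n(ℂ)`. -/
noncomputable def diagGL : (Fin n → ℂˣ) →* Matrix.GeneralLinearGroup (Fin n) ℂ :=
  (Units.map (Matrix.diagonalRingHom (Fin n) ℂ).toMonoidHom).comp
    (MulEquiv.piUnits (M := fun _ : Fin n => ℂ)).symm.toMonoidHom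

theorem coe_diagGL (z : Fin n → ℂˣ) :
    (diagGL z : Matrix (Fin n) (Fin n) ℂ) = Matrix.diagonal fun i => (z i : ℂ) := rfl

/-- The point `(exp (z l_i))_i` of the torus `(ℂ*)^n`. -/
noncomputable def expTorus (l : Fin n → ℝ) (z : ℂ) : Fin n → ℂˣ :=
  fun i => Units.mk0 (Complex.exp (z * l i)) (Complex.exp_ne_zero _)

/-- The complex one-parameter group `z ↦ v diag(exp (z l_i)) v⁻¹`. For unitary `v` these are the
groups `z ↦ exp (z p)` with `p` Hermitian. -/
noncomputable def oneParam (v : Matrix.GeneralLinearGroup (Fin n) ℂ) (l : Fin n → ℝ) (z : ℂ) :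
    Matrix.GeneralLinearGroup (Fin n) ℂ := v * diagGL (expTorus l z) * v⁻¹

theorem expTorus_add (l : Fin n → ℝ) (a b : ℂ) :
    expTorus l (a + b) = expTorus l a * expTorus l b := by
  funext i
  ext
  simp [expTorus, add_mul, Complex.exp_add]

theorem expTorus_zero (l : Fin n → ℝ) : expTorus l 0 = 1 := by
  funext i
  ext
  simp [expTorus]

theorem oneParam_add (v : Matrix.GeneralLinearGroup (Fin n) ℂ) (l : Fin n → ℝ) (a b : ℂ) :
    oneParam v l (a + b) = oneParam v l a * oneParam v l b := by
  simp only [oneParam, expTorus_add, map_mul]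
  group

theorem oneParam_zero (v : Matrix.GeneralLinearGroup (Fin n) ℂ) (l : Fin n → ℝ) :
    oneParam v l 0 = 1 := by
  simp [oneParam, expTorus_zero]

theorem oneParam_neg (v : Matrix.GeneralLinearGroup (Fin n) ℂ) (l : Fin n → ℝ) (a : ℂ) :
    oneParam v l (-a) = (oneParam v l a)⁻¹ := by
  rw [eq_inv_iff_mul_eq_one, ← oneParam_add, neg_add_cancel, oneParam_zero]

theorem oneParam_smul (v : Matrix.GeneralLinearGroup (Fin n) ℂ) (l : Fin n → ℝ) (r : ℝ) (a : ℂ) :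
    oneParam v (r • l) a = oneParam v l (a * r) := by
  have : expTorus (r • l) a = expTorus l (a * r) := by
    funext i
    ext
    simp [expTorus, mul_assoc]
  rw [oneParam, this, oneParam]

theorem oneParam_conj (x v : Matrix.GeneralLinearGroup (Fin n) ℂ) (l : Fin n → ℝ) (a : ℂ) :
    oneParam (x * v) l a = x * oneParam v l a * x⁻¹ := by
  simp only [oneParam]
  group

theorem continuous_diagGL : Continuous (diagGL (n := n)) := by
  refine Units.continuous_iff.mpr ⟨?_, ?_⟩
  · exact (continuous_pi fun i => Units.continuous_val.comp (continuous_apply i)).matrix_diagonal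
  · have : (fun z : Fin n → ℂˣ => ((diagGL z)⁻¹ : Matrix.GeneralLinearGroup (Fin n) ℂ).val) =
        fun z => Matrix.diagonal fun i => ((z i)⁻¹ : ℂˣ).val := by
      funext z
      rw [← map_inv, coe_diagGL]
      rfl
    rw [this]
    exact (continuous_pi fun i =>
      Units.continuous_val.comp (continuous_inv.comp (continuous_apply i))).matrix_diagonal

theorem continuous_oneParam (z : ℂ) :
    Continuous fun p : Matrix.GeneralLinearGroup (Fin n) ℂ × (Fin n → ℝ) =>
      oneParam p.1 p.2 z := by
  have h : Continuous fun l : Fin n → ℝ => expTorus l z := by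
    refine continuous_pi fun i => Units.continuous_iff.mpr ⟨?_, ?_⟩
    · change Continuous fun l : Fin n → ℝ => Complex.exp (z * l i)
      fun_prop
    · change Continuous fun l : Fin n → ℝ => (Complex.exp (z * l i))⁻¹
      exact Continuous.inv₀ (by fun_prop) fun _ => Complex.exp_ne_zero _
  unfold oneParam
  exact (continuous_fst.mul (continuous_diagGL.comp (h.comp continuous_snd))).mul
    continuous_fst.inv

/-- The character `z ↦ ∏ z_i ^ β_i` of the torus `(ℂ*)^n`. -/
noncomputable def torusChar (β : Fin n → ℤ) (z : Fin n → ℂˣ) : ℂ := ((∏ i, z i ^ β i : ℂˣ) : ℂ)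

/-- Evaluation of Laurent polynomials at a point of the torus `(ℂ*)^n`. -/
noncomputable def laurentEval (z : Fin n → ℂˣ) : AddMonoidAlgebra ℂ (Fin n → ℤ) →ₐ[ℂ] ℂ :=
  AddMonoidAlgebra.lift ℂ ℂ (Fin n → ℤ)
    { toFun := fun β => torusChar (Multiplicative.toAdd β) z
      map_one' := by simp [torusChar]
      map_mul' := fun a b => by
        simp [torusChar, zpow_add, Finset.prod_mul_distrib] }

theorem laurentEval_single (z : Fin n → ℂˣ) (β : Fin n → ℤ) (c : ℂ) :
    laurentEval z (AddMonoidAlgebra.single β c) = c * torusChar β z := by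
  simp [laurentEval]

theorem laurentEval_eq_sum (z : Fin n → ℂˣ) (c : AddMonoidAlgebra ℂ (Fin n → ℤ)) :
    laurentEval z c = ∑ β ∈ c.coeff.support, torusChar β z * c.coeff β := by
  simp [laurentEval, AddMonoidAlgebra.lift_apply, Finsupp.sum, mul_comm]

theorem torusChar_single (i : Fin n) (k : ℤ) (z : Fin n → ℂˣ) :
    torusChar (Pi.single i k) z = (z i : ℂ) ^ k := by
  rw [torusChar, Finset.prod_eq_single i]
  · simp
  · intro j _ hj
    simp [hj]
  · simp

theorem torusChar_expTorus (β : Fin n → ℤ) (l : Fin n → ℝ) (z : ℂ) :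
    torusChar β (expTorus l z) = Complex.exp (z * (∑ i, β i * l i : ℝ)) := by
  simp only [torusChar, Units.coe_prod, Units.val_zpow_eq_zpow_val, expTorus, Units.val_mk0]
  push_cast
  rw [Finset.mul_sum, Complex.exp_sum]
  refine Finset.prod_congr rfl fun i _ => ?_
  rw [← Complex.exp_int_mul]
  ring_nf

theorem torusChar_zpow (β q : Fin n → ℤ) (z : ℂˣ) :
    torusChar β (fun i => z ^ q i) = (z : ℂ) ^ (∑ i, β i * q i) := by
  rw [torusChar, ← Units.val_zpow_eq_zpow_val]
  congr 1
  have h : ∀ (s : Finset (Fin n)) (f : Fin n → ℤ), z ^ ∑ i ∈ s, f i = ∏ i ∈ s, z ^ f i := by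
    intro s f
    induction s using Finset.induction_on with
    | empty => simp
    | insert a s ha ih => rw [Finset.sum_insert ha, Finset.prod_insert ha, zpow_add, ih]
  rw [h]
  refine Finset.prod_congr rfl fun i _ => ?_
  rw [← zpow_mul, mul_comm]

/-- The matrix entries of `v diag(z) v⁻¹` are Laurent polynomials in `z`. -/
theorem exists_laurent_entry (v : Matrix.GeneralLinearGroup (Fin n) ℂ) (i j : Fin n) :
    ∃ c : AddMonoidAlgebra ℂ (Fin n → ℤ), ∀ z : Fin n → ℂˣ,
      ((v * diagGL z * v⁻¹ : Matrix.GeneralLinearGroup (Fin n) ℂ) : Matrix (Fin n) (Fin n) ℂ) i j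
        = laurentEval z c := by
  refine ⟨∑ k, AddMonoidAlgebra.single (Pi.single k 1) (v.val i k * v⁻¹.val k j), fun z => ?_⟩
  rw [map_sum]
  simp only [laurentEval_single, torusChar_single, zpow_one]
  rw [Units.val_mul, Units.val_mul, coe_diagGL, Matrix.mul_apply]
  refine Finset.sum_congr rfl fun k _ => ?_
  rw [Matrix.mul_diagonal]
  ring

theorem exists_laurent_polynomial (v : Matrix.GeneralLinearGroup (Fin n) ℂ)
    (p : MvPolynomial (Fin n × Fin n) ℂ) :
    ∃ c : AddMonoidAlgebra ℂ (Fin n → ℤ), ∀ z : Fin n → ℂˣ,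
      MvPolynomial.eval (fun ij => ((v * diagGL z * v⁻¹ : Matrix.GeneralLinearGroup (Fin n) ℂ) :
        Matrix (Fin n) (Fin n) ℂ) ij.1 ij.2) p = laurentEval z c := by
  induction p using MvPolynomial.induction_on with
  | C a => exact ⟨algebraMap ℂ _ a, fun z => by rw [AlgHom.commutes]; simp⟩
  | add p q hp hq =>
    obtain ⟨c, hc⟩ := hp
    obtain ⟨d, hd⟩ := hq
    exact ⟨c + d, fun z => by rw [map_add, map_add, hc, hd]⟩
  | mul_X p ij hp =>
    obtain ⟨c, hc⟩ := hp
    obtain ⟨d, hd⟩ := exists_laurent_entry v ij.1 ij.2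
    exact ⟨c * d, fun z => by rw [map_mul, map_mul, hc, MvPolynomial.eval_X, hd]⟩

theorem exists_laurent_regularFunction {G : Subgroup (Matrix.GeneralLinearGroup (Fin n) ℂ)}
    (v : Matrix.GeneralLinearGroup (Fin n) ℂ) {f : G → ℂ} (hf : f ∈ regularFunctions G) :
    ∃ c : AddMonoidAlgebra ℂ (Fin n → ℤ), ∀ (z : Fin n → ℂˣ) (h : v * diagGL z * v⁻¹ ∈ G),
      f ⟨v * diagGL z * v⁻¹, h⟩ = laurentEval z c := by
  refine Algebra.adjoin_induction (p := fun f _ => ∃ c : AddMonoidAlgebra ℂ (Fin n → ℤ),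
    ∀ (z : Fin n → ℂˣ) (h : v * diagGL z * v⁻¹ ∈ G), f ⟨v * diagGL z * v⁻¹, h⟩ = laurentEval z c)
    ?_ ?_ ?_ ?_ hf
  · rintro f (⟨ij, rfl⟩ | rfl)
    · obtain ⟨c, hc⟩ := exists_laurent_entry v ij.1 ij.2
      exact ⟨c, fun z _ => hc z⟩
    · refine ⟨AddMonoidAlgebra.single (fun _ => -1) 1, fun z _ => ?_⟩
      change (v * diagGL z * v⁻¹ : Matrix.GeneralLinearGroup (Fin n) ℂ).val.det⁻¹ = _
      rw [laurentEval_single, one_mul, Units.val_mul, Units.val_mul, Matrix.det_mul,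
        Matrix.det_mul, mul_right_comm, ← Matrix.det_mul, Units.mul_inv, Matrix.det_one, one_mul,
        coe_diagGL, Matrix.det_diagonal]
      simp [torusChar]
  · exact fun r => ⟨algebraMap ℂ _ r, fun z _ => by rw [AlgHom.commutes]; rfl⟩
  · rintro f g _ _ ⟨c, hc⟩ ⟨d, hd⟩
    exact ⟨c + d, fun z h => by rw [map_add, ← hc z h, ← hd z h]; rfl⟩
  · rintro f g _ _ ⟨c, hc⟩ ⟨d, hd⟩
    exact ⟨c * d, fun z h => by rw [map_mul, ← hc z h, ← hd z h]; rfl⟩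

/-- A vector-valued function whose coordinates are Laurent polynomials is a Laurent polynomial with
vector coefficients. -/
theorem exists_vector_laurent {k : ℕ} {X W : Type*} [AddCommGroup W] [Module ℂ W]
    [FiniteDimensional ℂ W] (g : X → W) (p : X → Fin k → ℂˣ)
    (h : ∀ φ : Module.Dual ℂ W, ∃ c : AddMonoidAlgebra ℂ (Fin k → ℤ),
      ∀ a, φ (g a) = laurentEval (p a) c) :
    ∃ (s : Finset (Fin k → ℤ)) (x : (Fin k → ℤ) → W),
      ∀ a, g a = ∑ β ∈ s, torusChar β (p a) • x β := by
  let b := Module.finBasis ℂ W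
  choose c hc using fun i => h (b.coord i)
  refine ⟨Finset.univ.biUnion fun i => (c i).coeff.support,
    fun β => ∑ i, (c i).coeff β • b i, fun a => ?_⟩
  rw [← b.sum_repr (g a)]
  simp only [Finset.smul_sum]
  rw [Finset.sum_comm]
  refine Finset.sum_congr rfl fun i _ => ?_
  have h1 := hc i a
  rw [Module.Basis.coord_apply, laurentEval_eq_sum] at h1
  rw [h1, Finset.sum_smul, Finset.sum_subset (Finset.subset_biUnion_of_mem
    (fun i => (c i).coeff.support) (Finset.mem_univ i))]
  · simp only [smul_smul]
  · intro β _ hβ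
    rw [Finsupp.notMem_support_iff.mp hβ]
    simp

/-- A rational representation is given on a torus by a vector-valued Laurent polynomial. -/
theorem IsRational.exists_laurent {G : Subgroup (Matrix.GeneralLinearGroup (Fin n) ℂ)}
    {W : Type*} [AddCommGroup W] [Module ℂ W] [FiniteDimensional ℂ W]
    {ρ : Representation ℂ G W} (hρ : IsRational ρ) (v : Matrix.GeneralLinearGroup (Fin n) ℂ)
    (w : W) :
    ∃ (s : Finset (Fin n → ℤ)) (x : (Fin n → ℤ) → W), ∀ (z : Fin n → ℂˣ)
      (h : v * diagGL z * v⁻¹ ∈ G),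
      ρ ⟨v * diagGL z * v⁻¹, h⟩ w = ∑ β ∈ s, torusChar β z • x β := by
  obtain ⟨s, x, hx⟩ := exists_vector_laurent
    (fun z : {z : Fin n → ℂˣ // v * diagGL z * v⁻¹ ∈ G} => ρ ⟨v * diagGL z.1 * v⁻¹, z.2⟩ w)
    (fun z => z.1) fun φ =>
      (exists_laurent_regularFunction v (hρ φ w)).imp fun _ hc z => hc z.1 z.2
  exact ⟨s, x, fun z h => hx ⟨z, h⟩⟩

/-- The one-parameter version of the Laurent expansion, with terms of equal exponent collected. -/
theorem sum_torusChar_expTorus {W : Type*} [AddCommGroup W] [Module ℂ W]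
    (s : Finset (Fin n → ℤ)) (x : (Fin n → ℤ) → W) (l : Fin n → ℝ) (z : ℂ) :
    ∑ β ∈ s, torusChar β (expTorus l z) • x β =
      expSum (s.image fun β => ∑ i, β i * l i)
        (fun μ => ∑ β ∈ s with (∑ i, β i * l i : ℝ) = μ, x β) z := by
  rw [expSum, ← Finset.sum_fiberwise_of_maps_to
    (fun β hβ => Finset.mem_image_of_mem (fun β : Fin n → ℤ => (∑ i, β i * l i : ℝ)) hβ)]
  refine Finset.sum_congr rfl fun μ _ => ?_
  rw [Finset.smul_sum]
  refine Finset.sum_congr rfl fun β hβ => ?_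
  rw [torusChar_expTorus, (Finset.mem_filter.mp hβ).2]

theorem IsRational.exists_expSum {G : Subgroup (Matrix.GeneralLinearGroup (Fin n) ℂ)}
    {W : Type*} [AddCommGroup W] [Module ℂ W] [FiniteDimensional ℂ W]
    {ρ : Representation ℂ G W} (hρ : IsRational ρ) (v : Matrix.GeneralLinearGroup (Fin n) ℂ)
    (l : Fin n → ℝ) (w : W) :
    ∃ (s : Finset ℝ) (y : ℝ → W), ∀ (z : ℂ) (h : oneParam v l z ∈ G),
      ρ ⟨oneParam v l z, h⟩ w = expSum s y z := by
  obtain ⟨s, x, hx⟩ := hρ.exists_laurent v w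
  exact ⟨_, _, fun z h => (hx (expTorus l z) h).trans (sum_torusChar_expTorus s x l z)⟩

/-- The Zariski closure of a real one-parameter group `t ↦ v diag(exp (t l_i)) v⁻¹` contains every
algebraic one-parameter group `z ↦ v diag(z ^ q_i) v⁻¹` whose exponents `q` satisfy all the
integral linear relations satisfied by `l`. -/
theorem conj_diagGL_zpow_mem {A : Set (Matrix.GeneralLinearGroup (Fin n) ℂ)}
    (hA : IsZariskiClosed A) (v : Matrix.GeneralLinearGroup (Fin n) ℂ) (l : Fin n → ℝ)
    (h : ∀ t : ℝ, oneParam v l t ∈ A) (q : Fin n → ℤ)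
    (hq : ∀ m : Fin n → ℤ, ∑ i, (m i : ℝ) * l i = 0 → ∑ i, m i * q i = 0) (z : ℂˣ) :
    v * diagGL (fun i => z ^ q i) * v⁻¹ ∈ A := by
  obtain ⟨S, hS⟩ := hA
  rw [hS]
  intro p hp
  obtain ⟨c, hc⟩ := exists_laurent_polynomial v p
  rw [hc, laurentEval_eq_sum]
  have key := sum_filter_eq_zero_of_exp_sum_eq_zero c.coeff.support (fun β => ∑ i, β i * l i)
    c.coeff one_ne_zero (fun t => by
      have h1 := (hS _).mp (h t) p hp
      rw [oneParam, hc, laurentEval_eq_sum] at h1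
      rw [← h1]
      refine Finset.sum_congr rfl fun β _ => ?_
      rw [torusChar_expTorus, one_mul])
  -- The exponents `β` with equal pairing with `l` have equal pairing with `q`, and the coefficients
  -- of each such group add up to zero.
  rw [← Finset.sum_fiberwise_of_maps_to
    (fun β hβ => Finset.mem_image_of_mem (fun β : Fin n → ℤ => (∑ i, β i * l i : ℝ)) hβ)]
  refine Finset.sum_eq_zero fun μ hμ => ?_
  obtain ⟨β₀, hβ₀, rfl⟩ := Finset.mem_image.mp hμ
  rw [← mul_zero (torusChar β₀ fun i => z ^ q i), ← key, Finset.mul_sum]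
  refine Finset.sum_congr rfl fun β hβ => ?_
  congr 1
  rw [torusChar_zpow, torusChar_zpow]
  congr 1
  have h2 := hq (β - β₀) (by
    have := (Finset.mem_filter.mp hβ).2
    simp only [Pi.sub_apply, Int.cast_sub, sub_mul, Finset.sum_sub_distrib]
    linarith)
  simp only [Pi.sub_apply, sub_mul, Finset.sum_sub_distrib] at h2
  linarith

/-- Rational approximation of a real weight vector: the integral vector `q` satisfies the integral
linear relations of `l` and finitely many of its strict linear inequalities. -/
theorem exists_int_approx (l : Fin n → ℝ) (s : Finset (Fin n → ℤ)) :
    ∃ q : Fin n → ℤ, (∀ m : Fin n → ℤ, ∑ i, (m i : ℝ) * l i = 0 → ∑ i, m i * q i = 0) ∧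
      ∀ β ∈ s, ∑ i, (β i : ℝ) * l i < 0 → ∑ i, β i * q i < 0 := by
  -- `l i = ∑ k, a i k * e k` in a `ℚ`-basis `e` of the span of the `l i`; replace `e` by a nearby
  -- rational vector.
  let V := Submodule.span ℚ (Set.range l)
  have : FiniteDimensional ℚ V := FiniteDimensional.span_of_finite ℚ (Set.finite_range l)
  let b := Module.finBasis ℚ V
  let a : Fin n → Fin (Module.finrank ℚ V) → ℚ :=
    fun i k => b.repr ⟨l i, Submodule.subset_span ⟨i, rfl⟩⟩ k
  have ha : ∀ i, l i = ∑ k, (a i k : ℝ) * (b k : ℝ) := by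
    intro i
    have h1 := congrArg Subtype.val (b.sum_repr ⟨l i, Submodule.subset_span ⟨i, rfl⟩⟩)
    simp only [Submodule.coe_sum, Submodule.coe_smul, Rat.smul_def] at h1
    exact h1.symm
  have hlin : ∀ m : Fin n → ℤ, ∑ i, (m i : ℝ) * l i =
      ∑ k, ((∑ i, (m i : ℚ) * a i k : ℚ) : ℝ) * (b k : ℝ) := by
    intro m
    simp only [ha, Finset.mul_sum]
    rw [Finset.sum_comm]
    refine Finset.sum_congr rfl fun k _ => ?_
    push_cast
    rw [Finset.sum_mul]
    exact Finset.sum_congr rfl fun i _ => by ring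
  have hzero : ∀ m : Fin n → ℤ, ∑ i, (m i : ℝ) * l i = 0 → ∀ k, ∑ i, (m i : ℚ) * a i k = 0 := by
    intro m hm
    rw [hlin] at hm
    refine Fintype.linearIndependent_iff.mp b.linearIndependent _ (Subtype.ext ?_)
    simpa [Rat.smul_def] using hm
  have hopen : IsOpen {e : Fin (Module.finrank ℚ V) → ℝ | ∀ β ∈ s, ∑ i, (β i : ℝ) * l i < 0 →
      ∑ k, ((∑ i, (β i : ℚ) * a i k : ℚ) : ℝ) * e k < 0} := by
    simp only [Set.ofPred_forall]
    refine isOpen_biInter_finset fun β _ => ?_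
    refine isOpen_iInter_of_finite fun _ => ?_
    exact isOpen_lt (by fun_prop) continuous_const
  obtain ⟨e, he⟩ := (DenseRange.piMap (fun _ : Fin (Module.finrank ℚ V) =>
    Rat.denseRange_cast (𝕜 := ℝ))).exists_mem_open hopen
      ⟨fun k => (b k : ℝ), fun β _ hβ => by rwa [← hlin]⟩
  let r : Fin n → ℚ := fun i => ∑ k, a i k * e k
  have hr : ∀ m : Fin n → ℤ, ∑ i, (m i : ℚ) * r i = ∑ k, (∑ i, (m i : ℚ) * a i k) * e k := by
    intro m
    simp only [r, Finset.mul_sum, Finset.sum_mul]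
    rw [Finset.sum_comm]
    exact Finset.sum_congr rfl fun k _ => Finset.sum_congr rfl fun i _ => by ring
  -- Clear denominators.
  let N : ℕ := ∏ i, (r i).den
  have hN : 0 < N := Finset.prod_pos fun i _ => (r i).den_pos
  have hq : ∀ i, ∃ q : ℤ, (q : ℚ) = r i * N := by
    intro i
    obtain ⟨k, hk⟩ : (r i).den ∣ N := Finset.dvd_prod_of_mem _ (Finset.mem_univ i)
    refine ⟨(r i).num * k, ?_⟩
    rw [hk]
    push_cast
    rw [← mul_assoc, Rat.mul_den_eq_num]
  choose q hq using hq
  have hqr : ∀ m : Fin n → ℤ, ((∑ i, m i * q i : ℤ) : ℚ) = (∑ i, (m i : ℚ) * r i) * N := by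
    intro m
    push_cast
    rw [Finset.sum_mul]
    exact Finset.sum_congr rfl fun i _ => by rw [hq i]; ring
  refine ⟨q, fun m hm => ?_, fun β hβ hneg => ?_⟩
  · have : ((∑ i, m i * q i : ℤ) : ℚ) = 0 := by
      rw [hqr, hr]
      simp [hzero m hm]
    exact_mod_cast this
  · have h1 := he β hβ hneg
    simp only [Pi.map_apply] at h1
    have h2 : ∑ i, (β i : ℚ) * r i < 0 := by
      rw [hr]
      exact_mod_cast h1
    have h3 : ((∑ i, β i * q i : ℤ) : ℚ) < 0 := by
      rw [hqr]
      exact mul_neg_of_neg_of_pos h2 (by exact_mod_cast hN)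
    exact_mod_cast h3

end

/-! ### Classical topology -/

section

open Filter Topology
open scoped Matrix.Norms.L2Operator ComplexOrder

variable {n : ℕ}

theorem continuous_of_mem_regularFunctions {G : Subgroup (Matrix.GeneralLinearGroup (Fin n) ℂ)}
    {f : G → ℂ} (hf : f ∈ regularFunctions G) : Continuous f := by
  have hval : Continuous fun g : G => (g : Matrix.GeneralLinearGroup (Fin n) ℂ).val :=
    Units.continuous_val.comp continuous_subtype_val
  refine Algebra.adjoin_induction (p := fun f _ => Continuous f) ?_ ?_ ?_ ?_ hf
  · rintro f (⟨ij, rfl⟩ | rfl)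
    · exact hval.matrix_elem ij.1 ij.2
    · refine hval.matrix_det.inv₀ fun g => ?_
      exact ((Matrix.isUnit_iff_isUnit_det _).mp (g : Matrix.GeneralLinearGroup (Fin n) ℂ).isUnit).ne_zero
  · exact fun r => continuous_const
  · exact fun f g _ _ hf hg => hf.add hg
  · exact fun f g _ _ hf hg => hf.mul hg

theorem IsZariskiClosed.isClosed {A : Set (Matrix.GeneralLinearGroup (Fin n) ℂ)}
    (hA : IsZariskiClosed A) : IsClosed A := by
  obtain ⟨S, hS⟩ := hA
  have : A = ⋂ p ∈ S, {g : Matrix.GeneralLinearGroup (Fin n) ℂ |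
      MvPolynomial.eval (fun ij : Fin n × Fin n => g.val ij.1 ij.2) p = 0} := by
    ext g
    simpa using hS g
  rw [this]
  refine isClosed_biInter fun p _ => isClosed_eq ?_ continuous_const
  exact (MvPolynomial.continuous_eval p).comp
    (continuous_pi fun ij => Units.continuous_val.matrix_elem ij.1 ij.2)

theorem IsRational.continuous {G : Subgroup (Matrix.GeneralLinearGroup (Fin n) ℂ)}
    {W V : Type*} [AddCommGroup W] [Module ℂ W] [FiniteDimensional ℂ W]
    [NormedAddCommGroup V] [NormedSpace ℂ V]
    {ρ : Representation ℂ G W} (hρ : IsRational ρ) (φ : W →ₗ[ℂ] V) (w : W) :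
    Continuous fun g : G => φ (ρ g w) := by
  let b := Module.finBasis ℂ W
  have h : (fun g : G => φ (ρ g w)) = fun g => ∑ i, b.coord i (ρ g w) • φ (b i) := by
    funext g
    conv_lhs => rw [← b.sum_repr (ρ g w)]
    simp only [map_sum, map_smul, Module.Basis.coord_apply]
  rw [h]
  exact continuous_finsetSum _ fun i _ =>
    (continuous_of_mem_regularFunctions (hρ (b.coord i) w)).smul continuous_const

theorem isCompact_setOf_norm_le (C : ℝ) :
    IsCompact {g : Matrix.GeneralLinearGroup (Fin n) ℂ | ‖g.val‖ ≤ C ∧ ‖g⁻¹.val‖ ≤ C} := by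
  have h := Units.isClosedEmbedding_embedProduct (α := Matrix (Fin n) (Fin n) ℂ)
  have hc : IsCompact ((Metric.closedBall (0 : Matrix (Fin n) (Fin n) ℂ) C) ×ˢ
      (MulOpposite.op '' Metric.closedBall (0 : Matrix (Fin n) (Fin n) ℂ) C)) := by
    have : ProperSpace (Matrix (Fin n) (Fin n) ℂ) := FiniteDimensional.proper ℂ _
    exact (isCompact_closedBall _ _).prod
      ((isCompact_closedBall _ _).image MulOpposite.continuous_op)
  have := h.isCompact_preimage hc
  convert this using 1
  ext g
  simp only [Set.mem_ofPred_eq, Set.mem_preimage, Units.embedProduct_apply, Set.mem_prod,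
    mem_closedBall_zero_iff]
  refine and_congr_right fun _ => ⟨fun h => ⟨_, mem_closedBall_zero_iff.mpr h, rfl⟩, ?_⟩
  rintro ⟨x, hx, he⟩
  rw [← MulOpposite.op_injective he]
  exact mem_closedBall_zero_iff.mp hx

theorem norm_one_le : ‖(1 : Matrix (Fin n) (Fin n) ℂ)‖ ≤ 1 := by
  rw [← Matrix.diagonal_one, Matrix.l2_opNorm_diagonal]
  exact (pi_norm_le_iff_of_nonneg zero_le_one).mpr fun i => by simp

/-! ### Unitary matrices and the polar decomposition -/

/-- The unitary group `U(n)` as a subgroup of `GL_n(ℂ)`. -/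
def unitarySubgroup (n : ℕ) : Subgroup (Matrix.GeneralLinearGroup (Fin n) ℂ) where
  carrier := {g | star g.val * g.val = 1}
  one_mem' := by simp
  mul_mem' := by
    intro a b ha hb
    simp only [Set.mem_ofPred_eq, Units.val_mul, star_mul] at *
    rw [mul_assoc, ← mul_assoc _ a.val, ha, one_mul, hb]
  inv_mem' := by
    intro a ha
    simp only [Set.mem_ofPred_eq] at *
    have h1 : star a.val = a⁻¹.val := by
      rw [← mul_one (star a.val), ← a.mul_inv, ← mul_assoc, ha, one_mul]
    rw [← h1, star_star, h1, a.mul_inv]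

theorem mem_unitarySubgroup {g : Matrix.GeneralLinearGroup (Fin n) ℂ} :
    g ∈ unitarySubgroup n ↔ star g.val * g.val = 1 := Iff.rfl

theorem star_eq_inv_of_mem_unitarySubgroup {g : Matrix.GeneralLinearGroup (Fin n) ℂ}
    (hg : g ∈ unitarySubgroup n) : star g.val = g⁻¹.val := by
  rw [← mul_one (star g.val), ← g.mul_inv, ← mul_assoc, mem_unitarySubgroup.mp hg, one_mul]

theorem norm_le_one_of_mem_unitarySubgroup {g : Matrix.GeneralLinearGroup (Fin n) ℂ}
    (hg : g ∈ unitarySubgroup n) : ‖g.val‖ ≤ 1 := by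
  have h : ‖g.val‖ * ‖g.val‖ ≤ 1 := by
    rw [← CStarRing.norm_star_mul_self, mem_unitarySubgroup.mp hg]
    exact norm_one_le
  nlinarith [norm_nonneg g.val]

theorem isCompact_unitarySubgroup :
    IsCompact (unitarySubgroup n : Set (Matrix.GeneralLinearGroup (Fin n) ℂ)) := by
  refine (isCompact_setOf_norm_le 1).of_isClosed_subset ?_ fun g hg =>
    ⟨norm_le_one_of_mem_unitarySubgroup hg,
      norm_le_one_of_mem_unitarySubgroup ((unitarySubgroup n).inv_mem hg)⟩
  exact isClosed_eq (Units.continuous_val.star.mul Units.continuous_val) continuous_const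

theorem star_oneParam {u : Matrix.GeneralLinearGroup (Fin n) ℂ} (hu : u ∈ unitarySubgroup n)
    (l : Fin n → ℝ) (z : ℂ) :
    star (oneParam u l z).val = (oneParam u l (starRingEnd ℂ z)).val := by
  have h1 := star_eq_inv_of_mem_unitarySubgroup hu
  simp only [oneParam, Units.val_mul, star_mul]
  rw [← h1, star_star, mul_assoc]
  congr 2
  rw [coe_diagGL, coe_diagGL, Matrix.star_eq_conjTranspose, Matrix.diagonal_conjTranspose]
  congr 1
  funext i
  simp [expTorus, ← Complex.exp_conj]

theorem oneParam_I_mul_mem_unitarySubgroup {u : Matrix.GeneralLinearGroup (Fin n) ℂ}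
    (hu : u ∈ unitarySubgroup n) (l : Fin n → ℝ) (θ : ℝ) :
    oneParam u l (Complex.I * θ) ∈ unitarySubgroup n := by
  rw [mem_unitarySubgroup, star_oneParam hu, ← Units.val_mul, ← oneParam_add]
  simp [oneParam_zero]

/-- Polar decomposition, with the positive part written in diagonalised form. -/
theorem exists_polar (g : Matrix.GeneralLinearGroup (Fin n) ℂ) :
    ∃ k ∈ unitarySubgroup n, ∃ u ∈ unitarySubgroup n, ∃ l : Fin n → ℝ,
      g = k * oneParam u l 1 := by
  have hpd : (g.val.conjTranspose * g.val).PosDef := by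
    refine Matrix.PosDef.conjTranspose_mul_self _ ?_
    exact Matrix.mulVec_injective_of_isUnit g.isUnit
  have hH := hpd.isHermitian
  have hu1 := Matrix.mem_unitaryGroup_iff'.mp hH.eigenvectorUnitary.2
  have hu2 := Matrix.mem_unitaryGroup_iff.mp hH.eigenvectorUnitary.2
  let u : Matrix.GeneralLinearGroup (Fin n) ℂ :=
    ⟨hH.eigenvectorUnitary, star (hH.eigenvectorUnitary : Matrix (Fin n) (Fin n) ℂ), hu2, hu1⟩
  have hu : u ∈ unitarySubgroup n := hu1
  let l : Fin n → ℝ := fun i => Real.log (hH.eigenvalues i) / 2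
  have hE : (oneParam u l 2).val = star g.val * g.val := by
    rw [Matrix.star_eq_conjTranspose]
    conv_rhs => rw [hH.spectral_theorem]
    rw [Unitary.conjStarAlgAut_apply]
    simp only [oneParam, Units.val_mul, coe_diagGL]
    congr 3
    funext i
    have : (2 : ℂ) * (l i : ℂ) = (Real.log (hH.eigenvalues i) : ℂ) := by
      simp only [l]; push_cast; ring
    simp only [expTorus, Units.val_mk0, this, Function.comp_apply]
    rw [← Complex.ofReal_exp, Real.exp_log (hpd.eigenvalues_pos i)]
    rfl
  refine ⟨g * oneParam u l (-1), ?_, u, hu, l, ?_⟩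
  · rw [mem_unitarySubgroup, Units.val_mul, star_mul, mul_assoc, ← mul_assoc (star g.val), ← hE,
      star_oneParam hu, ← Units.val_mul, ← Units.val_mul, ← oneParam_add, ← oneParam_add]
    norm_num [oneParam_zero]
  · rw [mul_assoc, ← oneParam_add]
    simp [oneParam_zero]

/-! ### Invariant Hermitian norms -/

/-- A compact group acting through a rational representation preserves some Hermitian norm: average
an arbitrary inner product over Haar measure. -/
theorem exists_unitarization {G K : Subgroup (Matrix.GeneralLinearGroup (Fin n) ℂ)}
    (hKG : K ≤ G) (hK : IsCompact (K : Set (Matrix.GeneralLinearGroup (Fin n) ℂ)))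
    {W : Type*} [AddCommGroup W] [Module ℂ W] [FiniteDimensional ℂ W]
    {ρ : Representation ℂ G W} (hρ : IsRational ρ) :
    ∃ (m : ℕ) (φ : W ≃ₗ[ℂ] EuclideanSpace ℂ (Fin m)),
      ∀ k : G, (k : Matrix.GeneralLinearGroup (Fin n) ℂ) ∈ K → ∀ x, ‖φ (ρ k x)‖ = ‖φ x‖ := by
  have : CompactSpace K := isCompact_iff_compactSpace.mp hK
  let _ : MeasurableSpace K := borel K
  have : BorelSpace K := ⟨rfl⟩
  let ν : MeasureTheory.Measure K := MeasureTheory.Measure.haar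
  let φ₀ : W ≃ₗ[ℂ] EuclideanSpace ℂ (Fin (Module.finrank ℂ W)) :=
    (Module.finBasis ℂ W).equivFun.trans (WithLp.linearEquiv 2 ℂ _).symm
  let incl : K → G := Subgroup.inclusion hKG
  have hincl : Continuous incl := Continuous.subtype_mk continuous_subtype_val _
  -- The inverse makes left invariance of the Haar measure applicable.
  let F : W → K → EuclideanSpace ℂ (Fin (Module.finrank ℂ W)) := fun x k => φ₀ (ρ (incl k⁻¹) x)
  have hF : ∀ x, Continuous (F x) := fun x =>
    (hρ.continuous φ₀.toLinearMap x).comp (hincl.comp continuous_inv)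
  have hFadd : ∀ x y k, F (x + y) k = F x k + F y k := fun x y k => by simp [F]
  have hFsmul : ∀ (c : ℂ) x k, F (c • x) k = c • F x k := fun c x k => by simp [F]
  have hint : ∀ x y, MeasureTheory.Integrable (fun k => inner ℂ (F x k) (F y k)) ν := fun x y =>
    ((hF x).inner (hF y)).integrable_of_hasCompactSupport (HasCompactSupport.of_compactSpace _)
  have hself : ∀ x, ∫ k, inner ℂ (F x k) (F x k) ∂ν = ((∫ k, ‖F x k‖ ^ 2 ∂ν : ℝ) : ℂ) := by
    intro x
    rw [← integral_complex_ofReal]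
    refine MeasureTheory.integral_congr_ae (MeasureTheory.ae_of_all _ fun k => ?_)
    simp only [inner_self_eq_norm_sq_to_K]
    push_cast
    rfl
  let core : InnerProductSpace.Core ℂ W :=
    { inner := fun x y => ∫ k, inner ℂ (F x k) (F y k) ∂ν
      conj_inner_symm := fun x y => by
        rw [← integral_conj]
        simp
      re_inner_nonneg := fun x => by
        rw [hself]
        simp only [RCLike.re_to_complex, Complex.ofReal_re]
        exact MeasureTheory.integral_nonneg fun k => by positivity
      add_left := fun x y z => by
        rw [← MeasureTheory.integral_add (hint x z) (hint y z)]
        simp only [hFadd, inner_add_left]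
      smul_left := fun x y c => by
        rw [← MeasureTheory.integral_const_mul]
        simp only [hFsmul, inner_smul_left]
      definite := fun x hx => by
        rw [hself] at hx
        have hx' : ∫ k, ‖F x k‖ ^ 2 ∂ν = 0 := by exact_mod_cast hx
        have hc : Continuous fun k => ‖F x k‖ ^ 2 := (hF x).norm.pow 2
        rw [MeasureTheory.integral_eq_zero_iff_of_nonneg (fun k => by positivity)
          (hc.integrable_of_hasCompactSupport (HasCompactSupport.of_compactSpace _))] at hx'
        have h1 := congrFun (MeasureTheory.Measure.eq_of_ae_eq hx' hc continuous_const) 1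
        have h2 : incl 1 = 1 := rfl
        simpa [F, h2] using h1 }
  let _ : NormedAddCommGroup W := core.toNormedAddCommGroup
  let _ : InnerProductSpace ℂ W := InnerProductSpace.ofCore core.toCore
  let b := stdOrthonormalBasis ℂ W
  refine ⟨_, b.repr.toLinearEquiv, fun k hk x => ?_⟩
  have hnorm : ∀ x : W, ‖x‖ ^ 2 = ∫ k, ‖F x k‖ ^ 2 ∂ν := by
    intro x
    have h1 : ((‖x‖ ^ 2 : ℝ) : ℂ) = inner ℂ x x := by
      rw [inner_self_eq_norm_sq_to_K]; push_cast; rfl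
    have h2 : inner ℂ x x = ((∫ k, ‖F x k‖ ^ 2 ∂ν : ℝ) : ℂ) := hself x
    exact_mod_cast h1.trans h2
  have h3 : ‖b.repr (ρ k x)‖ ^ 2 = ‖b.repr x‖ ^ 2 := by
    rw [b.repr.norm_map, b.repr.norm_map, hnorm, hnorm,
      ← MeasureTheory.integral_mul_left_eq_self (fun j => ‖F (ρ k x) j‖ ^ 2) ⟨k, hk⟩]
    refine MeasureTheory.integral_congr_ae (MeasureTheory.ae_of_all _ fun j => ?_)
    simp only [F]
    rw [← Module.End.mul_apply, ← map_mul]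
    congr 5
    ext : 1
    simp [incl]
  exact (sq_eq_sq₀ (norm_nonneg _) (norm_nonneg _)).mp h3

end

/-! ### Linear substitutions in polynomial rings and Hilbert's finiteness theorem -/

section

section Substitution

variable {ι : Type*} [Fintype ι] [DecidableEq ι]

/-- Composition of polynomial functions on `ℂ^ι` with the linear map `T`. -/
noncomputable def linSubst (T : (ι → ℂ) →ₗ[ℂ] (ι → ℂ)) :
    MvPolynomial ι ℂ →ₐ[ℂ] MvPolynomial ι ℂ :=
  MvPolynomial.aeval fun o => ∑ o', MvPolynomial.C (T (Pi.single o' 1) o) * MvPolynomial.X o'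

theorem eval_linSubst (T : (ι → ℂ) →ₗ[ℂ] (ι → ℂ)) (y : ι → ℂ) (s : MvPolynomial ι ℂ) :
    MvPolynomial.eval y (linSubst T s) = MvPolynomial.eval (T y) s := by
  induction s using MvPolynomial.induction_on with
  | C a => simp [linSubst]
  | add p q hp hq => simp [hp, hq]
  | mul_X p o hp =>
    rw [map_mul, map_mul, map_mul, hp, MvPolynomial.eval_X]
    congr 1
    rw [LinearMap.pi_apply_eq_sum_univ T y]
    simp only [linSubst, MvPolynomial.aeval_X, map_sum, map_mul, MvPolynomial.eval_C,
      MvPolynomial.eval_X, Finset.sum_apply, Pi.smul_apply, smul_eq_mul]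
    refine Finset.sum_congr rfl fun o' _ => ?_
    rw [mul_comm]
    congr 1
    refine congrArg (fun v => T v o) (funext fun i => ?_)
    simp [Pi.single_apply, eq_comm]

theorem linSubst_linSubst (T T' : (ι → ℂ) →ₗ[ℂ] (ι → ℂ)) (s : MvPolynomial ι ℂ) :
    linSubst T (linSubst T' s) = linSubst (T' ∘ₗ T) s := by
  refine MvPolynomial.funext fun y => ?_
  rw [eval_linSubst, eval_linSubst, eval_linSubst, LinearMap.comp_apply]

theorem linSubst_id (s : MvPolynomial ι ℂ) : linSubst LinearMap.id s = s := by
  refine MvPolynomial.funext fun y => ?_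
  rw [eval_linSubst, LinearMap.id_apply]

theorem isHomogeneous_linSubst (T : (ι → ℂ) →ₗ[ℂ] (ι → ℂ)) {s : MvPolynomial ι ℂ} {d : ℕ}
    (hs : s.IsHomogeneous d) : (linSubst T s).IsHomogeneous d := by
  have := hs.aeval (fun o => ∑ o', MvPolynomial.C (T (Pi.single o' 1) o) * MvPolynomial.X o')
    (n := 1) fun o => MvPolynomial.IsHomogeneous.sum _ _ _ fun o' _ =>
      MvPolynomial.isHomogeneous_C_mul_X _ _
  rwa [one_mul] at this

theorem totalDegree_linSubst_le (T : (ι → ℂ) →ₗ[ℂ] (ι → ℂ)) (s : MvPolynomial ι ℂ) :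
    (linSubst T s).totalDegree ≤ s.totalDegree := by
  conv_lhs => rw [← MvPolynomial.sum_homogeneousComponent s, map_sum]
  refine MvPolynomial.totalDegree_finsetSum_le fun i hi => ?_
  exact ((isHomogeneous_linSubst T
    (MvPolynomial.homogeneousComponent_isHomogeneous i s)).totalDegree_le).trans
      (Nat.lt_succ_iff.mp (Finset.mem_range.mp hi))

theorem homogeneousComponent_linSubst (T : (ι → ℂ) →ₗ[ℂ] (ι → ℂ)) (s : MvPolynomial ι ℂ) (d : ℕ) :
    MvPolynomial.homogeneousComponent d (linSubst T s) =
      linSubst T (MvPolynomial.homogeneousComponent d s) := by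
  have h : ∀ i, MvPolynomial.homogeneousComponent d
      (linSubst T (MvPolynomial.homogeneousComponent i s)) =
        if i = d then linSubst T (MvPolynomial.homogeneousComponent i s) else 0 := by
    intro i
    rw [MvPolynomial.homogeneousComponent_of_mem (isHomogeneous_linSubst T
      (MvPolynomial.homogeneousComponent_isHomogeneous i s))]
    simp only [eq_comm]
  conv_lhs => rw [← MvPolynomial.sum_homogeneousComponent s, map_sum, map_sum]
  simp only [h]
  rw [Finset.sum_ite_eq']
  split_ifs with hd
  · rfl
  · rw [MvPolynomial.homogeneousComponent_eq_zero, map_zero]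
    simpa using hd

end Substitution

/-- Hilbert's finiteness theorem. The graded subalgebra `B` need only have the property that an
element of `B` which is a combination of elements of `B` with polynomial coefficients is also such
a combination with coefficients in `B`; for rings of invariants this is provided by complete
reducibility. -/
theorem exists_finset_adjoin_eq {ι : Type*} [Finite ι] (B : Subalgebra ℂ (MvPolynomial ι ℂ))
    (hhom : ∀ f ∈ B, ∀ d, MvPolynomial.homogeneousComponent d f ∈ B)
    (hlift : ∀ (F : Finset (MvPolynomial ι ℂ)), (∀ f ∈ F, f ∈ B) →
      ∀ a : F → MvPolynomial ι ℂ, ∑ f : F, a f * f ∈ B →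
        ∃ a' : F → MvPolynomial ι ℂ, (∀ f, a' f ∈ B) ∧ ∑ f : F, a' f * f = ∑ f : F, a f * f) :
    ∃ F : Finset (MvPolynomial ι ℂ), Algebra.adjoin ℂ (F : Set (MvPolynomial ι ℂ)) = B := by
  -- The ideal generated by the elements of `B` of positive degree is generated by finitely many of
  -- them; induction on the degree shows that these generate `B` as an algebra.
  let P : Set (MvPolynomial ι ℂ) := {f | f ∈ B ∧ ∃ d, 0 < d ∧ f.IsHomogeneous d}
  obtain ⟨F, hFP, hF⟩ := (Submodule.fg_span_iff_fg_span_finset_subset P).mp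
    (IsNoetherian.noetherian (Submodule.span (MvPolynomial ι ℂ) P))
  refine ⟨F, le_antisymm (Algebra.adjoin_le fun f hf => (hFP hf).1) ?_⟩
  have key : ∀ d, ∀ f ∈ B, f.IsHomogeneous d →
      f ∈ Algebra.adjoin ℂ (F : Set (MvPolynomial ι ℂ)) := by
    intro d
    induction d using Nat.strong_induction_on with
    | _ d ih =>
      intro f hfB hfd
      rcases Nat.eq_zero_or_pos d with rfl | hd
      · rw [← MvPolynomial.totalDegree_zero_iff_isHomogeneous,
          MvPolynomial.totalDegree_eq_zero_iff_eq_C] at hfd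
        rw [hfd]
        exact Subalgebra.algebraMap_mem _ _
      have hfs : f ∈ Submodule.span (MvPolynomial ι ℂ) (F : Set (MvPolynomial ι ℂ)) := by
        rw [← hF]
        exact Submodule.subset_span ⟨hfB, d, hd, hfd⟩
      obtain ⟨a, ha⟩ := (Submodule.mem_span_finset'.mp hfs)
      simp only [smul_eq_mul] at ha
      obtain ⟨a', ha'B, ha'⟩ := hlift F (fun f hf => (hFP hf).1) a (by rw [ha]; exact hfB)
      rw [ha] at ha'
      have hdeg : ∀ p : F, ∃ e, 0 < e ∧ p.1.IsHomogeneous e := fun p => (hFP p.2).2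
      choose e he0 he using hdeg
      -- Compare the components of degree `d`.
      have hcomp : ∀ p : F, MvPolynomial.homogeneousComponent d (a' p * p.1) ∈
          Algebra.adjoin ℂ (F : Set (MvPolynomial ι ℂ)) := by
        intro p
        have h1 : MvPolynomial.homogeneousComponent d (a' p * p.1) =
            ∑ i ∈ Finset.range ((a' p).totalDegree + 1),
              if i + e p = d then MvPolynomial.homogeneousComponent i (a' p) * p.1 else 0 := by
          conv_lhs => rw [← MvPolynomial.sum_homogeneousComponent (a' p), Finset.sum_mul, map_sum]
          refine Finset.sum_congr rfl fun i _ => ?_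
          rw [MvPolynomial.homogeneousComponent_of_mem
            ((MvPolynomial.homogeneousComponent_isHomogeneous i (a' p)).mul (he p))]
          simp only [eq_comm]
        rw [h1]
        refine Subalgebra.sum_mem _ fun i _ => ?_
        split_ifs with hi
        · refine Subalgebra.mul_mem _ (ih i ?_ _ (hhom _ (ha'B p) i)
            (MvPolynomial.homogeneousComponent_isHomogeneous i _)) (Algebra.subset_adjoin p.2)
          have := he0 p
          omega
        · exact Subalgebra.zero_mem _
      have h2 : f = ∑ p : F, MvPolynomial.homogeneousComponent d (a' p * p.1) := by
        rw [← map_sum, ha', MvPolynomial.homogeneousComponent_eq_self hfd]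
      rw [h2]
      exact Subalgebra.sum_mem _ fun p _ => hcomp p
  intro f hf
  rw [← MvPolynomial.sum_homogeneousComponent f]
  exact Subalgebra.sum_mem _ fun d _ => key d _ (hhom f hf d)
    (MvPolynomial.homogeneousComponent_isHomogeneous d f)

/-! ### Complete reducibility and invariants -/

variable {n : ℕ} {G : Subgroup (Matrix.GeneralLinearGroup (Fin n) ℂ)}

/-- Complete reducibility replaces the Reynolds operator: a fixed vector in the image of an
equivariant map lifts to a fixed vector, namely the component of any lift in an invariant
complement of the kernel. Equivariance is only needed in the form of the two hypotheses. -/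
theorem IsReductive.exists_fixed_lift (hG : IsReductive G) {M N : Type*} [AddCommGroup M]
    [Module ℂ M] [FiniteDimensional ℂ M] [AddCommGroup N] [Module ℂ N]
    {σ : Representation ℂ G M} (hσ : IsRational σ) (L : M →ₗ[ℂ] N)
    (hker : ∀ g x, L x = 0 → L (σ g x) = 0) (x : M) (hx : ∀ g, L (σ g x) = L x) :
    ∃ x', L x' = L x ∧ ∀ g, σ g x' = x' := by
  let e : M ≃ₗ[ℂ] (Fin (Module.finrank ℂ M) → ℂ) := (Module.finBasis ℂ M).equivFun
  let τ : Representation ℂ G (Fin (Module.finrank ℂ M) → ℂ) :=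
    { toFun := fun g => e.toLinearMap ∘ₗ σ g ∘ₗ e.symm.toLinearMap
      map_one' := by ext; simp
      map_mul' := fun g h => by
        refine LinearMap.ext fun v => ?_
        simp }
  have hτ : IsRational τ := fun φ w => hσ (φ ∘ₗ e.toLinearMap) (e.symm w)
  have hτe : ∀ g m, τ g (e m) = e (σ g m) := fun g m => by simp [τ]
  have hss := hG.isSemisimple _ τ hτ
  let k : Subrepresentation τ :=
    { toSubmodule := LinearMap.ker (L ∘ₗ e.symm.toLinearMap)
      apply_mem_toSubmodule := fun g v hv => by
        simp only [LinearMap.mem_ker, LinearMap.comp_apply, LinearEquiv.coe_coe] at hv ⊢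
        have := hker g (e.symm v) hv
        simpa [τ] using this }
  obtain ⟨c, hc⟩ := hss.exists_isCompl k
  have hsup : k.toSubmodule ⊔ c.toSubmodule = ⊤ := by
    rw [← Subrepresentation.toSubmodule_sup, hc.sup_eq_top]; rfl
  have hinf : k.toSubmodule ⊓ c.toSubmodule = ⊥ := by
    rw [← Subrepresentation.toSubmodule_inf, hc.inf_eq_bot]; rfl
  obtain ⟨a, ha, b, hb, hab⟩ := Submodule.mem_sup.mp (hsup ▸ Submodule.mem_top (x := e x))
  have ha' : L (e.symm a) = 0 := ha
  have hbx : e.symm b = x - e.symm a := by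
    rw [eq_sub_iff_add_eq, ← map_add, add_comm, hab, e.symm_apply_apply]
  refine ⟨e.symm b, by rw [hbx, map_sub, ha', sub_zero], fun g => ?_⟩
  have h1 : τ g b - b ∈ k.toSubmodule ⊓ c.toSubmodule := by
    refine ⟨?_, c.toSubmodule.sub_mem (c.apply_mem_toSubmodule g hb) hb⟩
    change L (e.symm (τ g b - b)) = 0
    have h2 : τ g b = e (σ g (e.symm b)) := by rw [← hτe, e.apply_symm_apply]
    rw [h2, map_sub, e.symm_apply_apply, hbx, map_sub, map_sub, map_sub, hx, hker g _ ha', map_sub, ha',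
      sub_self]
  rw [hinf, Submodule.mem_bot, sub_eq_zero] at h1
  apply e.injective
  rw [← hτe, e.apply_symm_apply, h1]

theorem IsRational.pi {κ M : Type*} [Fintype κ] [AddCommGroup M] [Module ℂ M]
    {σ : Representation ℂ G M} (hσ : IsRational σ) {τ : Representation ℂ G (κ → M)}
    (h : ∀ g a i, τ g a i = σ g (a i)) : IsRational τ := by
  classical
  intro φ a
  have : (fun g => φ (τ g a)) =
      ∑ i, fun g => (φ ∘ₗ LinearMap.single ℂ (fun _ => M) i) (σ g (a i)) := by
    funext g
    rw [Finset.sum_apply]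
    conv_lhs => rw [← Finset.univ_sum_single (τ g a)]
    rw [map_sum]
    refine Finset.sum_congr rfl fun i _ => ?_
    rw [LinearMap.comp_apply, LinearMap.single_apply, h]
  rw [this]
  exact Subalgebra.sum_mem _ fun i _ => hσ _ _

/-- The dual of a finite-dimensional space of polynomials is spanned by evaluations. -/
theorem span_range_eval_eq_top {ι : Type*} (M : Submodule ℂ (MvPolynomial ι ℂ))
    [FiniteDimensional ℂ M] :
    Submodule.span ℂ (Set.range fun y : ι → ℂ =>
      (MvPolynomial.aeval y).toLinearMap ∘ₗ M.subtype) = (⊤ : Submodule ℂ (Module.Dual ℂ M)) := by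
  refine Submodule.span_eq_top_of_ne_zero fun s hs => ?_
  by_contra! hcon
  refine hs (Subtype.ext (MvPolynomial.funext fun y => ?_))
  have := hcon _ ⟨y, rfl⟩
  simpa using this

theorem eval_mem_regularFunctions {ι : Type*} (f : ι → G → ℂ)
    (hf : ∀ o, f o ∈ regularFunctions G) (s : MvPolynomial ι ℂ) :
    (fun g => MvPolynomial.eval (fun o => f o g) s) ∈ regularFunctions G := by
  induction s using MvPolynomial.induction_on with
  | C a =>
    simp only [MvPolynomial.eval_C]
    exact (regularFunctions G).algebraMap_mem a
  | add p q hp hq =>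
    simp only [map_add]
    exact (regularFunctions G).add_mem hp hq
  | mul_X p o hp =>
    simp only [map_mul, MvPolynomial.eval_X]
    exact (regularFunctions G).mul_mem hp (hf o)

/-- If the group acts on the variables through regular functions, then linear functionals on a
finite-dimensional space of polynomials are regular along the action. -/
theorem dual_linSubst_mem_regularFunctions {ι : Type*} [Fintype ι] [DecidableEq ι]
    (T : G → (ι → ℂ) →ₗ[ℂ] (ι → ℂ))
    (hT : ∀ y o, (fun g => T g y o) ∈ regularFunctions G)
    (M : Submodule ℂ (MvPolynomial ι ℂ)) [FiniteDimensional ℂ M]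
    (hM : ∀ g, ∀ s ∈ M, linSubst (T g) s ∈ M) (φ : Module.Dual ℂ M) (s : M) :
    (fun g => φ ⟨linSubst (T g) s, hM g s s.2⟩) ∈ regularFunctions G := by
  have hφ : φ ∈ Submodule.span ℂ (Set.range fun y : ι → ℂ =>
      (MvPolynomial.aeval y).toLinearMap ∘ₗ M.subtype) := by
    rw [span_range_eval_eq_top]; trivial
  induction hφ using Submodule.span_induction with
  | mem φ h =>
    obtain ⟨y, rfl⟩ := h
    have := eval_mem_regularFunctions (fun o g => T g y o) (hT y) s.1
    simpa [MvPolynomial.aeval_eq_eval, eval_linSubst] using this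
  | zero => exact (regularFunctions G).zero_mem
  | add φ ψ _ _ h1 h2 => exact (regularFunctions G).add_mem h1 h2
  | smul c φ _ h => exact (regularFunctions G).smul_mem h c

end

/-! ### The coordinate ring of `GL_n(ℂ)` and its translations -/

section

open Filter Topology

variable {n : ℕ}

/-- Index set of coordinates on `GL_n(ℂ)`: the matrix entries, and `none` for `det⁻¹`. -/
abbrev Coord (n : ℕ) : Type := Option (Fin n × Fin n)

/-- The embedding `x ↦ (x, det(x)⁻¹)` of `GL_n(ℂ)` as a closed subset of an affine space. -/
noncomputable def pt (x : Matrix.GeneralLinearGroup (Fin n) ℂ) : Coord n → ℂ :=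
  fun o => o.elim x.val.det⁻¹ fun ij => x.val ij.1 ij.2

/-- The matrix part of a point of the affine space. -/
def matPart (y : Coord n → ℂ) : Matrix (Fin n) (Fin n) ℂ := fun i j => y (some (i, j))

/-- Linear extension of the right translation `x ↦ x * g`. -/
noncomputable def rightMap (g : Matrix.GeneralLinearGroup (Fin n) ℂ) :
    (Coord n → ℂ) →ₗ[ℂ] (Coord n → ℂ) where
  toFun y o := o.elim (y none * g.val.det⁻¹) fun ij => (matPart y * g.val) ij.1 ij.2
  map_add' y y' := by
    funext o
    cases o with
    | none => simp [add_mul]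
    | some ij => simp [Matrix.mul_apply, matPart, add_mul, Finset.sum_add_distrib]
  map_smul' c y := by
    funext o
    cases o with
    | none => simp [mul_assoc]
    | some ij => simp [Matrix.mul_apply, matPart, mul_assoc, Finset.mul_sum]

/-- Linear extension of the left translation `x ↦ h * x`. -/
noncomputable def leftMap (h : Matrix.GeneralLinearGroup (Fin n) ℂ) :
    (Coord n → ℂ) →ₗ[ℂ] (Coord n → ℂ) where
  toFun y o := o.elim (h.val.det⁻¹ * y none) fun ij => (h.val * matPart y) ij.1 ij.2
  map_add' y y' := by
    funext o
    cases o with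
    | none => simp [mul_add]
    | some ij => simp [Matrix.mul_apply, matPart, mul_add, Finset.sum_add_distrib]
  map_smul' c y := by
    funext o
    cases o with
    | none => simp [mul_left_comm]
    | some ij => simp [Matrix.mul_apply, matPart, mul_left_comm, Finset.mul_sum]

theorem matPart_pt (x : Matrix.GeneralLinearGroup (Fin n) ℂ) : matPart (pt x) = x.val := rfl

theorem matPart_rightMap (g : Matrix.GeneralLinearGroup (Fin n) ℂ) (y : Coord n → ℂ) :
    matPart (rightMap g y) = matPart y * g.val := rfl

theorem matPart_leftMap (g : Matrix.GeneralLinearGroup (Fin n) ℂ) (y : Coord n → ℂ) :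
    matPart (leftMap g y) = g.val * matPart y := rfl

theorem coord_ext {y y' : Coord n → ℂ} (h : y none = y' none) (h' : matPart y = matPart y') :
    y = y' := by
  funext o
  cases o with
  | none => exact h
  | some ij => exact congrFun (congrFun h' ij.1) ij.2

theorem rightMap_pt (g x : Matrix.GeneralLinearGroup (Fin n) ℂ) :
    rightMap g (pt x) = pt (x * g) := by
  refine coord_ext ?_ ?_
  · simp [rightMap, pt, mul_comm]
  · rw [matPart_rightMap, matPart_pt, matPart_pt, Units.val_mul]

theorem leftMap_pt (h x : Matrix.GeneralLinearGroup (Fin n) ℂ) :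
    leftMap h (pt x) = pt (h * x) := by
  refine coord_ext ?_ ?_
  · simp [leftMap, pt, mul_comm]
  · rw [matPart_leftMap, matPart_pt, matPart_pt, Units.val_mul]

theorem rightMap_mul (g g' : Matrix.GeneralLinearGroup (Fin n) ℂ) :
    rightMap (g * g') = rightMap g' ∘ₗ rightMap g := by
  refine LinearMap.ext fun y => coord_ext ?_ ?_
  · simp [rightMap]
    ring
  · rw [LinearMap.comp_apply, matPart_rightMap, matPart_rightMap, matPart_rightMap, Units.val_mul,
      mul_assoc]

theorem rightMap_one : rightMap (1 : Matrix.GeneralLinearGroup (Fin n) ℂ) = LinearMap.id := by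
  refine LinearMap.ext fun y => coord_ext ?_ ?_
  · simp [rightMap]
  · rw [matPart_rightMap, Units.val_one, mul_one, LinearMap.id_apply]

theorem leftMap_mul (g g' : Matrix.GeneralLinearGroup (Fin n) ℂ) :
    leftMap (g * g') = leftMap g ∘ₗ leftMap g' := by
  refine LinearMap.ext fun y => coord_ext ?_ ?_
  · simp [leftMap]
    ring
  · rw [LinearMap.comp_apply, matPart_leftMap, matPart_leftMap, matPart_leftMap, Units.val_mul,
      mul_assoc]

theorem leftMap_one : leftMap (1 : Matrix.GeneralLinearGroup (Fin n) ℂ) = LinearMap.id := by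
  refine LinearMap.ext fun y => coord_ext ?_ ?_
  · simp [leftMap]
  · rw [matPart_leftMap, Units.val_one, one_mul, LinearMap.id_apply]

theorem leftMap_comp_rightMap (h g : Matrix.GeneralLinearGroup (Fin n) ℂ) :
    leftMap h ∘ₗ rightMap g = rightMap g ∘ₗ leftMap h := by
  refine LinearMap.ext fun y => coord_ext ?_ ?_
  · simp [leftMap, rightMap, mul_assoc]
  · simp only [LinearMap.comp_apply, matPart_leftMap, matPart_rightMap, mul_assoc]

theorem entry_mem_regularFunctions (G : Subgroup (Matrix.GeneralLinearGroup (Fin n) ℂ))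
    (i j : Fin n) :
    (fun g : G => (g : Matrix.GeneralLinearGroup (Fin n) ℂ).val i j) ∈ regularFunctions G :=
  Algebra.subset_adjoin (Or.inl ⟨(i, j), rfl⟩)

theorem det_inv_mem_regularFunctions (G : Subgroup (Matrix.GeneralLinearGroup (Fin n) ℂ)) :
    (fun g : G => (g : Matrix.GeneralLinearGroup (Fin n) ℂ).val.det⁻¹) ∈ regularFunctions G :=
  Algebra.subset_adjoin (Or.inr rfl)

theorem rightMap_mem_regularFunctions (G : Subgroup (Matrix.GeneralLinearGroup (Fin n) ℂ))
    (y : Coord n → ℂ) (o : Coord n) :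
    (fun g : G => rightMap (g : Matrix.GeneralLinearGroup (Fin n) ℂ) y o) ∈
      regularFunctions G := by
  cases o with
  | none => exact (regularFunctions G).smul_mem (det_inv_mem_regularFunctions G) (y none)
  | some ij =>
    have : (fun g : G => rightMap (g : Matrix.GeneralLinearGroup (Fin n) ℂ) y (some ij)) =
        ∑ k, matPart y ij.1 k • fun g : G =>
          (g : Matrix.GeneralLinearGroup (Fin n) ℂ).val k ij.2 := by
      funext g
      simp [rightMap, Matrix.mul_apply]
    rw [this]
    exact (regularFunctions G).sum_mem fun k _ =>
      (regularFunctions G).smul_mem (entry_mem_regularFunctions G k ij.2) _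

theorem leftMap_mem_regularFunctions (G : Subgroup (Matrix.GeneralLinearGroup (Fin n) ℂ))
    (y : Coord n → ℂ) (o : Coord n) :
    (fun g : G => leftMap (g : Matrix.GeneralLinearGroup (Fin n) ℂ) y o) ∈
      regularFunctions G := by
  cases o with
  | none =>
    have : (fun g : G => leftMap (g : Matrix.GeneralLinearGroup (Fin n) ℂ) y none) =
        y none • fun g : G => (g : Matrix.GeneralLinearGroup (Fin n) ℂ).val.det⁻¹ := by
      funext g
      simp [leftMap, mul_comm]
    rw [this]
    exact (regularFunctions G).smul_mem (det_inv_mem_regularFunctions G) (y none)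
  | some ij =>
    have : (fun g : G => leftMap (g : Matrix.GeneralLinearGroup (Fin n) ℂ) y (some ij)) =
        ∑ k, matPart y k ij.2 • fun g : G =>
          (g : Matrix.GeneralLinearGroup (Fin n) ℂ).val ij.1 k := by
      funext g
      simp [leftMap, Matrix.mul_apply, mul_comm]
    rw [this]
    exact (regularFunctions G).sum_mem fun k _ =>
      (regularFunctions G).smul_mem (entry_mem_regularFunctions G ij.1 k) _

/-- The equation `det(x) * c = 1` cutting out `GL_n(ℂ)` in the affine space. -/
noncomputable def detPoly (n : ℕ) : MvPolynomial (Coord n) ℂ :=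
  (Matrix.of fun i j : Fin n => MvPolynomial.X (some (i, j))).det * MvPolynomial.X none - 1

theorem eval_detPoly (y : Coord n → ℂ) :
    MvPolynomial.eval y (detPoly n) = (matPart y).det * y none - 1 := by
  rw [detPoly, map_sub, map_mul, RingHom.map_det, MvPolynomial.eval_X, map_one]
  congr 3
  ext i j
  simp [matPart]

theorem eval_pt_detPoly (x : Matrix.GeneralLinearGroup (Fin n) ℂ) :
    MvPolynomial.eval (pt x) (detPoly n) = 0 := by
  rw [eval_detPoly, matPart_pt, sub_eq_zero]
  exact mul_inv_cancel₀ ((Matrix.isUnit_iff_isUnit_det _).mp x.isUnit).ne_zero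

theorem exists_eq_pt {y : Coord n → ℂ} (h : MvPolynomial.eval y (detPoly n) = 0) :
    ∃ x, y = pt x := by
  rw [eval_detPoly, sub_eq_zero] at h
  have h0 : (matPart y).det ≠ 0 := left_ne_zero_of_mul_eq_one h
  exact ⟨Matrix.GeneralLinearGroup.mkOfDetNeZero (matPart y) h0,
    coord_ext (eq_inv_of_mul_eq_one_right h) rfl⟩

/-- The weak Nullstellensatz. -/
theorem exists_eval_eq_zero_of_ne_top {ι : Type*} [Finite ι] {I : Ideal (MvPolynomial ι ℂ)}
    (hI : I ≠ ⊤) : ∃ y : ι → ℂ, ∀ p ∈ I, MvPolynomial.eval y p = 0 := by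
  obtain ⟨J, hJ, hIJ⟩ := Ideal.exists_le_maximal I hI
  obtain ⟨y, rfl⟩ := MvPolynomial.eq_vanishingIdeal_singleton_of_isMaximal ℂ hJ
  exact ⟨y, fun p hp => by
    simpa [MvPolynomial.aeval_eq_eval] using (MvPolynomial.mem_vanishingIdeal_singleton_iff y p).mp (hIJ hp)⟩

/-! ### Invariants of a reductive group acting by right translations -/

/-- The polynomials invariant under right translation by `G`. -/
noncomputable def invariants (G : Subgroup (Matrix.GeneralLinearGroup (Fin n) ℂ)) :
    Subalgebra ℂ (MvPolynomial (Coord n) ℂ) where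
  carrier := {s | ∀ g ∈ G, linSubst (rightMap g) s = s}
  mul_mem' := fun ha hb g hg => by rw [map_mul, ha g hg, hb g hg]
  add_mem' := fun ha hb g hg => by rw [map_add, ha g hg, hb g hg]
  algebraMap_mem' := fun c g _ => AlgHom.commutes _ c

variable {G : Subgroup (Matrix.GeneralLinearGroup (Fin n) ℂ)}

theorem linSubst_mem_restrictTotalDegree {ι : Type*} [Fintype ι] [DecidableEq ι]
    (T : (ι → ℂ) →ₗ[ℂ] (ι → ℂ)) (d : ℕ) :
    ∀ s ∈ MvPolynomial.restrictTotalDegree ι ℂ d,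
      linSubst T s ∈ MvPolynomial.restrictTotalDegree ι ℂ d := fun s hs => by
  rw [MvPolynomial.mem_restrictTotalDegree] at hs ⊢
  exact (totalDegree_linSubst_le T s).trans hs

/-- The representation of `G` by right translations on polynomials of degree at most `d`. -/
noncomputable def polyRep (G : Subgroup (Matrix.GeneralLinearGroup (Fin n) ℂ)) (d : ℕ) :
    Representation ℂ G (MvPolynomial.restrictTotalDegree (Coord n) ℂ d) where
  toFun g := (linSubst (rightMap g)).toLinearMap.restrict (linSubst_mem_restrictTotalDegree _ d)
  map_one' := LinearMap.ext fun s => Subtype.ext <| by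
    change linSubst (rightMap 1) s.1 = s.1
    rw [rightMap_one, linSubst_id]
  map_mul' g h := LinearMap.ext fun s => Subtype.ext <| by
    change linSubst (rightMap (g * h)) s.1 = linSubst (rightMap g) (linSubst (rightMap h) s.1)
    rw [linSubst_linSubst, ← rightMap_mul]
    rfl

theorem isRational_polyRep (d : ℕ) : IsRational (polyRep G d) := fun φ s =>
  dual_linSubst_mem_regularFunctions
    (fun g : G => rightMap (g : Matrix.GeneralLinearGroup (Fin n) ℂ))
    (rightMap_mem_regularFunctions G) _ (fun _ => linSubst_mem_restrictTotalDegree _ d) φ s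

/-- Lifting of invariants from the image of an equivariant linear map on tuples of polynomials. -/
theorem IsReductive.exists_invariant_tuple (hG : IsReductive G) {κ N : Type*} [Fintype κ]
    [AddCommGroup N] [Module ℂ N] (L : (κ → MvPolynomial (Coord n) ℂ) →ₗ[ℂ] N)
    (hker : ∀ g ∈ G, ∀ a, L a = 0 → L (fun i => linSubst (rightMap g) (a i)) = 0)
    (a : κ → MvPolynomial (Coord n) ℂ)
    (ha : ∀ g ∈ G, L (fun i => linSubst (rightMap g) (a i)) = L a) :
    ∃ a' : κ → MvPolynomial (Coord n) ℂ, (∀ i, a' i ∈ invariants G) ∧ L a' = L a := by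
  let d := Finset.univ.sup fun i => (a i).totalDegree
  let M := MvPolynomial.restrictTotalDegree (Coord n) ℂ d
  have had : ∀ i, a i ∈ M := fun i => by
    rw [MvPolynomial.mem_restrictTotalDegree]
    exact Finset.le_sup (f := fun i => (a i).totalDegree) (Finset.mem_univ i)
  let τ : Representation ℂ G (κ → M) :=
    { toFun := fun g => LinearMap.pi fun i => polyRep G d g ∘ₗ LinearMap.proj i
      map_one' := by
        refine LinearMap.ext fun v => funext fun i => ?_
        simp
      map_mul' := fun g h => by
        refine LinearMap.ext fun v => funext fun i => ?_
        simp }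
  have hτ : IsRational τ := (isRational_polyRep (G := G) d).pi fun g a i => rfl
  obtain ⟨x', hx', hfix⟩ := hG.exists_fixed_lift hτ
    (L ∘ₗ LinearMap.pi fun i => M.subtype ∘ₗ LinearMap.proj i)
    (fun g x hx => hker g g.2 (fun i => (x i : MvPolynomial (Coord n) ℂ)) hx)
    (fun i => ⟨a i, had i⟩) (fun g => ha g g.2)
  refine ⟨fun i => x' i, fun i g hg => ?_, hx'⟩
  exact congrArg Subtype.val (congrFun (hfix ⟨g, hg⟩) i)

theorem IsReductive.exists_finset_adjoin_eq_invariants (hG : IsReductive G) :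
    ∃ F : Finset (MvPolynomial (Coord n) ℂ), Algebra.adjoin ℂ (F : Set _) = invariants G := by
  refine exists_finset_adjoin_eq _ (fun f hf d g hg => ?_) fun F hF a ha => ?_
  · rw [← homogeneousComponent_linSubst, hf g hg]
  · let L : (F → MvPolynomial (Coord n) ℂ) →ₗ[ℂ] MvPolynomial (Coord n) ℂ :=
      ∑ f : F, LinearMap.mulRight ℂ (f : MvPolynomial (Coord n) ℂ) ∘ₗ LinearMap.proj f
    have hL : ∀ a, L a = ∑ f : F, a f * f := fun a => by simp [L]
    have hLg : ∀ g ∈ G, ∀ a, L (fun i => linSubst (rightMap g) (a i)) =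
        linSubst (rightMap g) (L a) := by
      intro g hg a
      rw [hL, hL, map_sum]
      refine Finset.sum_congr rfl fun f _ => ?_
      rw [map_mul, hF f f.2 g hg]
    obtain ⟨a', ha', h⟩ := hG.exists_invariant_tuple L
      (fun g hg a h => by rw [hLg g hg, h, map_zero]) a
      (fun g hg => by rw [hLg g hg, hL]; exact ha g hg)
    exact ⟨a', ha', by rw [← hL, ← hL, h]⟩

theorem eval_pt_eq_of_mem_invariants {s : MvPolynomial (Coord n) ℂ} (hs : s ∈ invariants G)
    {g : Matrix.GeneralLinearGroup (Fin n) ℂ} (hg : g ∈ G) :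
    MvPolynomial.eval (pt g) s = MvPolynomial.eval (pt 1) s := by
  conv_rhs => rw [← hs g hg]
  rw [eval_linSubst, rightMap_pt, one_mul]

/-- Invariants separate `G` from its other left cosets: these are disjoint Zariski-closed sets, so
some polynomial is `0` on `G` and `1` on `h G`, and this restriction to `G ∪ h G` lifts to an
invariant. -/
theorem IsReductive.mem_of_eval_invariants_eq (hG : IsReductive G)
    {h : Matrix.GeneralLinearGroup (Fin n) ℂ}
    (hh : ∀ s ∈ invariants G, MvPolynomial.eval (pt h) s = MvPolynomial.eval (pt 1) s) :
    h ∈ G := by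
  by_contra hhG
  obtain ⟨S, hS⟩ := hG.isZariskiClosed
  let I₁ := MvPolynomial.vanishingIdeal ℂ (Set.range fun g : G => pt g.1)
  let I₂ := MvPolynomial.vanishingIdeal ℂ (Set.range fun g : G => pt (h * g.1))
  -- By the Nullstellensatz, since `G` and `h G` have no common point.
  have htop : I₁ ⊔ I₂ = ⊤ := by
    by_contra hne
    obtain ⟨y, hy⟩ := exists_eval_eq_zero_of_ne_top hne
    obtain ⟨x, rfl⟩ := exists_eq_pt (hy (detPoly n) (Ideal.mem_sup_left (by
      rintro _ ⟨g, rfl⟩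
      exact eval_pt_detPoly g.1)))
    have hren : ∀ (p : MvPolynomial (Fin n × Fin n) ℂ) (x : Matrix.GeneralLinearGroup (Fin n) ℂ),
        MvPolynomial.eval (pt x) (MvPolynomial.rename some p) =
          MvPolynomial.eval (fun ij => x.val ij.1 ij.2) p := by
      intro p x
      rw [MvPolynomial.eval_rename]
      rfl
    have h1 : x ∈ G := (hS x).mpr fun p hp => by
      rw [← hren]
      refine hy _ (Ideal.mem_sup_left ?_)
      rintro _ ⟨g, rfl⟩
      exact (hren p g.1).trans ((hS g.1).mp g.2 p hp)
    have h2 : h⁻¹ * x ∈ G := (hS _).mpr fun p hp => by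
      rw [← hren, ← leftMap_pt, ← eval_linSubst]
      refine hy _ (Ideal.mem_sup_right ?_)
      rintro _ ⟨g, rfl⟩
      change MvPolynomial.eval _ _ = 0
      rw [eval_linSubst, leftMap_pt, inv_mul_cancel_left, hren]
      exact (hS g.1).mp g.2 p hp
    exact hhG (by simpa using G.mul_mem h1 (G.inv_mem h2))
  obtain ⟨a, ha, b, hb, hab⟩ := Submodule.mem_sup.mp
    (htop ▸ Submodule.mem_top (x := (1 : MvPolynomial (Coord n) ℂ)))
  have ha' : ∀ g : G, MvPolynomial.eval (pt g.1) a = 0 := fun g => ha _ ⟨g, rfl⟩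
  have hb' : ∀ g : G, MvPolynomial.eval (pt (h * g.1)) a = 1 := fun g => by
    have h1 : MvPolynomial.eval (pt (h * g.1)) b = 0 := hb _ ⟨g, rfl⟩
    have h2 := congrArg (MvPolynomial.eval (pt (h * g.1))) hab
    rwa [map_add, h1, add_zero, map_one] at h2
  -- Restriction to `G` and to `h G`.
  let L : (Unit → MvPolynomial (Coord n) ℂ) →ₗ[ℂ] (G → ℂ) × (G → ℂ) :=
    (LinearMap.prod
      (LinearMap.pi fun g : G => (MvPolynomial.aeval (pt g.1)).toLinearMap)
      (LinearMap.pi fun g : G => (MvPolynomial.aeval (pt (h * g.1))).toLinearMap)) ∘ₗ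
      LinearMap.proj ()
  have hL : ∀ a, L a = (fun g : G => MvPolynomial.eval (pt g.1) (a ()),
      fun g : G => MvPolynomial.eval (pt (h * g.1)) (a ())) := fun a => rfl
  have hLg : ∀ g (hg : g ∈ G), ∀ a, L (fun i => linSubst (rightMap g) (a i)) =
      (fun j => (L a).1 (j * ⟨g, hg⟩), fun j => (L a).2 (j * ⟨g, hg⟩)) := by
    intro g hg a
    simp only [hL, eval_linSubst, rightMap_pt, Subgroup.coe_mul, mul_assoc]
  obtain ⟨a', ha'inv, ha'L⟩ := hG.exists_invariant_tuple L
    (fun g hg a h => by rw [hLg g hg, h]; rfl) (fun _ => a)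
    (fun g hg => by rw [hLg g hg, hL]; simp only [ha', hb'])
  have e1 := congrFun (congrArg Prod.fst ha'L) 1
  have e2 := congrFun (congrArg Prod.snd ha'L) 1
  simp only [hL] at e1 e2
  rw [ha'] at e1
  rw [hb'] at e2
  simp only [Subgroup.coe_one, mul_one] at e1 e2
  have := hh _ (ha'inv ())
  rw [e1, e2] at this
  exact one_ne_zero this

/-- If the values of all generating invariants converge along a sequence in `GL_n(ℂ)`, the limit is
again the tuple of values at a point of `GL_n(ℂ)`. Otherwise, by the Nullstellensatz, `1` would be
a combination of the functions `f - c f`; its coefficients may be taken invariant, and passing to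
the limit gives `1 = 0`. -/
theorem IsReductive.exists_eval_eq_of_tendsto (hG : IsReductive G)
    {F : Finset (MvPolynomial (Coord n) ℂ)}
    (hF : Algebra.adjoin ℂ (F : Set (MvPolynomial (Coord n) ℂ)) = invariants G)
    (x : ℕ → Matrix.GeneralLinearGroup (Fin n) ℂ) (c : F → ℂ)
    (hc : ∀ f : F, Tendsto (fun j => MvPolynomial.eval (pt (x j)) f.1) atTop (𝓝 (c f))) :
    ∃ y, ∀ f : F, MvPolynomial.eval (pt y) f.1 = c f := by
  have hFG : ∀ f : F, f.1 ∈ invariants G := fun f => hF ▸ Algebra.subset_adjoin f.2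
  have hconv : ∀ s ∈ invariants G,
      ∃ b, Tendsto (fun j => MvPolynomial.eval (pt (x j)) s) atTop (𝓝 b) := by
    intro s hs
    rw [← hF] at hs
    induction hs using Algebra.adjoin_induction with
    | mem f hf => exact ⟨_, hc ⟨f, hf⟩⟩
    | algebraMap r => exact ⟨r, by simp [MvPolynomial.algebraMap_eq]⟩
    | add p q _ _ hp hq =>
      obtain ⟨a, ha⟩ := hp
      obtain ⟨b, hb⟩ := hq
      exact ⟨a + b, by simpa using ha.add hb⟩
    | mul p q _ _ hp hq =>
      obtain ⟨a, ha⟩ := hp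
      obtain ⟨b, hb⟩ := hq
      exact ⟨a * b, by simpa using ha.mul hb⟩
  let r : F → MvPolynomial (Coord n) ℂ := fun f => f.1 - MvPolynomial.C (c f)
  by_cases htop : Ideal.span (Set.range r) ⊔ Ideal.span {detPoly n} = ⊤
  · exfalso
    obtain ⟨p, hp, q, hq, hpq⟩ := Submodule.mem_sup.mp
      (htop ▸ Submodule.mem_top (x := (1 : MvPolynomial (Coord n) ℂ)))
    obtain ⟨a, rfl⟩ := (Ideal.mem_span_range_iff_exists_fun).mp hp
    obtain ⟨b, rfl⟩ := Ideal.mem_span_singleton'.mp hq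
    -- The combination `∑ a f * (f - c f)`, as a function on `GL_n(ℂ)`.
    let L : (F → MvPolynomial (Coord n) ℂ) →ₗ[ℂ]
        (Matrix.GeneralLinearGroup (Fin n) ℂ → ℂ) :=
      LinearMap.pi fun y => (MvPolynomial.aeval (pt y)).toLinearMap ∘ₗ
        ∑ f : F, LinearMap.mulRight ℂ (r f) ∘ₗ LinearMap.proj f
    have hL : ∀ a y, L a y =
        ∑ f : F, MvPolynomial.eval (pt y) (a f) * (MvPolynomial.eval (pt y) f.1 - c f) := by
      intro a y
      simp [L, r, MvPolynomial.aeval_eq_eval]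
    have hL1 : ∀ y, L a y = 1 := by
      intro y
      have h1 := congrArg (MvPolynomial.eval (pt y)) hpq
      rw [map_add, map_mul, eval_pt_detPoly, mul_zero, add_zero, map_one, map_sum] at h1
      rw [hL, ← h1]
      simp [r]
    have hLg : ∀ g ∈ G, ∀ a y, L (fun i => linSubst (rightMap g) (a i)) y = L a (y * g) := by
      intro g hg a y
      simp only [hL, eval_linSubst, rightMap_pt]
      refine Finset.sum_congr rfl fun f _ => ?_
      have h1 := congrArg (MvPolynomial.eval (pt y)) (hFG f g hg)
      rw [eval_linSubst, rightMap_pt] at h1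
      rw [h1]
    obtain ⟨a', ha'inv, ha'L⟩ := hG.exists_invariant_tuple L
      (fun g hg a h => by funext y; rw [hLg g hg, h]; rfl) a
      (fun g hg => by funext y; rw [hLg g hg, hL1, hL1])
    choose b' hb' using fun f => hconv _ (ha'inv f)
    have hlim : Tendsto (fun j => L a' (x j)) atTop (𝓝 (∑ f : F, b' f * (c f - c f))) := by
      simp only [hL]
      exact tendsto_finsetSum _ fun f _ => (hb' f).mul ((hc f).sub_const _)
    have hone : (fun j => L a' (x j)) = fun _ => 1 := by
      funext j
      rw [ha'L, hL1]
    rw [hone] at hlim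
    have := tendsto_nhds_unique hlim tendsto_const_nhds
    simp at this
  · obtain ⟨y, hy⟩ := exists_eval_eq_zero_of_ne_top htop
    obtain ⟨x, rfl⟩ := exists_eq_pt (hy _ (Ideal.mem_sup_right (Ideal.mem_span_singleton_self _)))
    refine ⟨x, fun f => ?_⟩
    have := hy (r f) (Ideal.mem_sup_left (Ideal.subset_span ⟨f, rfl⟩))
    rwa [map_sub, MvPolynomial.eval_C, sub_eq_zero] at this

/-- A reductive group `G ⊆ GL_n(ℂ)` is the stabiliser of a vector with closed orbit in a rational
representation of `GL_n(ℂ)`. The representation is the dual of a space of invariants generating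
the invariant ring, the vector is evaluation at the identity. -/
theorem IsReductive.exists_closed_orbit (hG : IsReductive G) :
    ∃ (D : Type) (_ : AddCommGroup D) (_ : Module ℂ D) (_ : FiniteDimensional ℂ D)
      (π : Representation ℂ (⊤ : Subgroup (Matrix.GeneralLinearGroup (Fin n) ℂ)) D) (v : D),
      IsRational π ∧
      (∀ h, π h v = v ↔ (h : Matrix.GeneralLinearGroup (Fin n) ℂ) ∈ G) ∧
      ∀ (m : ℕ) (φ : D ≃ₗ[ℂ] EuclideanSpace ℂ (Fin m)),
        IsClosed (Set.range fun h => φ (π h v)) := by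
  obtain ⟨F, hF⟩ := hG.exists_finset_adjoin_eq_invariants
  have hFG : ∀ f : F, f.1 ∈ invariants G := fun f => hF ▸ Algebra.subset_adjoin f.2
  let d := F.sup MvPolynomial.totalDegree
  let M : Submodule ℂ (MvPolynomial (Coord n) ℂ) :=
    MvPolynomial.restrictTotalDegree (Coord n) ℂ d ⊓ (invariants G).toSubmodule
  have hFM : ∀ f : F, f.1 ∈ M := fun f => ⟨by
    rw [SetLike.mem_coe, MvPolynomial.mem_restrictTotalDegree]
    exact Finset.le_sup f.2, hFG f⟩
  have hM : ∀ h, ∀ s ∈ M, linSubst (leftMap h) s ∈ M := by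
    rintro h s ⟨hs, hs'⟩
    refine ⟨linSubst_mem_restrictTotalDegree _ d s hs, fun g hg => ?_⟩
    rw [linSubst_linSubst, leftMap_comp_rightMap, ← linSubst_linSubst, hs' g hg]
  let lam : (h : Matrix.GeneralLinearGroup (Fin n) ℂ) → M →ₗ[ℂ] M := fun h =>
    (linSubst (leftMap h)).toLinearMap.restrict (hM h)
  have hlam1 : lam 1 = LinearMap.id := LinearMap.ext fun s => Subtype.ext <| by
    change linSubst (leftMap 1) s.1 = s.1
    rw [leftMap_one, linSubst_id]
  have hlam : ∀ g h, lam (g * h) = lam h ∘ₗ lam g := fun g h =>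
    LinearMap.ext fun s => Subtype.ext <| by
      change linSubst (leftMap (g * h)) s.1 = linSubst (leftMap h) (linSubst (leftMap g) s.1)
      rw [linSubst_linSubst, leftMap_mul]
  let π : Representation ℂ (⊤ : Subgroup (Matrix.GeneralLinearGroup (Fin n) ℂ))
      (Module.Dual ℂ M) :=
    { toFun := fun h => (lam h.1).dualMap
      map_one' := by
        change (lam 1).dualMap = _
        rw [hlam1]; rfl
      map_mul' := fun g h => by
        change (lam (g.1 * h.1)).dualMap = _
        rw [hlam]; rfl }
  let v : Module.Dual ℂ M := (MvPolynomial.aeval (pt 1)).toLinearMap ∘ₗ M.subtype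
  have hπv : ∀ h (s : M), π h v s = MvPolynomial.eval (pt h.1) s.1 := by
    intro h s
    change MvPolynomial.eval (pt 1) (linSubst (leftMap h.1) s.1) = _
    rw [eval_linSubst, leftMap_pt, mul_one]
  refine ⟨Module.Dual ℂ M, inferInstance, inferInstance, inferInstance, π, v, ?_, ?_, ?_⟩
  · intro Φ ℓ
    obtain ⟨s, rfl⟩ := (Module.evalEquiv ℂ M).surjective Φ
    exact dual_linSubst_mem_regularFunctions
      (fun g : (⊤ : Subgroup (Matrix.GeneralLinearGroup (Fin n) ℂ)) => leftMap g.1)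
      (leftMap_mem_regularFunctions ⊤) M (fun g => hM g.1) ℓ s
  · intro h
    constructor
    · intro hfix
      refine hG.mem_of_eval_invariants_eq fun s hs => ?_
      rw [← hF] at hs
      induction hs using Algebra.adjoin_induction with
      | mem f hf =>
        rw [← hπv h ⟨f, hFM ⟨f, hf⟩⟩, hfix]
        rfl
      | algebraMap r => simp [MvPolynomial.algebraMap_eq]
      | add p q _ _ hp hq => rw [map_add, map_add, hp, hq]
      | mul p q _ _ hp hq => rw [map_mul, map_mul, hp, hq]
    · intro hh
      refine LinearMap.ext fun s => ?_
      rw [hπv]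
      exact eval_pt_eq_of_mem_invariants s.2.2 hh
  · intro m φ
    refine IsSeqClosed.isClosed fun x y hx hxy => ?_
    choose h hh using hx
    have hc : ∀ s : M, Tendsto (fun j => MvPolynomial.eval (pt (h j).1) s.1) atTop
        (𝓝 (φ.symm y s)) := by
      intro s
      have hcont : Continuous fun z => φ.symm z s :=
        ((Module.Dual.eval ℂ M s) ∘ₗ φ.symm.toLinearMap).continuous_of_finiteDimensional
      have := (hcont.tendsto y).comp hxy
      refine this.congr fun j => ?_
      rw [Function.comp_apply, ← hh j]
      simp only [LinearEquiv.symm_apply_apply]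
      exact hπv (h j) s
    obtain ⟨x₀, hx₀⟩ := hG.exists_eval_eq_of_tendsto hF (fun j => (h j).1)
      (fun f => φ.symm y ⟨f.1, hFM f⟩) fun f => hc ⟨f.1, hFM f⟩
    -- The limit functional and evaluation at `x₀` agree on `M`, as the latter is the limit of the
    -- evaluations on the whole algebra generated by `F`.
    have hlim : ∀ s ∈ invariants G, Tendsto (fun j => MvPolynomial.eval (pt (h j).1) s) atTop
        (𝓝 (MvPolynomial.eval (pt x₀) s)) := by
      intro s hs
      rw [← hF] at hs
      induction hs using Algebra.adjoin_induction with
      | mem f hf =>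
        rw [hx₀ ⟨f, hf⟩]
        exact hc ⟨f, hFM ⟨f, hf⟩⟩
      | algebraMap r => simp [MvPolynomial.algebraMap_eq]
      | add p q _ _ hp hq => simpa using hp.add hq
      | mul p q _ _ hp hq => simpa using hp.mul hq
    refine ⟨⟨x₀, trivial⟩, ?_⟩
    change φ (π ⟨x₀, trivial⟩ v) = y
    rw [← φ.apply_symm_apply y]
    congr 1
    refine LinearMap.ext fun s => ?_
    rw [hπv]
    exact tendsto_nhds_unique (hlim s s.2.2) (hc s)

end

/-! ### Vectors of minimal norm and self-adjointness of reductive groups -/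

section

open Filter Topology
open scoped Matrix.Norms.L2Operator

variable {n : ℕ} {G : Subgroup (Matrix.GeneralLinearGroup (Fin n) ℂ)}

/-- Expansion of a one-parameter orbit of a rational representation in a Hermitian norm which is
invariant under the compact part of the one-parameter group. -/
theorem IsRational.exists_expSum_norm {W : Type*} [AddCommGroup W] [Module ℂ W]
    [FiniteDimensional ℂ W] {ρ : Representation ℂ G W} (hρ : IsRational ρ) {m : ℕ}
    (φ : W ≃ₗ[ℂ] EuclideanSpace ℂ (Fin m)) (v : Matrix.GeneralLinearGroup (Fin n) ℂ)
    (l : Fin n → ℝ) (hmem : ∀ z, oneParam v l z ∈ G)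
    (hinv : ∀ (θ : ℝ) x, ‖φ (ρ ⟨oneParam v l (Complex.I * θ), hmem _⟩ x)‖ = ‖φ x‖) (w : W) :
    ∃ (s : Finset ℝ) (y : ℝ → EuclideanSpace ℂ (Fin m)),
      (∀ z, φ (ρ ⟨oneParam v l z, hmem z⟩ w) = expSum s y z) ∧
      ∀ t θ : ℝ, ‖expSum s y (t + Complex.I * θ)‖ = ‖expSum s y t‖ := by
  obtain ⟨s, y, hy⟩ := hρ.exists_expSum v l w
  have h1 : ∀ z, φ (ρ ⟨oneParam v l z, hmem z⟩ w) = expSum s (fun μ => φ (y μ)) z := by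
    intro z
    rw [hy z (hmem z)]
    simp [expSum]
  refine ⟨s, _, h1, fun t θ => ?_⟩
  rw [← h1, ← h1, ← hinv θ (ρ ⟨oneParam v l t, hmem t⟩ w), ← Module.End.mul_apply, ← map_mul]
  congr 4
  ext : 1
  rw [Subgroup.coe_mul, ← oneParam_add, add_comm]

theorem exists_norm_le_of_isClosed {m : ℕ} {S : Set (EuclideanSpace ℂ (Fin m))} (hS : IsClosed S)
    (hne : S.Nonempty) : ∃ x ∈ S, ∀ y ∈ S, ‖x‖ ≤ ‖y‖ := by
  obtain ⟨x, hx, h⟩ := hS.exists_infDist_eq_dist hne 0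
  refine ⟨x, hx, fun y hy => ?_⟩
  have := Metric.infDist_le_dist_of_mem (x := (0 : EuclideanSpace ℂ (Fin m))) hy
  rwa [h, dist_zero_left, dist_zero_left] at this

/-- The squared Hilbert–Schmidt norm. -/
noncomputable def hsNormSq (A : Matrix (Fin n) (Fin n) ℂ) : ℝ := ∑ i, ∑ j, ‖A i j‖ ^ 2

theorem ofReal_hsNormSq (A : Matrix (Fin n) (Fin n) ℂ) :
    ((hsNormSq A : ℝ) : ℂ) = (star A * A).trace := by
  simp only [hsNormSq, Matrix.trace, Matrix.diag, Matrix.mul_apply, Matrix.star_apply]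
  rw [Finset.sum_comm]
  push_cast
  refine Finset.sum_congr rfl fun i _ => Finset.sum_congr rfl fun j _ => ?_
  rw [← Complex.conj_mul']
  rfl

theorem hsNormSq_unitary_mul {k : Matrix.GeneralLinearGroup (Fin n) ℂ} (hk : k ∈ unitarySubgroup n)
    (A : Matrix (Fin n) (Fin n) ℂ) : hsNormSq (k.val * A) = hsNormSq A := by
  apply Complex.ofReal_injective
  rw [ofReal_hsNormSq, ofReal_hsNormSq, star_mul, mul_assoc, ← mul_assoc (star k.val),
    mem_unitarySubgroup.mp hk, one_mul]

theorem hsNormSq_mul_unitary {k : Matrix.GeneralLinearGroup (Fin n) ℂ} (hk : k ∈ unitarySubgroup n)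
    (A : Matrix (Fin n) (Fin n) ℂ) : hsNormSq (A * k.val) = hsNormSq A := by
  apply Complex.ofReal_injective
  rw [ofReal_hsNormSq, ofReal_hsNormSq, star_mul, Matrix.trace_mul_comm, mul_assoc,
    ← mul_assoc k.val, star_eq_inv_of_mem_unitarySubgroup hk, k.mul_inv, one_mul,
    Matrix.trace_mul_comm]

theorem continuous_hsNormSq : Continuous (hsNormSq (n := n)) :=
  continuous_finsetSum _ fun i _ => continuous_finsetSum _ fun j _ =>
    ((continuous_id.matrix_elem i j).norm.pow 2)

theorem exists_norm_le_sqrt_hsNormSq :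
    ∃ C : ℝ, 0 ≤ C ∧ ∀ A : Matrix (Fin n) (Fin n) ℂ, ‖A‖ ≤ C * √(hsNormSq A) := by
  let T : (Fin n → Fin n → ℂ) →L[ℂ] Matrix (Fin n) (Fin n) ℂ :=
    (Matrix.ofLinearEquiv ℂ).toLinearMap.toContinuousLinearMap
  refine ⟨‖T‖, norm_nonneg _, fun A => (T.le_opNorm A).trans ?_⟩
  refine mul_le_mul_of_nonneg_left ?_ (norm_nonneg _)
  refine (pi_norm_le_iff_of_nonneg (Real.sqrt_nonneg _)).mpr fun i =>
    (pi_norm_le_iff_of_nonneg (Real.sqrt_nonneg _)).mpr fun j => Real.le_sqrt_of_sq_le ?_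
  calc ‖A i j‖ ^ 2 ≤ ∑ j, ‖A i j‖ ^ 2 :=
        Finset.single_le_sum (f := fun j => ‖A i j‖ ^ 2) (fun _ _ => by positivity)
          (Finset.mem_univ j)
    _ ≤ hsNormSq A := Finset.single_le_sum (f := fun i => ∑ j, ‖A i j‖ ^ 2)
          (fun _ _ => by positivity) (Finset.mem_univ i)

/-- Distance of `x` from the unitary group, measured by `‖x‖² + ‖x⁻¹‖²` in the Hilbert–Schmidt
norm. It is invariant under multiplication by unitary matrices on both sides and strictly convex
along one-parameter groups of Hermitian matrices. -/
noncomputable def distortion (x : Matrix.GeneralLinearGroup (Fin n) ℂ) : ℝ :=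
  hsNormSq x.val + hsNormSq x⁻¹.val

theorem distortion_unitary_mul {k : Matrix.GeneralLinearGroup (Fin n) ℂ}
    (hk : k ∈ unitarySubgroup n) (x : Matrix.GeneralLinearGroup (Fin n) ℂ) :
    distortion (k * x) = distortion x := by
  rw [distortion, mul_inv_rev, Units.val_mul, Units.val_mul, hsNormSq_unitary_mul hk,
    hsNormSq_mul_unitary ((unitarySubgroup n).inv_mem hk), distortion]

theorem distortion_mul_unitary {k : Matrix.GeneralLinearGroup (Fin n) ℂ}
    (hk : k ∈ unitarySubgroup n) (x : Matrix.GeneralLinearGroup (Fin n) ℂ) :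
    distortion (x * k) = distortion x := by
  rw [distortion, mul_inv_rev, Units.val_mul, Units.val_mul, hsNormSq_mul_unitary hk,
    hsNormSq_unitary_mul ((unitarySubgroup n).inv_mem hk), distortion]

theorem continuous_distortion : Continuous (distortion (n := n)) :=
  (continuous_hsNormSq.comp Units.continuous_val).add
    (continuous_hsNormSq.comp (Units.continuous_val.comp continuous_inv))

theorem hsNormSq_nonneg (A : Matrix (Fin n) (Fin n) ℂ) : 0 ≤ hsNormSq A :=
  Finset.sum_nonneg fun _ _ => Finset.sum_nonneg fun _ _ => by positivity

theorem isCompact_setOf_distortion_le (C : ℝ) :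
    IsCompact {x : Matrix.GeneralLinearGroup (Fin n) ℂ | distortion x ≤ C} := by
  obtain ⟨B, hB0, hB⟩ := exists_norm_le_sqrt_hsNormSq (n := n)
  refine (isCompact_setOf_norm_le (B * √C)).of_isClosed_subset
    (isClosed_le continuous_distortion continuous_const) fun x hx => ?_
  have h1 := hsNormSq_nonneg x.val
  have h2 := hsNormSq_nonneg x⁻¹.val
  have h3 : hsNormSq x.val + hsNormSq x⁻¹.val ≤ C := hx
  exact ⟨(hB _).trans (mul_le_mul_of_nonneg_left (Real.sqrt_le_sqrt (by linarith)) hB0),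
    (hB _).trans (mul_le_mul_of_nonneg_left (Real.sqrt_le_sqrt (by linarith)) hB0)⟩

theorem hsNormSq_diagonal_mul (d : Fin n → ℂ) (A : Matrix (Fin n) (Fin n) ℂ) :
    hsNormSq (Matrix.diagonal d * A) = ∑ i, ‖d i‖ ^ 2 * ∑ j, ‖A i j‖ ^ 2 := by
  simp only [hsNormSq, Matrix.diagonal_mul, norm_mul, mul_pow, Finset.mul_sum]

theorem hsNormSq_mul_diagonal (d : Fin n → ℂ) (A : Matrix (Fin n) (Fin n) ℂ) :
    hsNormSq (A * Matrix.diagonal d) = ∑ j, ‖d j‖ ^ 2 * ∑ i, ‖A i j‖ ^ 2 := by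
  simp only [hsNormSq, Matrix.mul_diagonal, norm_mul, mul_pow, Finset.mul_sum]
  rw [Finset.sum_comm]
  simp only [mul_comm]

theorem distortion_oneParam_mul {u : Matrix.GeneralLinearGroup (Fin n) ℂ}
    (hu : u ∈ unitarySubgroup n) (l : Fin n → ℝ) (x : Matrix.GeneralLinearGroup (Fin n) ℂ) (t : ℝ) :
    distortion (oneParam u l t * x) =
      ∑ i, (Real.exp (2 * t * l i) * ∑ j, ‖(u⁻¹ * x).val i j‖ ^ 2 +
        Real.exp (-(2 * t * l i)) * ∑ j, ‖(x⁻¹ * u).val j i‖ ^ 2) := by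
  have hn : ∀ (t : ℝ) i, ‖((expTorus l t i : ℂˣ) : ℂ)‖ ^ 2 = Real.exp (2 * t * l i) := by
    intro t i
    simp only [expTorus, Units.val_mk0, Complex.norm_exp]
    rw [← Real.exp_nat_mul]
    congr 1
    simp
    ring
  have e1 : oneParam u l t * x = u * (diagGL (expTorus l t) * (u⁻¹ * x)) := by
    simp only [oneParam, mul_assoc]
  have e2 : (oneParam u l t * x)⁻¹ = x⁻¹ * u * diagGL (expTorus l ((-t : ℝ) : ℂ)) * u⁻¹ := by
    rw [mul_inv_rev, ← oneParam_neg, oneParam]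
    push_cast
    simp only [mul_assoc]
  rw [distortion, e2, Units.val_mul _ u⁻¹, hsNormSq_mul_unitary ((unitarySubgroup n).inv_mem hu),
    Units.val_mul (x⁻¹ * u), coe_diagGL, hsNormSq_mul_diagonal, e1, Units.val_mul u,
    hsNormSq_unitary_mul hu, Units.val_mul (diagGL _), coe_diagGL, hsNormSq_diagonal_mul, Finset.sum_add_distrib]
  simp only [hn]
  congr 1
  refine Finset.sum_congr rfl fun i _ => ?_
  congr 2
  ring

/-- Strict convexity of the distortion. -/
theorem oneParam_eq_one_of_distortion {u : Matrix.GeneralLinearGroup (Fin n) ℂ}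
    (hu : u ∈ unitarySubgroup n) (l : Fin n → ℝ) (x : Matrix.GeneralLinearGroup (Fin n) ℂ)
    (h1 : distortion (oneParam u l 1 * x) = distortion x)
    (hmin : distortion x ≤ distortion (oneParam u l ((1 / 2 : ℝ) : ℂ) * x)) (z : ℂ) :
    oneParam u l z = 1 := by
  have f0 := distortion_oneParam_mul hu l x 0
  have f1 := distortion_oneParam_mul hu l x 1
  rw [distortion_oneParam_mul hu l x] at hmin
  rw [Complex.ofReal_one, h1] at f1
  rw [Complex.ofReal_zero, oneParam_zero, one_mul] at f0
  set b : Fin n → ℝ := fun i => ∑ j, ‖(u⁻¹ * x).val i j‖ ^ 2 with hb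
  set b' : Fin n → ℝ := fun i => ∑ j, ‖(x⁻¹ * u).val j i‖ ^ 2 with hb'
  have hb0 : ∀ i, 0 ≤ b i := fun i => Finset.sum_nonneg fun _ _ => by positivity
  have hb0' : ∀ i, 0 ≤ b' i := fun i => Finset.sum_nonneg fun _ _ => by positivity
  -- The second difference of the distortion at `0`, `1 / 2`, `1` is a sum of nonnegative terms.
  have hterm : ∀ i, Real.exp (2 * 1 * l i) * b i + Real.exp (-(2 * 1 * l i)) * b' i +
      (Real.exp (2 * 0 * l i) * b i + Real.exp (-(2 * 0 * l i)) * b' i) -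
      2 * (Real.exp (2 * (1 / 2) * l i) * b i + Real.exp (-(2 * (1 / 2) * l i)) * b' i) =
      (Real.exp (l i) - 1) ^ 2 * b i + (Real.exp (-l i) - 1) ^ 2 * b' i := by
    intro i
    have e1 : Real.exp (2 * 1 * l i) = Real.exp (l i) ^ 2 := by
      rw [← Real.exp_nat_mul]; norm_num
    have e2 : Real.exp (-(2 * 1 * l i)) = Real.exp (-l i) ^ 2 := by
      rw [← Real.exp_nat_mul]; norm_num
    rw [e1, e2]
    norm_num
    ring
  have hsum : ∑ i, ((Real.exp (l i) - 1) ^ 2 * b i + (Real.exp (-l i) - 1) ^ 2 * b' i) ≤ 0 := by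
    rw [← Finset.sum_congr rfl fun i _ => hterm i, Finset.sum_sub_distrib, Finset.sum_add_distrib,
      ← Finset.mul_sum, ← f0, ← f1]
    linarith
  have hzero := (Finset.sum_eq_zero_iff_of_nonneg (fun i _ => add_nonneg
    (mul_nonneg (sq_nonneg _) (hb0 i)) (mul_nonneg (sq_nonneg _) (hb0' i)))).mp
    (le_antisymm hsum (Finset.sum_nonneg fun i _ => add_nonneg
      (mul_nonneg (sq_nonneg _) (hb0 i)) (mul_nonneg (sq_nonneg _) (hb0' i))))
  have hl : l = 0 := by
    funext i
    have h2 := hzero i (Finset.mem_univ i)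
    have h3 : (Real.exp (l i) - 1) ^ 2 * b i = 0 := by
      have := mul_nonneg (sq_nonneg (Real.exp (l i) - 1)) (hb0 i)
      have := mul_nonneg (sq_nonneg (Real.exp (-l i) - 1)) (hb0' i)
      linarith
    rcases mul_eq_zero.mp h3 with h4 | h4
    · simpa [sub_eq_zero] using h4
    · exfalso
      have hrow : ∀ j, (u⁻¹ * x).val i j = 0 := fun j => by
        simpa using (Finset.sum_eq_zero_iff_of_nonneg fun _ _ => by positivity).mp h4 j
          (Finset.mem_univ j)
      have h5 := congrFun (congrFun (u⁻¹ * x).mul_inv i) i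
      rw [Matrix.mul_apply, Finset.sum_eq_zero fun j _ => by rw [hrow j, zero_mul],
        Matrix.one_apply_eq] at h5
      exact zero_ne_one h5
  have : expTorus (0 : Fin n → ℝ) z = 1 := by
    funext i
    ext
    simp [expTorus]
  rw [hl, oneParam, this, map_one, mul_one, mul_inv_cancel]

/-- A compact group of matrices is conjugate to a group of unitary matrices. -/
theorem exists_conj_mem_unitarySubgroup {K : Subgroup (Matrix.GeneralLinearGroup (Fin n) ℂ)}
    (hK : IsCompact (K : Set (Matrix.GeneralLinearGroup (Fin n) ℂ))) :
    ∃ c : Matrix.GeneralLinearGroup (Fin n) ℂ, ∀ k ∈ K, c * k * c⁻¹ ∈ unitarySubgroup n := by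
  let τ : Representation ℂ K (Fin n → ℂ) :=
    { toFun := fun g => g.1.val.mulVecLin
      map_one' := by ext; simp
      map_mul' := fun g h => by simp [Matrix.mulVecLin_mul]; rfl }
  have hτ : IsRational τ := by
    intro φ w
    have : (fun g => φ (τ g w)) = ∑ i, ∑ j, (w j * φ (Pi.single i 1)) •
        fun g : K => g.1.val i j := by
      funext g
      rw [LinearMap.pi_apply_eq_sum_univ φ]
      simp only [Finset.sum_apply, Pi.smul_apply, smul_eq_mul]
      refine Finset.sum_congr rfl fun i _ => ?_
      have : (fun j => if i = j then (1 : ℂ) else 0) = Pi.single i 1 := by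
        funext j; simp [Pi.single_apply, eq_comm]
      rw [this]
      change (g.1.val.mulVec w) i * _ = _
      rw [Matrix.mulVec, dotProduct, Finset.sum_mul]
      exact Finset.sum_congr rfl fun j _ => by ring
    rw [this]
    exact (regularFunctions K).sum_mem fun i _ => (regularFunctions K).sum_mem fun j _ =>
      (regularFunctions K).smul_mem (entry_mem_regularFunctions K i j) _
  obtain ⟨m, φ, hφ⟩ := exists_unitarization le_rfl hK hτ
  obtain rfl : m = n := by
    have := φ.finrank_eq
    simpa using this.symm
  let e : (Fin m → ℂ) ≃ₗ[ℂ] (Fin m → ℂ) := φ.trans (WithLp.linearEquiv 2 ℂ (Fin m → ℂ))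
  let c : Matrix.GeneralLinearGroup (Fin m) ℂ :=
    ⟨LinearMap.toMatrix' e.toLinearMap, LinearMap.toMatrix' e.symm.toLinearMap,
      by rw [← LinearMap.toMatrix'_comp]; simp, by rw [← LinearMap.toMatrix'_comp]; simp⟩
  refine ⟨c, fun k hk => ?_⟩
  have hA : (c * k * c⁻¹).val.mulVecLin = e.toLinearMap ∘ₗ τ ⟨k, hk⟩ ∘ₗ e.symm.toLinearMap := by
    rw [Units.val_mul, Units.val_mul, Matrix.mulVecLin_mul, Matrix.mulVecLin_mul]
    rw [LinearMap.comp_assoc]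
    congr 1
    · exact Matrix.toLin'_toMatrix' _
    · congr 1
      exact Matrix.toLin'_toMatrix' _
  have hiso : ∀ x : EuclideanSpace ℂ (Fin m),
      ‖Matrix.toEuclideanLin (c * k * c⁻¹).val x‖ = ‖x‖ := by
    intro x
    have h1 : Matrix.toEuclideanLin (c * k * c⁻¹).val x = φ (τ ⟨k, hk⟩ (φ.symm x)) := by
      have h2 := LinearMap.congr_fun hA (WithLp.ofLp x)
      apply (WithLp.linearEquiv 2 ℂ (Fin m → ℂ)).injective
      exact h2
    rw [h1, hφ ⟨k, hk⟩ hk, LinearEquiv.apply_symm_apply]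
  let iso : EuclideanSpace ℂ (Fin m) →ₗᵢ[ℂ] EuclideanSpace ℂ (Fin m) := ⟨_, hiso⟩
  rw [mem_unitarySubgroup, Matrix.star_eq_conjTranspose]
  apply (Matrix.toEuclideanLin (𝕜 := ℂ) (m := Fin m) (n := Fin m)).injective
  refine LinearMap.ext fun x => ext_inner_left ℂ fun y => ?_
  have h3 : Matrix.toEuclideanLin ((c * k * c⁻¹).val.conjTranspose * (c * k * c⁻¹).val) x =
      LinearMap.adjoint (Matrix.toEuclideanLin (c * k * c⁻¹).val)
        (Matrix.toEuclideanLin (c * k * c⁻¹).val x) := by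
    rw [← Matrix.toEuclideanLin_conjTranspose_eq_adjoint]
    simp
  rw [h3, LinearMap.adjoint_inner_right]
  have h4 := iso.inner_map_map y x
  have h5 : Matrix.toEuclideanLin (1 : Matrix (Fin m) (Fin m) ℂ) x = x := by
    simp
  rw [h5]
  exact h4

/-- Mostow's theorem: a reductive group `G` is conjugate to a group stable under the polar
decomposition, by an element which also conjugates a given compact subgroup into the unitary group.
The conjugating element minimises the norm of a vector `v` with stabiliser `G` on its closed
`GL_n(ℂ)`-orbit and, among all minimisers, the distortion. -/
theorem IsReductive.exists_conj_polar (hG : IsReductive G)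
    {K : Subgroup (Matrix.GeneralLinearGroup (Fin n) ℂ)} (hKG : K ≤ G)
    (hK : IsCompact (K : Set (Matrix.GeneralLinearGroup (Fin n) ℂ))) :
    ∃ x : Matrix.GeneralLinearGroup (Fin n) ℂ,
      (∀ k ∈ K, x * k * x⁻¹ ∈ unitarySubgroup n) ∧
      ∀ g ∈ G, ∃ k ∈ unitarySubgroup n, ∃ u ∈ unitarySubgroup n, ∃ l : Fin n → ℝ,
        x * g * x⁻¹ = k * oneParam u l 1 ∧ ∀ z, x⁻¹ * oneParam u l z * x ∈ G := by
  obtain ⟨D, _, _, _, π, v, hπ, hstab, hclosed⟩ := hG.exists_closed_orbit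
  obtain ⟨m, φ, hφ⟩ := exists_unitarization (G := ⊤) le_top (isCompact_unitarySubgroup (n := n)) hπ
  obtain ⟨c, hc⟩ := exists_conj_mem_unitarySubgroup hK
  let top : Matrix.GeneralLinearGroup (Fin n) ℂ →
    (⊤ : Subgroup (Matrix.GeneralLinearGroup (Fin n) ℂ)) := fun h => ⟨h, Subgroup.mem_top h⟩
  have top_mul : ∀ a b, top (a * b) = top a * top b := fun a b => rfl
  have htop : ∀ a b w, π (top (a * b)) w = π (top a) (π (top b) w) := fun a b w => by
    rw [top_mul, map_mul, Module.End.mul_apply]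
  let Φ : Matrix.GeneralLinearGroup (Fin n) ℂ → ℝ := fun x => ‖φ (π (top x) v)‖
  have hΦ : Continuous Φ :=
    ((hπ.continuous φ.toLinearMap v).comp (Continuous.subtype_mk continuous_id _)).norm
  have hΦG : ∀ x, ∀ g ∈ G, Φ (x * g) = Φ x := fun x g hg => by
    simp only [Φ]
    rw [htop, (hstab (top g)).mpr hg]
  obtain ⟨_, ⟨x₁, rfl⟩, hx₁⟩ := exists_norm_le_of_isClosed (hclosed m φ) (Set.range_nonempty _)
  have hx₁' : ∀ x, Φ x₁.1 ≤ Φ x := fun x => hx₁ _ ⟨top x, rfl⟩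
  let Z : Set (Matrix.GeneralLinearGroup (Fin n) ℂ) := {x | Φ x = Φ x₁.1}
  have hZ : IsClosed Z := isClosed_eq hΦ continuous_const
  let Ψ : Matrix.GeneralLinearGroup (Fin n) ℂ → ℝ := fun x => distortion (x * c⁻¹)
  have hΨ : Continuous Ψ := continuous_distortion.comp (continuous_mul_const _)
  have hcpt : IsCompact {x | Ψ x ≤ Ψ x₁.1} :=
    ((Homeomorph.mulRight c⁻¹).isClosedEmbedding).isCompact_preimage
      (isCompact_setOf_distortion_le (Ψ x₁.1))
  obtain ⟨x, ⟨hxZ, hxle⟩, hxmin⟩ := (hcpt.inter_left hZ).exists_isMinOn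
    ⟨x₁.1, rfl, le_refl (Ψ x₁.1)⟩ hΨ.continuousOn
  have hxmin' : ∀ y ∈ Z, Ψ x ≤ Ψ y := by
    intro y hy
    rcases le_or_gt (Ψ y) (Ψ x₁.1) with h | h
    · exact hxmin ⟨hy, h⟩
    · exact hxle.trans h.le
  have hmin : ∀ y, Φ x ≤ Φ y := fun y => (le_of_eq hxZ).trans (hx₁' y)
  -- `Φ` is convex along `z ↦ oneParam u l z * x`, minimal at `z = 0`, and takes the same value at
  -- `z = 1` because `x * g` does; so the one-parameter group fixes `π x v`.
  have hfix : ∀ g ∈ G, ∀ k ∈ unitarySubgroup n, ∀ u ∈ unitarySubgroup n, ∀ l : Fin n → ℝ,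
      x * g * x⁻¹ = k * oneParam u l 1 →
        ∀ z, π (top (oneParam u l z)) (π (top x) v) = π (top x) v := by
    intro g hg k hk u hu l hpol z
    have hinv' : ∀ (θ : ℝ) w, ‖φ (π (top (oneParam u l (Complex.I * θ))) w)‖ = ‖φ w‖ :=
      fun θ => hφ (top _) (oneParam_I_mul_mem_unitarySubgroup hu l θ)
    obtain ⟨s, y, hy, hinv⟩ := hπ.exists_expSum_norm φ u l (fun z => Subgroup.mem_top _) hinv'
      (π (top x) v)
    replace hy : ∀ z, φ (π (top (oneParam u l z)) (π (top x) v)) = expSum s y z := hy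
    have hy0 : expSum s y 0 = φ (π (top x) v) := by
      rw [← hy 0]
      congr 1
      have : top (oneParam u l 0) = 1 := by
        rw [oneParam_zero]; rfl
      rw [this, map_one, Module.End.one_apply]
    have hyΦ : ∀ z, ‖expSum s y z‖ = Φ (oneParam u l z * x) := by
      intro z
      rw [← hy z]
      simp only [Φ]
      rw [htop]
    have key := expSum_eq_of_norm_one_eq s y hinv
      (fun t => by rw [hy0, hyΦ]; exact hmin _)
      (by
        rw [hy0, hyΦ]
        change _ = Φ x
        rw [← hΦG x g hg]
        have h1 : x * g = k * (oneParam u l 1 * x) := by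
          rw [← mul_assoc, ← hpol, inv_mul_cancel_right]
        rw [h1]
        simp only [Φ]
        rw [htop k, hφ (top k) hk]) z
    rw [hy0, ← hy z] at key
    exact φ.injective key
  refine ⟨x, fun k hk => ?_, fun g hg => ?_⟩
  · obtain ⟨k', hk', u, hu, l, hpol⟩ := exists_polar (x * k * x⁻¹)
    have hfixz := hfix k (hKG hk) k' hk' u hu l hpol
    -- The Hermitian part preserves both minima, and strict convexity of the distortion makes it
    -- trivial.
    have h1 : oneParam u l 1 = 1 := by
      refine oneParam_eq_one_of_distortion hu l (x * c⁻¹) ?_ ?_ 1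
      · rw [← distortion_unitary_mul hk', ← mul_assoc, ← mul_assoc, ← hpol,
          ← distortion_mul_unitary (hc k hk) (x * c⁻¹)]
        congr 1
        group
      · have : oneParam u l ((1 / 2 : ℝ) : ℂ) * x ∈ Z := by
          change Φ _ = _
          rw [← hxZ]
          simp only [Φ]
          rw [htop, hfixz]
        have h2 := hxmin' _ this
        simp only [Ψ] at h2
        rwa [mul_assoc] at h2
    rw [hpol, h1, mul_one]
    exact hk'
  · obtain ⟨k, hk, u, hu, l, hpol⟩ := exists_polar (x * g * x⁻¹)
    refine ⟨k, hk, u, hu, l, hpol, fun z => ?_⟩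
    have h1 := (hstab (top (x⁻¹ * oneParam u l z * x))).mp (by
      rw [htop, htop, hfix g hg k hk u hu l hpol z, ← htop, inv_mul_cancel]
      change π 1 v = v
      rw [map_one, Module.End.one_apply])
    exact h1

end

/-! ### Orbits of one-parameter subgroups through a vector of minimal norm -/

section

open Filter Topology
open scoped Matrix.Norms.L2Operator

variable {n : ℕ} {G K : Subgroup (Matrix.GeneralLinearGroup (Fin n) ℂ)}

theorem exists_laurent_of_mem_regularFunctionsTorus {f : ℂˣ → ℂ}
    (hf : f ∈ regularFunctionsTorus) :
    ∃ c : AddMonoidAlgebra ℂ (Fin 1 → ℤ), ∀ z : ℂˣ, f z = laurentEval (fun _ => z) c := by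
  refine Algebra.adjoin_induction (p := fun f _ => ∃ c : AddMonoidAlgebra ℂ (Fin 1 → ℤ),
    ∀ z : ℂˣ, f z = laurentEval (fun _ => z) c) ?_ ?_ ?_ ?_ hf
  · rintro f (rfl | rfl)
    · exact ⟨AddMonoidAlgebra.single (fun _ => 1) 1, fun z => by
        rw [laurentEval_single]; simp [torusChar]⟩
    · exact ⟨AddMonoidAlgebra.single (fun _ => -1) 1, fun z => by
        rw [laurentEval_single]; simp [torusChar]⟩
  · exact fun r => ⟨algebraMap ℂ _ r, fun z => by rw [AlgHom.commutes]; rfl⟩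
  · rintro f g _ _ ⟨c, hc⟩ ⟨d, hd⟩
    exact ⟨c + d, fun z => by rw [map_add, ← hc, ← hd]; rfl⟩
  · rintro f g _ _ ⟨c, hc⟩ ⟨d, hd⟩
    exact ⟨c * d, fun z => by rw [map_mul, ← hc, ← hd]; rfl⟩

/-- The action of an algebraic one-parameter subgroup in the coordinate `z = exp ζ`. -/
theorem IsRational.exists_expSum_oneParam {W : Type*} [AddCommGroup W] [Module ℂ W]
    [FiniteDimensional ℂ W] {ρ : Representation ℂ G W} (hρ : IsRational ρ) {l : ℂˣ →* G}
    (hl : IsAlgebraicOneParam l) (w : W) :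
    ∃ (s : Finset ℝ) (y : ℝ → W), ∀ ζ : ℂ,
      ρ (l (Units.mk0 (Complex.exp ζ) (Complex.exp_ne_zero ζ))) w = expSum s y ζ := by
  obtain ⟨s, x, hx⟩ := exists_vector_laurent (fun z : ℂˣ => ρ (l z) w)
    (fun z (_ : Fin 1) => z) fun φ => exists_laurent_of_mem_regularFunctionsTorus (hl _ (hρ φ w))
  refine ⟨s.image fun β => ∑ i, β i * (1 : ℝ),
    fun μ => ∑ β ∈ s with (∑ i, β i * (1 : ℝ)) = μ, x β, fun ζ => (hx _).trans ?_⟩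
  rw [← sum_torusChar_expTorus _ _ (fun _ => 1) ζ]
  refine Finset.sum_congr rfl fun β _ => ?_
  congr 2
  funext i
  ext
  simp [expTorus]

section

variable {m : ℕ}

/-- The weights of a vector which is of minimal norm on its orbit lie on both sides of zero, unless
the vector is fixed. In both cases the orbit is closed. -/
theorem isClosed_range_expSum (s : Finset ℝ) (y : ℝ → EuclideanSpace ℂ (Fin m))
    (h : ∀ t θ : ℝ, ‖expSum s y (t + Complex.I * θ)‖ = ‖expSum s y t‖)
    (hmin : ∀ t : ℝ, ‖expSum s y 0‖ ≤ ‖expSum s y t‖)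
    {S : Set (EuclideanSpace ℂ (Fin m))}
    (hS : ∀ ζ, expSum s y ζ ∈ S)
    (hS' : ∀ x ∈ S, ∃ ζ : ℂ, |ζ.im| ≤ Real.pi ∧ expSum s y ζ = x) : IsClosed S := by
  by_cases hconst : ∀ μ ∈ s, μ ≠ 0 → y μ = 0
  · have : S = {expSum s y 0} := by
      refine Set.eq_singleton_iff_unique_mem.mpr ⟨hS 0, fun x hx => ?_⟩
      obtain ⟨ζ, _, rfl⟩ := hS' x hx
      exact expSum_eq_of_coeff_eq_zero s y hconst ζ
    rw [this]
    exact isClosed_singleton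
  have hcomp : ∀ t : ℝ, ∑ μ ∈ s, (Real.exp (2 * t * μ) - 1) * ‖y μ‖ ^ 2 ≥ 0 := by
    intro t
    have h0 := norm_sq_expSum s y h 0
    have h1 := pow_le_pow_left₀ (norm_nonneg _) (hmin t) 2
    rw [norm_sq_expSum s y h t, ← Complex.ofReal_zero, h0] at h1
    simp only [sub_mul, Finset.sum_sub_distrib, one_mul]
    simp only [mul_zero, zero_mul, Real.exp_zero, one_mul] at h1
    linarith
  -- Taking `ε = 1` and `ε = -1`: both positive and negative weights occur.
  have hside : ∀ ε : ℝ, ε ≠ 0 → ∃ μ ∈ s, 0 < ε * μ ∧ y μ ≠ 0 := by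
    intro ε hε
    by_contra! hcon
    have hneg : ∀ μ ∈ s, (Real.exp (2 * ε * μ) - 1) * ‖y μ‖ ^ 2 ≤ 0 := by
      intro μ hμ
      rcases lt_or_ge 0 (ε * μ) with hpos | hle
      · simp [hcon μ hμ hpos]
      · refine mul_nonpos_of_nonpos_of_nonneg ?_ (by positivity)
        rw [sub_nonpos, Real.exp_le_one_iff]
        linarith
    have hz := (Finset.sum_eq_zero_iff_of_nonpos hneg).mp
      (le_antisymm (Finset.sum_nonpos hneg) (hcomp ε))
    refine hconst fun μ hμ hμ0 => ?_
    have h1 := hz μ hμ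
    have h2 : Real.exp (2 * ε * μ) - 1 ≠ 0 := by
      rw [sub_ne_zero]
      simpa [hε] using hμ0
    simpa [h2] using h1
  have hbound : ∀ ε : ℝ, ε ≠ 0 → ∀ C : ℝ, ∃ T : ℝ, ∀ t : ℝ, ‖expSum s y t‖ ≤ C → ε * t ≤ T := by
    intro ε hε C
    obtain ⟨μ, hμ, hεμ, hy⟩ := hside ε hε
    have hy' : 0 < ‖y μ‖ ^ 2 := by positivity
    refine ⟨ε * (Real.log (C ^ 2 / ‖y μ‖ ^ 2) / (2 * μ)), fun t ht => ?_⟩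
    have h1 := pow_le_pow_left₀ (norm_nonneg _) ht 2
    rw [norm_sq_expSum s y h t] at h1
    have h2 := (Finset.single_le_sum (f := fun μ => Real.exp (2 * t * μ) * ‖y μ‖ ^ 2)
      (fun ν _ => by positivity) hμ).trans h1
    have h3 : Real.exp (2 * t * μ) ≤ C ^ 2 / ‖y μ‖ ^ 2 := by rwa [le_div_iff₀ hy']
    have h4 := (Real.le_log_iff_exp_le ((Real.exp_pos _).trans_le h3)).mpr h3
    have hμ0 : μ ≠ 0 := by rintro rfl; simp at hεμ
    have h5 : ε * (Real.log (C ^ 2 / ‖y μ‖ ^ 2) / (2 * μ)) - ε * t =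
        (ε * μ) * (Real.log (C ^ 2 / ‖y μ‖ ^ 2) - 2 * t * μ) / (2 * μ ^ 2) := by
      field_simp
    have h6 : 0 ≤ (ε * μ) * (Real.log (C ^ 2 / ‖y μ‖ ^ 2) - 2 * t * μ) / (2 * μ ^ 2) :=
      div_nonneg (mul_nonneg hεμ.le (by linarith)) (by positivity)
    linarith
  have hcont : Continuous (expSum s y) := by
    unfold expSum
    fun_prop
  refine IsSeqClosed.isClosed fun x x₀ hx hlim => ?_
  choose ζ hζπ hζ using fun j => hS' (x j) (hx j)
  obtain ⟨C, hC⟩ := (Metric.isBounded_range_of_tendsto _ hlim).exists_norm_le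
  obtain ⟨T, hT⟩ := hbound 1 one_ne_zero C
  obtain ⟨T', hT'⟩ := hbound (-1) (by norm_num) C
  have hbox : ∀ j, ζ j ∈ (Set.Icc (-T') T) ×ℂ (Set.Icc (-Real.pi) Real.pi) := by
    intro j
    have h1 : ‖expSum s y (ζ j).re‖ ≤ C := by
      rw [← h (ζ j).re (ζ j).im, mul_comm Complex.I, Complex.re_add_im, hζ j]
      exact hC _ ⟨j, rfl⟩
    have h2 := hT _ h1
    have h3 := hT' _ h1
    exact ⟨⟨by linarith, by linarith⟩, abs_le.mp (hζπ j)⟩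
  obtain ⟨ζ₀, _, σ, hσ, hσlim⟩ := (isCompact_Icc.reProdIm isCompact_Icc).tendsto_subseq hbox
  have h1 : Tendsto (fun j => x (σ j)) atTop (𝓝 (expSum s y ζ₀)) := by
    refine ((hcont.tendsto ζ₀).comp hσlim).congr fun j => ?_
    exact hζ (σ j)
  rw [tendsto_nhds_unique (hlim.comp hσ.tendsto_atTop) h1]
  exact hS ζ₀

theorem isClosed_range_of_norm_minimal {ρ : Representation ℂ G (EuclideanSpace ℂ (Fin m))}
    (hρ : IsRational ρ)
    (hK : ∀ k : G, (k : Matrix.GeneralLinearGroup (Fin n) ℂ) ∈ K → ∀ x, ‖ρ k x‖ = ‖x‖)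
    {w : EuclideanSpace ℂ (Fin m)} (hw : ∀ g, ‖w‖ ≤ ‖ρ g w‖) {l : ℂˣ →* G}
    (hl : IsSpecialOneParam K l) : IsClosed (Set.range fun z : ℂˣ => ρ (l z) w) := by
  obtain ⟨s, y, hy⟩ := hρ.exists_expSum_oneParam hl.1 w
  have hy0 : expSum s y 0 = w := by
    rw [← hy 0]
    have : Units.mk0 (Complex.exp 0) (Complex.exp_ne_zero 0) = 1 := by ext; simp
    rw [this, map_one, map_one, Module.End.one_apply]
  refine isClosed_range_expSum s y (fun t θ => ?_) (fun t => ?_) (fun ζ => ⟨_, hy ζ⟩) ?_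
  · rw [← hy, ← hy, ← hK (l (Units.mk0 (Complex.exp (Complex.I * θ)) (Complex.exp_ne_zero _)))
      (hl.2 _ (by rw [Units.val_mk0, mul_comm]; exact Complex.norm_exp_ofReal_mul_I θ))
      (ρ (l (Units.mk0 (Complex.exp t) (Complex.exp_ne_zero _))) w),
      ← Module.End.mul_apply, ← map_mul, ← map_mul]
    congr 4
    ext
    rw [Units.val_mul, Units.val_mk0, Units.val_mk0, Units.val_mk0, ← Complex.exp_add, add_comm]
  · rw [hy0, ← hy]
    exact hw _
  · rintro _ ⟨z, rfl⟩
    refine ⟨Complex.log z, ?_, ?_⟩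
    · rw [Complex.log_im]
      exact Complex.abs_arg_le_pi _
    · rw [← hy]
      change ρ (l _) w = ρ (l z) w
      congr 3
      ext
      rw [Units.val_mk0, Complex.exp_log z.ne_zero]

/-! ### Bounded directions at a vector with closed one-parameter orbits -/

theorem zpow_mem_regularFunctionsTorus (k : ℤ) :
    (fun z : ℂˣ => (z : ℂ) ^ k) ∈ regularFunctionsTorus := by
  cases k with
  | ofNat a =>
    have : (fun z : ℂˣ => (z : ℂ) ^ (Int.ofNat a)) = (fun z : ℂˣ => (z : ℂ)) ^ a := by
      funext z; simp
    rw [this]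
    exact regularFunctionsTorus.pow_mem (Algebra.subset_adjoin (Or.inl rfl)) a
  | negSucc a =>
    have : (fun z : ℂˣ => (z : ℂ) ^ (Int.negSucc a)) = (fun z : ℂˣ => (z : ℂ)⁻¹) ^ (a + 1) := by
      funext z; simp [zpow_negSucc]
    rw [this]
    exact regularFunctionsTorus.pow_mem (Algebra.subset_adjoin (Or.inr rfl)) (a + 1)

/-- The one-parameter subgroup `z ↦ v diag(z ^ q_i) v⁻¹` of `G`. -/
noncomputable def cochar (v : Matrix.GeneralLinearGroup (Fin n) ℂ) (q : Fin n → ℤ)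
    (h : ∀ z : ℂˣ, v * diagGL (fun i => z ^ q i) * v⁻¹ ∈ G) : ℂˣ →* G where
  toFun z := ⟨_, h z⟩
  map_one' := by
    ext : 1
    have : (fun i => (1 : ℂˣ) ^ q i) = 1 := by funext i; simp
    change v * diagGL (fun i => (1 : ℂˣ) ^ q i) * v⁻¹ = 1
    rw [this, map_one, mul_one, mul_inv_cancel]
  map_mul' a b := by
    ext : 1
    have : (fun i => (a * b) ^ q i) = (fun i => a ^ q i) * fun i => b ^ q i := by
      funext i; simp [mul_zpow]
    change v * diagGL (fun i => (a * b) ^ q i) * v⁻¹ =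
      v * diagGL (fun i => a ^ q i) * v⁻¹ * (v * diagGL (fun i => b ^ q i) * v⁻¹)
    rw [this, map_mul]
    group

theorem isAlgebraicOneParam_cochar (v : Matrix.GeneralLinearGroup (Fin n) ℂ) (q : Fin n → ℤ)
    (h : ∀ z : ℂˣ, v * diagGL (fun i => z ^ q i) * v⁻¹ ∈ G) :
    IsAlgebraicOneParam (cochar v q h) := by
  intro f hf
  obtain ⟨c, hc⟩ := exists_laurent_regularFunction v hf
  have : (fun z : ℂˣ => f (cochar v q h z)) =
      ∑ β ∈ c.coeff.support, c.coeff β • fun z : ℂˣ => (z : ℂ) ^ (∑ i, β i * q i) := by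
    funext z
    rw [Finset.sum_apply]
    refine ((hc _ (h z)).trans (laurentEval_eq_sum _ _)).trans ?_
    refine Finset.sum_congr rfl fun β _ => ?_
    rw [torusChar_zpow, mul_comm]
    rfl
  rw [this]
  exact Subalgebra.sum_mem _ fun β _ =>
    regularFunctionsTorus.smul_mem (zpow_mem_regularFunctionsTorus _) _

/-- If all special one-parameter subgroups have closed orbit through `w`, then a one-parameter group
`z ↦ v diag(exp (z l_i)) v⁻¹` which moves `w` only boundedly in positive real time fixes `w`.
For `l` replaced by a nearby integral vector `q` the limit of the orbit in positive time is the
same vector `y₀`; it lies in the closed orbit of the one-parameter subgroup defined by `q`, which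
fixes it, so that `y₀ = w`. -/
theorem oneParam_fix_of_bounded (hG : IsZariskiClosed (G : Set (Matrix.GeneralLinearGroup (Fin n) ℂ)))
    {ρ : Representation ℂ G (EuclideanSpace ℂ (Fin m))} (hρ : IsRational ρ)
    (v : Matrix.GeneralLinearGroup (Fin n) ℂ) (l : Fin n → ℝ) (hmem : ∀ z, oneParam v l z ∈ G)
    (hinv : ∀ (θ : ℝ) x, ‖ρ ⟨oneParam v l (Complex.I * θ), hmem _⟩ x‖ = ‖x‖)
    (hvK : ∀ z : Fin n → ℂˣ, (∀ i, ‖(z i : ℂ)‖ = 1) → v * diagGL z * v⁻¹ ∈ G →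
      v * diagGL z * v⁻¹ ∈ K)
    {w : EuclideanSpace ℂ (Fin m)}
    (hw : ∀ l : ℂˣ →* G, IsSpecialOneParam K l → IsClosed (Set.range fun z : ℂˣ => ρ (l z) w))
    {C : ℝ} (hC : ∀ t : ℝ, 0 ≤ t → ‖ρ ⟨oneParam v l t, hmem t⟩ w‖ ≤ C) (t : ℝ) :
    ρ ⟨oneParam v l t, hmem t⟩ w = w := by
  obtain ⟨s, x, hx⟩ := hρ.exists_laurent v w
  obtain ⟨q, hqrel, hqneg⟩ := exists_int_approx l s
  have hq := conj_diagGL_zpow_mem hG v l (fun t => hmem t) q hqrel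
  set s' : Finset ℝ := s.image fun β => ∑ i, β i * l i with hs'
  set y : ℝ → EuclideanSpace ℂ (Fin m) :=
    fun μ => ∑ β ∈ s with (∑ i, β i * l i : ℝ) = μ, x β with hy
  have hE : ∀ z, ρ ⟨oneParam v l z, hmem z⟩ w = expSum s' y z := fun z =>
    (hx (expTorus l z) (hmem z)).trans (sum_torusChar_expTorus s x l z)
  have hpos : ∀ μ ∈ s', 0 < μ → y μ = 0 := by
    intro μ hμs hμ
    refine coeff_eq_zero_of_norm_expSum_le s' y (fun t θ => ?_) (C := C) (fun t ht => ?_) hμs hμ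
    · rw [← hE, ← hE, ← hinv θ (ρ ⟨oneParam v l t, hmem t⟩ w), ← Module.End.mul_apply, ← map_mul]
      congr 4
      rw [← oneParam_add, add_comm]
    · rw [← hE]
      exact hC t ht
  have hsum0 : ∑ μ ∈ s', (if μ = 0 then y 0 else 0) = y 0 := by
    rw [Finset.sum_ite_eq']
    split_ifs with h0
    · rfl
    · rw [hy]
      refine (Finset.sum_eq_zero fun β hβ => ?_).symm
      exact absurd ((Finset.mem_filter.mp hβ).2 ▸
        Finset.mem_image_of_mem (fun β : Fin n → ℤ => (∑ i, β i * l i : ℝ))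
          (Finset.mem_filter.mp hβ).1) h0
  -- The weights of `w` are nonpositive, and the weight zero part `y 0` is the limit in positive time.
  have hlimE : ∀ τ : ℕ → ℝ, Tendsto τ atTop atTop →
      Tendsto (fun j => ρ ⟨oneParam v l (τ j), hmem _⟩ w) atTop (𝓝 (y 0)) := by
    intro τ hτ
    simp only [hE, expSum]
    rw [← hsum0]
    refine tendsto_finsetSum _ fun μ hμ => ?_
    rcases lt_trichotomy μ 0 with hneg | rfl | hp
    · rw [if_neg hneg.ne, ← zero_smul ℂ (y μ)]
      refine Tendsto.smul_const ?_ _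
      rw [tendsto_zero_iff_norm_tendsto_zero]
      simp only [Complex.norm_exp, ← Complex.ofReal_mul, Complex.ofReal_re]
      exact Real.tendsto_exp_atBot.comp (hτ.atTop_mul_const_of_neg hneg)
    · simp
    · rw [if_neg hp.ne', hpos μ hμ hp]
      simp
  -- The integral one-parameter subgroup contracts the same weights, so it has the same limit.
  have hlimq : ∀ z : ℕ → ℂˣ, Tendsto (fun j => ‖(z j : ℂ)‖) atTop atTop →
      Tendsto (fun j => ρ (cochar v q hq (z j)) w) atTop (𝓝 (y 0)) := by
    intro z hz
    have h1 : ∀ j, ρ (cochar v q hq (z j)) w =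
        ∑ μ ∈ s', ∑ β ∈ s with (∑ i, β i * l i : ℝ) = μ, (z j : ℂ) ^ (∑ i, β i * q i) • x β := by
      intro j
      refine (hx _ (hq (z j))).trans ?_
      rw [hs', Finset.sum_fiberwise_of_maps_to
        (fun β hβ => Finset.mem_image_of_mem (fun β : Fin n → ℤ => (∑ i, β i * l i : ℝ)) hβ)]
      simp only [torusChar_zpow]
    simp only [h1]
    rw [← hsum0]
    refine tendsto_finsetSum _ fun μ hμ => ?_
    rcases lt_trichotomy μ 0 with hneg | rfl | hp
    · rw [if_neg hneg.ne, ← Finset.sum_const_zero (s := s.filter fun β => (∑ i, β i * l i : ℝ) = μ)]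
      refine tendsto_finsetSum _ fun β hβ => ?_
      obtain ⟨hβs, hβμ⟩ := Finset.mem_filter.mp hβ
      have hk := hqneg β hβs (hβμ ▸ hneg)
      rw [← zero_smul ℂ (x β)]
      refine Tendsto.smul_const ?_ _
      rw [tendsto_zero_iff_norm_tendsto_zero]
      simp only [norm_zpow]
      exact (tendsto_zpow_atTop_zero hk).comp hz
    · rw [if_pos rfl]
      refine tendsto_const_nhds.congr fun j => ?_
      rw [hy]
      refine Finset.sum_congr rfl fun β hβ => ?_
      rw [hqrel β (Finset.mem_filter.mp hβ).2, zpow_zero, one_smul]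
    -- By the relations, `β ↦ ∑ i, β i * q i` is constant on the fibre, whose `x β` add up to `y μ = 0`.
    · rw [if_neg hp.ne']
      obtain ⟨β₀, hβ₀, hβμ⟩ := Finset.mem_image.mp hμ
      refine tendsto_const_nhds.congr fun j => ?_
      rw [← smul_zero ((z j : ℂ) ^ (∑ i, β₀ i * q i)), ← hpos μ hμ hp, hy, Finset.smul_sum]
      refine Finset.sum_congr rfl fun β hβ => ?_
      congr 2
      have h2 := hqrel (β₀ - β) (by
        have := (Finset.mem_filter.mp hβ).2
        simp only [Pi.sub_apply, Int.cast_sub, sub_mul, Finset.sum_sub_distrib]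
        linarith)
      simp only [Pi.sub_apply, sub_mul, Finset.sum_sub_distrib] at h2
      linarith
  have hcont : ∀ g, Continuous (ρ g) := fun g => (ρ g).continuous_of_finiteDimensional
  let N : ℕ → ℂˣ := fun j => Units.mk0 ((j : ℂ) + 1) (Nat.cast_add_one_ne_zero j)
  have hN : Tendsto (fun j => ‖(N j : ℂ)‖) atTop atTop := by
    have : ∀ j, ‖(N j : ℂ)‖ = (j : ℝ) + 1 := by
      intro j
      simp only [N, Units.val_mk0]
      have : ((j : ℂ) + 1) = (((j : ℝ) + 1 : ℝ) : ℂ) := by push_cast; rfl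
      rw [this, Complex.norm_real, Real.norm_of_nonneg (by positivity)]
    simp only [this]
    exact tendsto_atTop_add_const_right _ _ tendsto_natCast_atTop_atTop
  have hspec : IsSpecialOneParam K (cochar v q hq) := by
    refine ⟨isAlgebraicOneParam_cochar v q hq, fun z hz => hvK _ (fun i => ?_) (hq z)⟩
    rw [Units.val_zpow_eq_zpow_val, norm_zpow, hz, one_zpow]
  obtain ⟨z₀, hz₀⟩ := (hw _ hspec).mem_of_tendsto (hlimq N hN)
    (Eventually.of_forall fun j => ⟨N j, rfl⟩)
  simp only at hz₀
  have hfix : ρ (cochar v q hq z₀⁻¹) (y 0) = y 0 := by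
    refine tendsto_nhds_unique (((hcont _).tendsto _).comp (hlimq N hN)) ?_
    refine (hlimq (fun j => z₀⁻¹ * N j) ?_).congr fun j => ?_
    · simp only [Units.val_mul, norm_mul]
      exact hN.const_mul_atTop (norm_pos_iff.mpr z₀⁻¹.ne_zero)
    · rw [Function.comp_apply, map_mul, map_mul, Module.End.mul_apply]
  have hyw : y 0 = w := by
    rw [← hfix, ← hz₀, ← Module.End.mul_apply, ← map_mul, ← map_mul, inv_mul_cancel, map_one,
      map_one, Module.End.one_apply]
  have hτ : Tendsto (fun j : ℕ => (j : ℝ)) atTop atTop := tendsto_natCast_atTop_atTop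
  have h1 := ((hcont ⟨oneParam v l t, hmem t⟩).tendsto _).comp (hlimE _ hτ)
  rw [hyw] at h1
  refine tendsto_nhds_unique h1 ?_
  have h2 := hlimE _ (tendsto_atTop_add_const_left atTop t hτ)
  rw [hyw] at h2
  refine h2.congr fun j => ?_
  rw [Function.comp_apply, ← Module.End.mul_apply, ← map_mul]
  congr 2
  ext : 1
  rw [Subgroup.coe_mul, ← oneParam_add]
  push_cast
  rfl

end

end

/-! ### The size of a group element -/

section

open Filter Topology
open scoped Matrix.Norms.L2Operator

variable {n : ℕ} {G K : Subgroup (Matrix.GeneralLinearGroup (Fin n) ℂ)}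

instance : FirstCountableTopology (Matrix.GeneralLinearGroup (Fin n) ℂ) := by
  have : FirstCountableTopology (Matrix (Fin n) (Fin n) ℂ)ᵐᵒᵖ :=
    MulOpposite.opHomeomorph.symm.isInducing.firstCountableTopology
  exact (Units.isInducing_embedProduct (M := Matrix (Fin n) (Fin n) ℂ)).firstCountableTopology

/-- The size `max 1 ‖g‖ ‖g⁻¹‖` of an invertible matrix, in the operator norm. -/
noncomputable def opSize (g : Matrix.GeneralLinearGroup (Fin n) ℂ) : ℝ :=
  max 1 (max ‖g.val‖ ‖g⁻¹.val‖)

theorem one_le_opSize (g : Matrix.GeneralLinearGroup (Fin n) ℂ) : 1 ≤ opSize g := le_max_left _ _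

theorem norm_le_opSize (g : Matrix.GeneralLinearGroup (Fin n) ℂ) : ‖g.val‖ ≤ opSize g :=
  (le_max_left _ _).trans (le_max_right _ _)

theorem norm_inv_le_opSize (g : Matrix.GeneralLinearGroup (Fin n) ℂ) : ‖g⁻¹.val‖ ≤ opSize g :=
  (le_max_right _ _).trans (le_max_right _ _)

theorem opSize_le {g : Matrix.GeneralLinearGroup (Fin n) ℂ} {C : ℝ} (h1 : 1 ≤ C)
    (h2 : ‖g.val‖ ≤ C) (h3 : ‖g⁻¹.val‖ ≤ C) : opSize g ≤ C := max_le h1 (max_le h2 h3)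

theorem opSize_mul_le (g h : Matrix.GeneralLinearGroup (Fin n) ℂ) :
    opSize (g * h) ≤ opSize g * opSize h := by
  have hg := one_le_opSize g
  have hh := one_le_opSize h
  refine opSize_le (by nlinarith) ?_ ?_
  · rw [Units.val_mul]
    exact (norm_mul_le _ _).trans (mul_le_mul (norm_le_opSize g) (norm_le_opSize h)
      (norm_nonneg _) (by linarith))
  · rw [mul_inv_rev, Units.val_mul, mul_comm (opSize g)]
    exact (norm_mul_le _ _).trans (mul_le_mul (norm_inv_le_opSize h) (norm_inv_le_opSize g)
      (norm_nonneg _) (by linarith))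

theorem continuous_opSize : Continuous (opSize (n := n)) :=
  continuous_const.max (Units.continuous_val.norm.max
    (Units.continuous_val.comp continuous_inv).norm)

theorem opSize_eq_one_of_mem_unitarySubgroup {k : Matrix.GeneralLinearGroup (Fin n) ℂ}
    (hk : k ∈ unitarySubgroup n) : opSize k = 1 :=
  le_antisymm (opSize_le le_rfl (norm_le_one_of_mem_unitarySubgroup hk)
    (norm_le_one_of_mem_unitarySubgroup ((unitarySubgroup n).inv_mem hk))) (one_le_opSize k)

theorem opSize_unitary_mul {k : Matrix.GeneralLinearGroup (Fin n) ℂ} (hk : k ∈ unitarySubgroup n)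
    (g : Matrix.GeneralLinearGroup (Fin n) ℂ) : opSize (k * g) = opSize g := by
  refine le_antisymm ?_ ?_
  · simpa [opSize_eq_one_of_mem_unitarySubgroup hk] using opSize_mul_le k g
  · simpa [opSize_eq_one_of_mem_unitarySubgroup ((unitarySubgroup n).inv_mem hk)] using
      opSize_mul_le k⁻¹ (k * g)

theorem opSize_mul_unitary {k : Matrix.GeneralLinearGroup (Fin n) ℂ} (hk : k ∈ unitarySubgroup n)
    (g : Matrix.GeneralLinearGroup (Fin n) ℂ) : opSize (g * k) = opSize g := by
  refine le_antisymm ?_ ?_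
  · simpa [opSize_eq_one_of_mem_unitarySubgroup hk] using opSize_mul_le g k
  · simpa [opSize_eq_one_of_mem_unitarySubgroup ((unitarySubgroup n).inv_mem hk)] using
      opSize_mul_le (g * k) k⁻¹

theorem opSize_oneParam {u : Matrix.GeneralLinearGroup (Fin n) ℂ} (hu : u ∈ unitarySubgroup n)
    (l : Fin n → ℝ) (z : ℂ) : opSize (oneParam u l z) = opSize (diagGL (expTorus l z)) := by
  rw [oneParam, opSize_mul_unitary ((unitarySubgroup n).inv_mem hu), opSize_unitary_mul hu]

theorem norm_expTorus (l : Fin n → ℝ) (t : ℝ) (i : Fin n) :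
    ‖(expTorus l t i : ℂ)‖ = Real.exp (t * l i) := by
  simp [expTorus, Complex.norm_exp]

theorem opSize_oneParam_le {u : Matrix.GeneralLinearGroup (Fin n) ℂ} (hu : u ∈ unitarySubgroup n)
    (l : Fin n → ℝ) (t : ℝ) : opSize (oneParam u l t) ≤ Real.exp (|t| * ‖l‖) := by
  have h : ∀ t : ℝ, ‖(diagGL (expTorus l t)).val‖ ≤ Real.exp (|t| * ‖l‖) := by
    intro t
    rw [coe_diagGL, Matrix.l2_opNorm_diagonal]
    refine (pi_norm_le_iff_of_nonneg (Real.exp_pos _).le).mpr fun i => ?_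
    rw [norm_expTorus, Real.exp_le_exp]
    calc t * l i ≤ |t * l i| := le_abs_self _
      _ = |t| * ‖l i‖ := abs_mul _ _
      _ ≤ |t| * ‖l‖ := mul_le_mul_of_nonneg_left (norm_le_pi_norm l i) (abs_nonneg t)
  rw [opSize_oneParam hu]
  refine opSize_le (Real.one_le_exp (by positivity)) (h t) ?_
  have h2 : (diagGL (expTorus l t))⁻¹ = diagGL (expTorus l ((-t : ℝ) : ℂ)) := by
    rw [← map_inv]
    congr 1
    push_cast
    rw [eq_comm, eq_inv_iff_mul_eq_one, ← expTorus_add, neg_add_cancel, expTorus_zero]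
  rw [h2, ← abs_neg t]
  exact h (-t)

theorem exp_norm_le_opSize_oneParam {u : Matrix.GeneralLinearGroup (Fin n) ℂ}
    (hu : u ∈ unitarySubgroup n) (l : Fin n → ℝ) :
    Real.exp ‖l‖ ≤ opSize (oneParam u l 1) := by
  have hpos := one_le_opSize (oneParam u l 1)
  rw [← Real.le_log_iff_exp_le (by linarith)]
  refine (pi_norm_le_iff_of_nonneg (Real.log_nonneg hpos)).mpr fun i => ?_
  have h : ∀ t : ℝ, Real.exp (t * l i) ≤ ‖(diagGL (expTorus l t)).val‖ := by
    intro t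
    rw [coe_diagGL, Matrix.l2_opNorm_diagonal, ← norm_expTorus]
    exact norm_le_pi_norm (fun i => (expTorus l t i : ℂ)) i
  have h2 : (diagGL (expTorus l 1))⁻¹ = diagGL (expTorus l ((-1 : ℝ) : ℂ)) := by
    rw [← map_inv]
    congr 1
    push_cast
    rw [eq_comm, eq_inv_iff_mul_eq_one, ← expTorus_add, neg_add_cancel, expTorus_zero]
  rw [opSize_oneParam hu] at hpos ⊢
  rw [Real.norm_eq_abs, abs_le']
  constructor
  · rw [Real.le_log_iff_exp_le (by linarith)]
    have := h 1
    rw [one_mul, Complex.ofReal_one] at this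
    exact this.trans (norm_le_opSize _)
  · rw [Real.le_log_iff_exp_le (by linarith)]
    have := h (-1)
    rw [neg_one_mul, ← h2] at this
    exact this.trans (norm_inv_le_opSize _)

/-! ### Closed one-parameter orbits imply a closed orbit -/

theorem tendsto_oneParam {u : ℕ → Matrix.GeneralLinearGroup (Fin n) ℂ} {l : ℕ → Fin n → ℝ}
    {u' : Matrix.GeneralLinearGroup (Fin n) ℂ} {l' : Fin n → ℝ}
    (h : Tendsto (fun k => (u k, l k)) atTop (𝓝 (u', l'))) (z : ℂ) :
    Tendsto (fun k => oneParam (u k) (l k) z) atTop (𝓝 (oneParam u' l' z)) := by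
  have h1 := (continuous_oneParam (n := n) z).tendsto (u', l')
  have h2 := Tendsto.comp h1 h
  exact h2

/-- Every orbit point is represented by a group element whose size `N` is almost minimal modulo the
stabiliser. -/
theorem exists_almost_minimal {W : Type*} [AddCommGroup W] [Module ℂ W] (ρ : Representation ℂ G W)
    (w : W) (N : G → ℝ) (hN : ∀ g, 1 ≤ N g) (g : G) :
    ∃ g' : G, ρ g' w = ρ g w ∧ ∀ s : G, ρ s w = w → N g' ≤ 2 * N (g' * s) := by
  set A : Set ℝ := {a | ∃ s : G, ρ s w = w ∧ N (g * s) = a} with hA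
  have hne : A.Nonempty := ⟨N (g * 1), 1, by simp, rfl⟩
  have hA1 : 1 ≤ sInf A := le_csInf hne (by rintro _ ⟨s, _, rfl⟩; exact hN _)
  obtain ⟨_, ⟨s₀, hs₀, rfl⟩, hlt⟩ := exists_lt_of_csInf_lt hne
    (show sInf A < 2 * sInf A by linarith)
  refine ⟨g * s₀, by rw [map_mul, Module.End.mul_apply, hs₀], fun s hs => ?_⟩
  have hbdd : BddBelow A := ⟨1, by rintro _ ⟨s, _, rfl⟩; exact hN _⟩
  have hs' : ρ (s₀ * s) w = w := by rw [map_mul, Module.End.mul_apply, hs, hs₀]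
  have : sInf A ≤ N (g * (s₀ * s)) := csInf_le hbdd ⟨s₀ * s, hs', rfl⟩
  rw [mul_assoc]
  linarith

/-- If `g` has Hermitian part `oneParam u l 1`, then on the segment from `1` to this Hermitian part
the vector `w` stays, by convexity, in the ball given by the end points. -/
theorem norm_oneParam_le_max {m : ℕ} {x u κ : Matrix.GeneralLinearGroup (Fin n) ℂ}
    (hxK : ∀ g ∈ G, x * g * x⁻¹ ∈ unitarySubgroup n → g ∈ K)
    {ρ : Representation ℂ G (EuclideanSpace ℂ (Fin m))} (hρ : IsRational ρ)
    (hK : ∀ k : G, (k : Matrix.GeneralLinearGroup (Fin n) ℂ) ∈ K → ∀ x, ‖ρ k x‖ = ‖x‖)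
    (w : EuclideanSpace ℂ (Fin m)) {l : Fin n → ℝ} (hmem : ∀ z, oneParam (x⁻¹ * u) l z ∈ G)
    (hinv : ∀ (θ : ℝ) y, ‖ρ ⟨oneParam (x⁻¹ * u) l (Complex.I * θ), hmem _⟩ y‖ = ‖y‖)
    {g : G} (hκ : κ ∈ unitarySubgroup n) (hpol : x * g.1 * x⁻¹ = κ * oneParam u l 1)
    {t : ℝ} (ht0 : 0 ≤ t) (ht1 : t ≤ 1) :
    ‖ρ ⟨oneParam (x⁻¹ * u) l t, hmem t⟩ w‖ ≤ max ‖w‖ ‖ρ g w‖ := by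
  obtain ⟨s, c, hc, hcinv⟩ := hρ.exists_expSum_norm (LinearEquiv.refl ℂ _) (x⁻¹ * u) l hmem hinv w
  simp only [LinearEquiv.refl_apply] at hc
  rw [hc]
  refine norm_expSum_le_of_le s c hcinv (T := 1) ?_ ?_ ht0 ht1
  · rw [← hc]
    have : (⟨oneParam (x⁻¹ * u) l 0, hmem 0⟩ : G) = 1 := Subtype.ext (oneParam_zero _ _)
    rw [this, map_one, Module.End.one_apply]
    exact le_max_left _ _
  · rw [Complex.ofReal_one, ← hc]
    set p : G := ⟨oneParam (x⁻¹ * u) l 1, hmem 1⟩ with hp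
    have h2 : x * (g * p⁻¹ : G).1 * x⁻¹ = κ := by
      have h3 : p.1 = x⁻¹ * oneParam u l 1 * x := by
        refine (oneParam_conj _ _ _ _).trans ?_
        rw [inv_inv]
      have h4 : x * g.1 * x⁻¹ * (oneParam u l 1)⁻¹ = κ := by
        rw [hpol, mul_inv_cancel_right]
      rw [Subgroup.coe_mul, Subgroup.coe_inv, h3, ← h4]
      group
    have h4 := hK (g * p⁻¹) (hxK _ (g * p⁻¹).2 (h2 ▸ hκ)) (ρ p w)
    rw [← Module.End.mul_apply, ← map_mul, inv_mul_cancel_right] at h4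
    rw [← h4]
    exact le_max_right _ _

/-- Suppose `G` is stable under polar decomposition after conjugation by `x`. A point of the closure
of the orbit is a limit of `ρ (g_j) w`, where the `g_j` may be taken of almost minimal size modulo
the stabiliser of `w`. If the sizes are bounded, a subsequence converges in `G`. Otherwise the
Hermitian parts of the `g_j` tend to infinity in a limit direction in which, by convexity, `w` moves
boundedly; this direction fixes `w`, and going back along it shortens the `g_j`. -/
theorem isClosed_orbit_of_isClosed_oneParam {m : ℕ}
    (hG : IsZariskiClosed (G : Set (Matrix.GeneralLinearGroup (Fin n) ℂ)))
    (x : Matrix.GeneralLinearGroup (Fin n) ℂ)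
    (hpolar : ∀ g ∈ G, ∃ k ∈ unitarySubgroup n, ∃ u ∈ unitarySubgroup n, ∃ l : Fin n → ℝ,
      x * g * x⁻¹ = k * oneParam u l 1 ∧ ∀ z, x⁻¹ * oneParam u l z * x ∈ G)
    (hxK : ∀ g ∈ G, x * g * x⁻¹ ∈ unitarySubgroup n → g ∈ K)
    {ρ : Representation ℂ G (EuclideanSpace ℂ (Fin m))} (hρ : IsRational ρ)
    (hK : ∀ k : G, (k : Matrix.GeneralLinearGroup (Fin n) ℂ) ∈ K → ∀ x, ‖ρ k x‖ = ‖x‖)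
    {w : EuclideanSpace ℂ (Fin m)}
    (hw : ∀ l : ℂˣ →* G, IsSpecialOneParam K l → IsClosed (Set.range fun z : ℂˣ => ρ (l z) w)) :
    IsClosed (orbit ρ w) := by
  let N : G → ℝ := fun g => opSize (x * g.1 * x⁻¹)
  have hρc : ∀ w, Continuous fun g : G => ρ g w := fun w => hρ.continuous LinearMap.id w
  have hGcl : IsClosed (G : Set (Matrix.GeneralLinearGroup (Fin n) ℂ)) := hG.isClosed
  have hconj : ∀ (u : Matrix.GeneralLinearGroup (Fin n) ℂ) (l : Fin n → ℝ) (z : ℂ),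
      oneParam (x⁻¹ * u) l z = x⁻¹ * oneParam u l z * x := fun u l z => by
    rw [oneParam_conj, inv_inv]
  -- The compact part of a one-parameter group in `G` acts isometrically.
  have hinv : ∀ u ∈ unitarySubgroup n, ∀ (l : Fin n → ℝ)
      (hmem : ∀ z, oneParam (x⁻¹ * u) l z ∈ G) (θ : ℝ) y,
      ‖ρ ⟨oneParam (x⁻¹ * u) l (Complex.I * θ), hmem _⟩ y‖ = ‖y‖ := by
    intro u hu l hmem θ y
    refine hK _ (hxK _ (hmem _) ?_) y
    change x * oneParam (x⁻¹ * u) l (Complex.I * θ) * x⁻¹ ∈ unitarySubgroup n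
    rw [hconj]
    simpa [mul_assoc] using oneParam_I_mul_mem_unitarySubgroup hu l θ
  have hmin : ∀ g : G, ∃ g' : G, ρ g' w = ρ g w ∧ ∀ s : G, ρ s w = w → N g' ≤ 2 * N (g' * s) :=
    exists_almost_minimal ρ w N fun _ => one_le_opSize _
  refine IsSeqClosed.isClosed fun y y₀ hy hlim => ?_
  choose g₀ hg₀ using hy
  choose g hg hgmin using fun j => hmin (g₀ j)
  have hgy : ∀ j, ρ (g j) w = y j := fun j => (hg j).trans (hg₀ j)
  by_cases hbdd : BddAbove (Set.range fun j => N (g j))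
  · obtain ⟨C, hC⟩ := hbdd
    have hcpt : IsCompact {h : Matrix.GeneralLinearGroup (Fin n) ℂ | ‖h.val‖ ≤ C ∧ ‖h⁻¹.val‖ ≤ C} :=
      isCompact_setOf_norm_le C
    obtain ⟨h, _, σ, hσ, hlimσ⟩ := hcpt.tendsto_subseq (x := fun j => x * (g j).1 * x⁻¹)
      (fun j => ⟨(norm_le_opSize _).trans (hC ⟨j, rfl⟩),
        (norm_inv_le_opSize _).trans (hC ⟨j, rfl⟩)⟩)
    have h1 : Tendsto (fun j => (g (σ j)).1) atTop (𝓝 (x⁻¹ * h * x)) := by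
      refine ((hlimσ.const_mul x⁻¹).mul_const x).congr fun j => ?_
      simp only [Function.comp_apply]
      group
    have h2 : x⁻¹ * h * x ∈ G := hGcl.mem_of_tendsto h1 (Eventually.of_forall fun j => (g (σ j)).2)
    have h3 : Tendsto (fun j => g (σ j)) atTop (𝓝 ⟨_, h2⟩) := tendsto_subtype_rng.mpr h1
    refine ⟨⟨_, h2⟩, tendsto_nhds_unique (((hρc w).tendsto _).comp h3) ?_⟩
    refine (hlim.comp hσ.tendsto_atTop).congr fun j => ?_
    exact (hgy (σ j)).symm
  · exfalso
    have hlarge : ∀ k : ℕ, ∃ j, (k : ℝ) < N (g j) := by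
      intro k
      by_contra! hcon
      exact hbdd ⟨k, by rintro _ ⟨j, rfl⟩; exact hcon j⟩
    choose J hJ using hlarge
    obtain ⟨C₀, hC₀⟩ := (Metric.isBounded_range_of_tendsto _ hlim).exists_norm_le
    set C := max ‖w‖ C₀ with hC
    choose κ hκ u hu l hpol hmem using fun k => hpolar (g (J k)).1 (g (J k)).2
    have hmem' : ∀ k z, oneParam (x⁻¹ * u k) (l k) z ∈ G := fun k z => hconj _ _ z ▸ hmem k z
    have hNexp : ∀ k, N (g (J k)) ≤ Real.exp ‖l k‖ := by
      intro k
      simp only [N]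
      rw [hpol, opSize_unitary_mul (hκ k)]
      have := opSize_oneParam_le (hu k) (l k) 1
      simpa using this
    have hexpN : ∀ k, Real.exp ‖l k‖ ≤ N (g (J k)) := by
      intro k
      simp only [N]
      rw [hpol, opSize_unitary_mul (hκ k)]
      exact exp_norm_le_opSize_oneParam (hu k) (l k)
    have hr : Tendsto (fun k => ‖l k‖) atTop atTop := by
      refine tendsto_atTop_mono (f := fun k : ℕ => Real.log k) (fun k => ?_)
        (Real.tendsto_log_atTop.comp tendsto_natCast_atTop_atTop)
      rcases Nat.eq_zero_or_pos k with rfl | hk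
      · simp
      · rw [Real.log_le_iff_le_exp (by exact_mod_cast hk)]
        exact (hJ k).le.trans (hNexp k)
    -- A limit `(u', l')` of the unitary parts and the normalised directions.
    have hlhat : ∀ k, (‖l k‖⁻¹ • l k) ∈ Metric.closedBall (0 : Fin n → ℝ) 1 := by
      intro k
      rw [mem_closedBall_zero_iff, norm_smul, norm_inv, norm_norm]
      exact inv_mul_le_one
    obtain ⟨⟨u', l'⟩, ⟨hu', _⟩, σ, hσ, hlimσ⟩ :=
      ((isCompact_unitarySubgroup (n := n)).prod
        (isCompact_closedBall (0 : Fin n → ℝ) 1)).tendsto_subseq (x := fun k => (u k, ‖l k‖⁻¹ • l k)) fun k => ⟨hu k, hlhat k⟩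
    have hu'U : u' ∈ unitarySubgroup n := hu'
    have hlimσ' : Tendsto (fun k => (u (σ k), ‖l (σ k)‖⁻¹ • l (σ k))) atTop (𝓝 (u', l')) := hlimσ
    have hlimE : ∀ z, Tendsto (fun k => oneParam (u (σ k)) (‖l (σ k)‖⁻¹ • l (σ k)) z) atTop
        (𝓝 (oneParam u' l' z)) := tendsto_oneParam hlimσ'
    have hlimE' : ∀ z, Tendsto (fun k => oneParam (x⁻¹ * u (σ k)) (‖l (σ k)‖⁻¹ • l (σ k)) z) atTop
        (𝓝 (oneParam (x⁻¹ * u') l' z)) := fun z => by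
      simp only [hconj]
      exact ((hlimE z).const_mul _).mul_const _
    have hmemhat : ∀ k z, oneParam (x⁻¹ * u k) (‖l k‖⁻¹ • l k) z ∈ G := fun k z => by
      rw [oneParam_smul]
      exact hmem' k _
    have hmemlim : ∀ z, oneParam (x⁻¹ * u') l' z ∈ G := fun z =>
      hGcl.mem_of_tendsto (hlimE' z) (Eventually.of_forall fun k => hmemhat (σ k) z)
    have hbound : ∀ k, ∀ t : ℝ, 0 ≤ t → t ≤ 1 →
        ‖ρ ⟨oneParam (x⁻¹ * u k) (l k) t, hmem' k t⟩ w‖ ≤ C := by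
      intro k t ht0 ht1
      refine (norm_oneParam_le_max hxK hρ hK w (hmem' k) (hinv (u k) (hu k) (l k) (hmem' k)) (hκ k)
        (hpol k) ht0 ht1).trans (max_le_max le_rfl ?_)
      rw [hgy]
      exact hC₀ _ ⟨_, rfl⟩
    have hboundlim : ∀ t : ℝ, 0 ≤ t → ‖ρ ⟨oneParam (x⁻¹ * u') l' t, hmemlim t⟩ w‖ ≤ C := by
      intro t ht
      have h1 : Tendsto (fun k => (⟨_, hmemhat (σ k) t⟩ : G)) atTop (𝓝 ⟨_, hmemlim t⟩) :=
        tendsto_subtype_rng.mpr (hlimE' t)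
      refine le_of_tendsto (((hρc w).norm.tendsto _).comp h1) ?_
      filter_upwards [(hr.comp hσ.tendsto_atTop).eventually_ge_atTop (max t 1)] with k hk
      have hk' : max t 1 ≤ ‖l (σ k)‖ := hk
      have hk1 : 1 ≤ ‖l (σ k)‖ := (le_max_right _ _).trans hk'
      have h2 := hbound (σ k) (t * ‖l (σ k)‖⁻¹) (by positivity) (by
        rw [← div_eq_mul_inv, div_le_one (by linarith)]
        exact (le_max_left _ _).trans hk')
      refine le_trans (le_of_eq ?_) h2
      rw [Function.comp_apply]
      congr 4
      rw [oneParam_smul]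
      push_cast
      rfl
    have hfix := oneParam_fix_of_bounded hG hρ (x⁻¹ * u') l' hmemlim (hinv u' hu'U l' hmemlim)
      (fun z hz hzG => by
        refine hxK _ hzG ?_
        have h1 : x * (x⁻¹ * u' * diagGL z * (x⁻¹ * u')⁻¹) * x⁻¹ = u' * diagGL z * u'⁻¹ := by
          group
        rw [h1]
        refine (unitarySubgroup n).mul_mem ((unitarySubgroup n).mul_mem hu'U ?_)
          ((unitarySubgroup n).inv_mem hu'U)
        rw [mem_unitarySubgroup, coe_diagGL, Matrix.star_eq_conjTranspose,
          Matrix.diagonal_conjTranspose, Matrix.diagonal_mul_diagonal, ← Matrix.diagonal_one]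
        congr 1
        funext i
        simp only [Pi.star_apply, RCLike.star_def]
        rw [Complex.conj_mul', hz i]
        norm_num) hw hboundlim
    -- Multiplying `g (J k)` by the element at time `-2` of the limit direction divides its size by
    -- about `exp 2`, which exceeds `2 * (3 / 2)`: this contradicts almost minimality.
    have hstep : ∀ᶠ _ : ℕ in atTop, False := by
      have hδ : Tendsto (fun k => opSize (oneParam (u (σ k)) (‖l (σ k)‖⁻¹ • l (σ k)) 2 *
          oneParam u' l' ((-2 : ℝ) : ℂ))) atTop (𝓝 1) := by
        have h1 := ((hlimE 2).mul_const (oneParam u' l' ((-2 : ℝ) : ℂ)))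
        have h2 : oneParam u' l' 2 * oneParam u' l' ((-2 : ℝ) : ℂ) = 1 := by
          rw [← oneParam_add]
          norm_num [oneParam_zero]
        rw [h2] at h1
        have h3 := (continuous_opSize.tendsto _).comp h1
        rwa [opSize_eq_one_of_mem_unitarySubgroup (unitarySubgroup n).one_mem] at h3
      filter_upwards [hδ.eventually_lt_const (show (1 : ℝ) < 3 / 2 by norm_num),
        (hr.comp hσ.tendsto_atTop).eventually_ge_atTop 2] with k hk hk2
      have hk2' : 2 ≤ ‖l (σ k)‖ := hk2
      set r := ‖l (σ k)‖ with hrdef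
      have h1 := hgmin (J (σ k)) ⟨oneParam (x⁻¹ * u') l' ((-2 : ℝ) : ℂ), hmemlim _⟩ (hfix (-2))
      have h2 : x * (g (J (σ k)) * ⟨oneParam (x⁻¹ * u') l' ((-2 : ℝ) : ℂ), hmemlim _⟩ : G).1 * x⁻¹ =
          κ (σ k) * (oneParam (u (σ k)) (l (σ k)) ((1 - 2 / r : ℝ) : ℂ) *
            (oneParam (u (σ k)) (r⁻¹ • l (σ k)) 2 * oneParam u' l' ((-2 : ℝ) : ℂ))) := by
        have h3 : oneParam (u (σ k)) (l (σ k)) 1 =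
            oneParam (u (σ k)) (l (σ k)) ((1 - 2 / r : ℝ) : ℂ) *
              oneParam (u (σ k)) (r⁻¹ • l (σ k)) 2 := by
          rw [oneParam_smul, ← oneParam_add]
          congr 1
          push_cast
          ring
        rw [← mul_assoc (oneParam _ _ _), ← h3, ← mul_assoc, ← hpol]
        change x * ((g (J (σ k))).1 * oneParam (x⁻¹ * u') l' ((-2 : ℝ) : ℂ)) * x⁻¹ = _
        rw [hconj]
        group
      have h4 : N (g (J (σ k)) * ⟨oneParam (x⁻¹ * u') l' ((-2 : ℝ) : ℂ), hmemlim _⟩) ≤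
          Real.exp (r - 2) * (3 / 2) := by
        simp only [N]
        rw [h2, opSize_unitary_mul (hκ _)]
        refine (opSize_mul_le _ _).trans (mul_le_mul ?_ hk.le
          (zero_le_one.trans (one_le_opSize _)) (Real.exp_pos _).le)
        refine (opSize_oneParam_le (hu _) _ _).trans (Real.exp_le_exp.mpr (le_of_eq ?_))
        have h5 : 0 ≤ 1 - 2 / r := by
          rw [sub_nonneg, div_le_one (by linarith)]
          exact hk2'
        rw [abs_of_nonneg h5, ← hrdef]
        field_simp
      have h6 := hexpN (σ k)
      rw [← hrdef] at h6
      have h7 : Real.exp r = Real.exp (r - 2) * Real.exp 2 := by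
        rw [← Real.exp_add]; ring_nf
      have h8 : (3 : ℝ) < Real.exp 2 := by
        have := Real.add_one_lt_exp (x := 2) (by norm_num)
        linarith
      nlinarith [Real.exp_pos (r - 2)]
    simpa using hstep.exists

/-! ### The stability criterion -/

/-- By maximality, a maximal compact subgroup which is conjugated into the unitary group consists of
all elements of `G` with unitary conjugate. -/
theorem IsMaximalCompact.mem_of_conj_mem_unitarySubgroup (hK : IsMaximalCompact G K)
    (hGcl : IsClosed (G : Set (Matrix.GeneralLinearGroup (Fin n) ℂ)))
    {x : Matrix.GeneralLinearGroup (Fin n) ℂ} (hx : ∀ k ∈ K, x * k * x⁻¹ ∈ unitarySubgroup n)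
    {g : Matrix.GeneralLinearGroup (Fin n) ℂ} (hg : g ∈ G)
    (hgx : x * g * x⁻¹ ∈ unitarySubgroup n) : g ∈ K := by
  let H := G ⊓ (unitarySubgroup n).comap (MulAut.conj x).toMonoidHom
  have hH : IsCompact (H : Set (Matrix.GeneralLinearGroup (Fin n) ℂ)) := by
    have h1 : IsCompact ((fun g => x * g * x⁻¹) ⁻¹'
        (unitarySubgroup n : Set (Matrix.GeneralLinearGroup (Fin n) ℂ))) :=
      ((Homeomorph.mulLeft x).trans (Homeomorph.mulRight x⁻¹)).isClosedEmbedding.isCompact_preimage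
        isCompact_unitarySubgroup
    exact h1.inter_left hGcl
  exact hK.2 ⟨inf_le_left, hH⟩ (fun k hk => ⟨hK.1.1 hk, hx k hk⟩) ⟨hg, hgx⟩

/-- The criterion for a representation on `ℂ^m` whose standard norm is invariant under the maximal
compact subgroup. -/
theorem isClosed_orbit_iff {m : ℕ} (hG : IsReductive G) (hGK : IsMaximalCompact G K)
    {ρ : Representation ℂ G (EuclideanSpace ℂ (Fin m))} (hρ : IsRational ρ)
    (hK : ∀ k : G, (k : Matrix.GeneralLinearGroup (Fin n) ℂ) ∈ K → ∀ x, ‖ρ k x‖ = ‖x‖)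
    (w : EuclideanSpace ℂ (Fin m)) :
    IsClosed (orbit ρ w) ↔ ∃ w' ∈ orbit ρ w, ∀ l : ℂˣ →* G, IsSpecialOneParam K l →
      IsClosed (Set.range fun z : ℂˣ => ρ (l z) w') := by
  constructor
  · intro h
    obtain ⟨_, ⟨g, rfl⟩, hmin⟩ := exists_norm_le_of_isClosed h (Set.range_nonempty _)
    refine ⟨_, ⟨g, rfl⟩, fun l hl => isClosed_range_of_norm_minimal hρ hK (fun h => ?_) hl⟩
    exact hmin _ ⟨h * g, by simp⟩
  · rintro ⟨_, ⟨g, rfl⟩, hl⟩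
    have horb : orbit ρ w = orbit ρ (ρ g w) := by
      refine Set.Subset.antisymm ?_ ?_
      · rintro _ ⟨h, rfl⟩
        refine ⟨h * g⁻¹, ?_⟩
        change ρ (h * g⁻¹) (ρ g w) = ρ h w
        rw [← Module.End.mul_apply, ← map_mul, inv_mul_cancel_right]
      · rintro _ ⟨h, rfl⟩
        exact ⟨h * g, by simp⟩
    rw [horb]
    obtain ⟨x, hxK, hpolar⟩ := hG.exists_conj_polar hGK.1.1 hGK.1.2
    exact isClosed_orbit_of_isClosed_oneParam hG.isZariskiClosed x hpolar
      (fun g hg h => hGK.mem_of_conj_mem_unitarySubgroup hG.isZariskiClosed.isClosed hxK hg h)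
      hρ hK hl

end

end LinAlgGrp

theorem theorem3p2 {n : ℕ} (G Gc : Subgroup (Matrix.GeneralLinearGroup (Fin n) ℂ))
    (hG : LinAlgGrp.IsReductive G) (hconn : LinAlgGrp.IsZariskiConnected G)
    (hGc : LinAlgGrp.IsMaximalCompact G Gc)
    {W : Type*} [AddCommGroup W] [Module ℂ W] [FiniteDimensional ℂ W]
    [TopologicalSpace W] [IsTopologicalAddGroup W] [ContinuousSMul ℂ W] [T2Space W]
    (ρ : Representation ℂ G W) (hρ : LinAlgGrp.IsRational ρ) (w : W) (hw : w ≠ 0) :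
    LinAlgGrp.IsStable ρ w ↔
      ∃ w' ∈ LinAlgGrp.orbit ρ w, ∀ l : ℂˣ →* G, LinAlgGrp.IsSpecialOneParam Gc l →
        IsClosed (Set.range (fun z : ℂˣ => ρ (l z) w')) := by
  -- Transport the representation to a Euclidean space with `Gc`-invariant norm.
  obtain ⟨m, φ, hφ⟩ := LinAlgGrp.exists_unitarization hGc.1.1 hGc.1.2 hρ
  let ψ : W ≃L[ℂ] EuclideanSpace ℂ (Fin m) := φ.toContinuousLinearEquiv
  let τ : Representation ℂ G (EuclideanSpace ℂ (Fin m)) :=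
    { toFun := fun g => φ.toLinearMap ∘ₗ ρ g ∘ₗ φ.symm.toLinearMap
      map_one' := LinearMap.ext fun v => by simp
      map_mul' := fun g h => LinearMap.ext fun v => by simp }
  have hτ : LinAlgGrp.IsRational τ := fun f v => hρ (f ∘ₗ φ.toLinearMap) (φ.symm v)
  have hτφ : ∀ g v, τ g (φ v) = φ (ρ g v) := fun g v => by simp [τ]
  have hτK : ∀ k : G, (k : Matrix.GeneralLinearGroup (Fin n) ℂ) ∈ Gc → ∀ x, ‖τ k x‖ = ‖x‖ := by
    intro k hk x
    obtain ⟨v, rfl⟩ := φ.surjective x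
    rw [hτφ, hφ k hk]
  have hclosed : ∀ {ι : Type} (f : ι → W),
      IsClosed (Set.range fun i => φ (f i)) ↔ IsClosed (Set.range f) := by
    intro ι f
    have : (Set.range fun i => φ (f i)) = ψ.toHomeomorph '' Set.range f := by
      rw [← Set.range_comp]; rfl
    rw [this, Homeomorph.isClosed_image]
  have key := LinAlgGrp.isClosed_orbit_iff hG hGc hτ hτK (φ w)
  simp only [LinAlgGrp.orbit, Set.exists_range_iff, hτφ, hclosed] at key
  simp only [LinAlgGrp.IsStable, LinAlgGrp.orbit, Set.exists_range_iff]
  rw [← key]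
  exact and_iff_right hw
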